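/- Let $J_v,J_y\subseteq\mathbb R$ and $J_r\subseteq(0,\infty)$ be open intervals, let $A:J_y\to\mathbb R$ be smooth with $A'(y)\neq0$ for all $y\in J_y$, and let $m,\phi,\chi$ be smooth real functions of $(v,r,y)\in J_v\times J_r\times J_y$. Consider the five-dimensional metric $$ds^2=e^{2A(y)}\Big[-\Big(1-\frac{2m(v,r,y)}{r}\Big)dv^2+2\,dv\,dr+r^2(d\theta^2+\sin^2\theta\,d\varphi^2)\Big]+dy^2 ,$$ sourced by the two scalar fields $\phi,\chi$, which are coupled to gravity through a function $f(\phi,\chi)$ that is smooth on an open set containing the values of $(\phi,\chi)$ and satisfies $f(\phi,\chi)\neq0$ at all points. Assume that the field equations $$f\,G_{MN}=T_{MN}-g_{MN}\Lambda_B,$$ $$T_{MN}=\partial_M\phi\,\partial_N\phi+\partial_M\chi\,\partial_N\chi-g_{MN}\Big[\tfrac12(\partial\phi)^2+\tfrac12(\partial\chi)^2+V(\phi,\chi)\Big]+\nabla_M\nabla_Nf-g_{MN}\square f$$ hold for some function $V(\phi,\chi)$ and some constant $\Lambda_B$ (the gravitational constant is absorbed in $f$). A function of $(v,r,y)$ is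 said to depend on a coordinate if the corresponding partial derivative does not vanish identically on $J_v\times J_r\times J_y$. Assume that each of $\phi$ and $\chi$ depends on at most two of the coordinates $(v,r,y)$. This contains, up to exchange of $\phi$ and $\chi$, all $21$ cases in which each field depends on exactly one or exactly two of the coordinates. Then the following holds. 1. Some field depends on $r$, but no field depends on both $r$ and $y$ (the cases $\{\phi(v),\chi(r)\}$, $\{\phi(r),\chi(r)\}$, $\{\phi(r),\chi(y)\}$, $\{\phi(v,r),\chi(v)\}$, $\{\phi(v,r),\chi(r)\}$, $\{\phi(v,r),\chi(y)\}$, $\{\phi(v,y),\chi(r)\}$, $\{\phi(v,r),\chi(v,r)\}$, $\{\phi(v,r),\chi(v,y)\}$): this is impossible, that is, the field equations are inconsistent. 2. No field depends on $r$ (the cases $\{\phi(v),\chi(v)\}$, $\{\phi(v),\chi(y)\}$, $\{\phi(y),\chi(y)\}$, $\{\phi(v,y),\chi(v)\}$, $\{\phi(v,y),\chi(y)\}$, $\{\phi(v,y),\chi(v,y)\}$): then $\partial_v[f(\phi,\chi)]=0$ (so the equations are inconsistent if the coupling depends on $v$), and $m(v,r,y)=m_0(v)\frac{r^3}{3}+m_1(v)$;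 in particular $\partial_ym=0$. 3. In all cases, and so in the remaining ones, where some field depends on both $r$ and $y$ ($\{\phi(r,y),\chi(v)\}$, $\{\phi(r,y),\chi(r)\}$, $\{\phi(r,y),\chi(y)\}$, $\{\phi(v,r),\chi(r,y)\}$, $\{\phi(v,y),\chi(r,y)\}$, $\{\phi(r,y),\chi(r,y)\}$): suppose that $m$ is a finite power series $m(v,r,y)=\sum_{n\in S}a_n(v,y)r^n$ with $S\subset\mathbb Z$ finite (positive and negative powers allowed). Then for every $v\in J_v$ either $\partial_ym(v,r,y)=0$ for all $(r,y)\in J_r\times J_y$, or $m(v,\cdot,\cdot)$ does not have the profile of a black hole, in the following sense: $a_n(v,y)=0$ for all $n\in S$ with $n\le0$ and all $y\in J_y$ (there is no mass at the centre $r=0$), $1\in S$, and $a_1(v,y)=c$ for all $y\in J_y$ with a constant $c>\frac12$. 4. There is no brane-localized black hole: if $J_y$ is unbounded above and $m(v,r,y)\to0$ as $y\to\infty$ for all $(v,r)\in J_v\times J_r$, and if in the cases where some field depends on both $r$ and $y$ the function $m$ is a finite power series in $r$ as in 3, then $m=0$ identically. -/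

import Mathlib

open Set Filter Topology
open scoped ContDiff

namespace WarpedVaidya

noncomputable section

/-! ### Tensor calculus in one coordinate chart of a five-dimensional spacetime

Points are `x : Fin 5 → ℝ`; the coordinates are `x 0 = v`, `x 1 = r`, `x 2 = θ`, `x 3 = ϕ`
(the azimuth) and `x 4 = y`. -/

/-- The partial derivative of `h` with respect to the `i`-th coordinate, at `x`. -/
def pd (i : Fin 5) (h : (Fin 5 → ℝ) → ℝ) (x : Fin 5 → ℝ) : ℝ :=
  deriv (fun t => h (Function.update x i t)) (x i)

/-- A field of `5 × 5` matrices: the components of a covariant 2-tensor field. -/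
abbrev TensorField := (Fin 5 → ℝ) → Matrix (Fin 5) (Fin 5) ℝ

/-- Christoffel symbols `Γ^K_{MN} = ½ g^{KL} (∂_N g_{ML} + ∂_M g_{NL} - ∂_L g_{MN})`. -/
def christoffel (g : TensorField) (K M N : Fin 5) (x : Fin 5 → ℝ) : ℝ :=
  (1 / 2) * ∑ L, (g x)⁻¹ K L *
    (pd N (fun z => g z M L) x + pd M (fun z => g z N L) x - pd L (fun z => g z M N) x)

/-- Ricci tensor
`R_{MN} = ∂_K Γ^K_{MN} - ∂_N Γ^K_{MK} + Γ^K_{KL} Γ^L_{MN} - Γ^K_{NL} Γ^L_{MK}`. -/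
def ricci (g : TensorField) (x : Fin 5 → ℝ) (M N : Fin 5) : ℝ :=
  ∑ K, (pd K (christoffel g K M N) x - pd N (christoffel g K M K) x
    + ∑ L, (christoffel g K K L x * christoffel g L M N x
      - christoffel g K N L x * christoffel g L M K x))

/-- The trace `g^{MN} B_{MN}` of a covariant 2-tensor at `x`. -/
def trace (g : TensorField) (x : Fin 5 → ℝ) (B : Fin 5 → Fin 5 → ℝ) : ℝ :=
  ∑ M, ∑ N, (g x)⁻¹ M N * B M N

/-- Einstein tensor `G_{MN} = R_{MN} - ½ R g_{MN}`. -/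
def einstein (g : TensorField) (x : Fin 5 → ℝ) (M N : Fin 5) : ℝ :=
  ricci g x M N - (1 / 2) * trace g x (ricci g x) * g x M N

/-- Second covariant derivative of a function: `∇_M ∇_N h = ∂_M ∂_N h - Γ^K_{MN} ∂_K h`. -/
def hessian (g : TensorField) (h : (Fin 5 → ℝ) → ℝ) (x : Fin 5 → ℝ) (M N : Fin 5) : ℝ :=
  pd M (pd N h) x - ∑ K, christoffel g K M N x * pd K h x

/-- Energy-momentum tensor of two scalar fields `φ, χ` with potential energy `W` and
non-minimal coupling `F` (all taken as functions on spacetime):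
`T_{MN} = ∂_M φ ∂_N φ + ∂_M χ ∂_N χ - g_{MN} (½ (∂φ)² + ½ (∂χ)² + W) + ∇_M ∇_N F - g_{MN} □ F`. -/
def energyMomentum (g : TensorField) (φ χ F W : (Fin 5 → ℝ) → ℝ) (x : Fin 5 → ℝ)
    (M N : Fin 5) : ℝ :=
  pd M φ x * pd N φ x + pd M χ x * pd N χ x
    - g x M N * (trace g x (fun K L => pd K φ x * pd L φ x) / 2
      + trace g x (fun K L => pd K χ x * pd L χ x) / 2 + W x)
    + hessian g F x M N - g x M N * trace g x (hessian g F x)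

/-! ### The warped generalized Vaidya geometry and its field equations -/

/-- The metric `e^{2A(y)} [-(1 - 2 m(v,r,y)/r) dv² + 2 dv dr + r² (dθ² + sin² θ dϕ²)] + dy²`. -/
def metric (A : ℝ → ℝ) (m : ℝ → ℝ → ℝ → ℝ) : TensorField := fun x =>
  !![-(Real.exp (2 * A (x 4)) * (1 - 2 * m (x 0) (x 1) (x 4) / x 1)),
        Real.exp (2 * A (x 4)), 0, 0, 0;
     Real.exp (2 * A (x 4)), 0, 0, 0, 0;
     0, 0, Real.exp (2 * A (x 4)) * x 1 ^ 2, 0, 0;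
     0, 0, 0, Real.exp (2 * A (x 4)) * x 1 ^ 2 * Real.sin (x 2) ^ 2, 0;
     0, 0, 0, 0, 1]

/-- The function on spacetime given by a function of `(v, r, y)`. -/
def lift (h : ℝ → ℝ → ℝ → ℝ) : (Fin 5 → ℝ) → ℝ := fun x => h (x 0) (x 1) (x 4)

/-- The field equations `f(φ,χ) G_{MN} = T_{MN} - g_{MN} Λ` (the gravitational constant is absorbed
in `f`) at all points with `v ∈ Jv`, `r ∈ Jr`, `0 < θ < π`, `y ∈ Jy`. -/
def FieldEquations (Jv Jr Jy : Set ℝ) (A : ℝ → ℝ) (m φ χ : ℝ → ℝ → ℝ → ℝ)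
    (f V : ℝ → ℝ → ℝ) (Λ : ℝ) : Prop :=
  ∀ x : Fin 5 → ℝ, x 0 ∈ Jv → x 1 ∈ Jr → x 2 ∈ Ioo 0 Real.pi → x 4 ∈ Jy → ∀ M N : Fin 5,
    f (lift φ x) (lift χ x) * einstein (metric A m) x M N =
      energyMomentum (metric A m) (lift φ) (lift χ) (fun z => f (lift φ z) (lift χ z))
        (fun z => V (lift φ z) (lift χ z)) x M N
      - metric A m x M N * Λ

/-! ### Functions of `(v, r, y)` -/

/-- Smoothness of a function of `(v, r, y)` on the box `Jv × Jr × Jy`. -/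
def SmoothOn (Jv Jr Jy : Set ℝ) (h : ℝ → ℝ → ℝ → ℝ) : Prop :=
  ContDiffOn ℝ ∞ (fun p : ℝ × ℝ × ℝ => h p.1 p.2.1 p.2.2) (Jv ×ˢ Jr ×ˢ Jy)

/-- `∂h/∂v`. -/
def dv (h : ℝ → ℝ → ℝ → ℝ) (v r y : ℝ) : ℝ := deriv (fun t => h t r y) v

/-- `∂h/∂r`. -/
def dr (h : ℝ → ℝ → ℝ → ℝ) (v r y : ℝ) : ℝ := deriv (fun t => h v t y) r

/-- `∂h/∂y`. -/
def dy (h : ℝ → ℝ → ℝ → ℝ) (v r y : ℝ) : ℝ := deriv (fun t => h v r t) y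

/-- A function of `(v, r, y)` with partial derivative `d` depends on the corresponding coordinate
on the box if `d` does not vanish identically there. -/
def NonzeroOn (Jv Jr Jy : Set ℝ) (d : ℝ → ℝ → ℝ → ℝ) : Prop :=
  ∃ v ∈ Jv, ∃ r ∈ Jr, ∃ y ∈ Jy, d v r y ≠ 0

/-- `h` depends on the coordinate `v`. -/
def DependsOnV (Jv Jr Jy : Set ℝ) (h : ℝ → ℝ → ℝ → ℝ) : Prop := NonzeroOn Jv Jr Jy (dv h)

/-- `h` depends on the coordinate `r`. -/
def DependsOnR (Jv Jr Jy : Set ℝ) (h : ℝ → ℝ → ℝ → ℝ) : Prop := NonzeroOn Jv Jr Jy (dr h)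

/-- `h` depends on the coordinate `y`. -/
def DependsOnY (Jv Jr Jy : Set ℝ) (h : ℝ → ℝ → ℝ → ℝ) : Prop := NonzeroOn Jv Jr Jy (dy h)

/-- `h` depends on at most two of the three coordinates `v`, `r`, `y`. -/
def DependsOnAtMostTwo (Jv Jr Jy : Set ℝ) (h : ℝ → ℝ → ℝ → ℝ) : Prop :=
  ¬ (DependsOnV Jv Jr Jy h ∧ DependsOnR Jv Jr Jy h ∧ DependsOnY Jv Jr Jy h)

/-- `h` depends both on `r` and on `y`. -/
def DependsOnRY (Jv Jr Jy : Set ℝ) (h : ℝ → ℝ → ℝ → ℝ) : Prop :=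
  DependsOnR Jv Jr Jy h ∧ DependsOnY Jv Jr Jy h

/-- `m(v,r,y) = ∑_{n ∈ S} a_n(v,y) r^n` is a finite power series in `r`, in which positive and
negative powers are allowed. -/
def IsFinitePowerSeries (Jv Jr Jy : Set ℝ) (m : ℝ → ℝ → ℝ → ℝ) (S : Finset ℤ)
    (a : ℤ → ℝ → ℝ → ℝ) : Prop :=
  ∀ v ∈ Jv, ∀ r ∈ Jr, ∀ y ∈ Jy, m v r y = ∑ n ∈ S, a n v y * r ^ n

/-- At advanced time `v`, the mass profile `∑_{n ∈ S} a_n(v,y) r^n` is not that of a black hole: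
it has no constant term and no negative powers of `r`, so that there is no mass at the centre
`r = 0`, and it starts with a linear term `c r` with the same coefficient `c > 1/2` at all `y`. -/
def NonBlackHoleProfile (Jy : Set ℝ) (S : Finset ℤ) (a : ℤ → ℝ → ℝ → ℝ) (v : ℝ) : Prop :=
  (∀ n ∈ S, n ≤ 0 → ∀ y ∈ Jy, a n v y = 0) ∧
    1 ∈ S ∧ ∃ c : ℝ, 1 / 2 < c ∧ ∀ y ∈ Jy, a 1 v y = c

/-- The mass is localized near the brane: the extra dimension extends to `y → ∞`, and the mass
function tends to zero there. -/
def BraneLocalized (Jv Jr Jy : Set ℝ) (m : ℝ → ℝ → ℝ → ℝ) : Prop :=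
  ¬ BddAbove Jy ∧ ∀ v ∈ Jv, ∀ r ∈ Jr, Tendsto (fun y => m v r y) atTop (𝓝 0)

end

end WarpedVaidya

open WarpedVaidya

/-! Write F = f(φ, χ), E = e^{2A}, and subscripts for partial derivatives. In the field equations
the potential, Λ and all trace terms multiply g_{MN}; eliminating them leaves six scalar equations
(`ComponentEquations`). These are manipulated as polynomial identities in a ring with three
commuting derivations (`ReducedSystem`), realized by the smooth functions on the box.

The rr and ry equations read φ_r² + χ_r² + F_rr = 0 and φ_r φ_y + χ_r χ_y + F_ry = A' F_r.
Cross-differentiation eliminates F and gives φ_r φ_ry − φ_rr φ_y + (the same for χ) = A' (φ_r² +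
χ_r²). If no field depends on both r and y, the left side is zero, so φ_r = χ_r = 0 because A' ≠ 0
(`vanishesOn_radial`). This is the first claim. Without radial dependence the remaining equations
are polynomial in r up to the unknown m, and comparison of powers of r gives the second claim
(`of_no_radial`).

For the third claim one may assume, after exchanging the fields, that φ_v = 0 and that χ lacks one
coordinate; in the other case no field depends on r. Then F_v = α + rβ, and the vy equation
integrates to 3 r m_y F = k + r³ K, with α, β, k, K independent of r. Elimination of F from the
remaining equations gives an equation for m alone with coefficients independent of r
(`MassEquation`, `radial_eq`). For a Laurent polynomial m there are two possibilities. If k ≠ 0, the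
lowest order in r forces all powers n ≤ 0 to vanish and 2 a₁ d = d + 1, where d ≥ 1 is the lowest
exponent of m_y (`rigidCoefficients_of_radial_eq`); so a₁ > 1/2. If k = 0, then 3 m_y F = r² K. Its
v-derivative is a Riccati-like equation for m_y, and wherever (α, β) ≠ 0 it makes m_y a monomial of
degree 1 or 2 at suitable points (`support_of_riccati`). Then F_rr = 0, hence φ_r = χ_r = 0 there,
which cannot hold densely where m_y ≠ 0. So α = β = 0, which forces K = 0 and m_y = 0, a
contradiction.

Thus the coefficients are rigid wherever m_y ≠ 0. As a₁ has only finitely many possible values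
there, it is constant in y. For the fourth claim, a constant a₁ > 1/2 contradicts m → 0, so m_y = 0
and the limit gives m = 0. -/

namespace WarpedVaidya

noncomputable section

/-! ### The differential ring of smooth functions on an open set of `ℝ³` -/

/-- The algebra of smooth functions on an open set of `ℝ³`. -/
def SmoothAlg (U : TopologicalSpace.Opens (ℝ × ℝ × ℝ)) : Subalgebra ℝ (U → ℝ) where
  carrier := {h | ∃ g : ℝ × ℝ × ℝ → ℝ, ContDiffOn ℝ ∞ g U ∧ ∀ p : U, h p = g p}
  mul_mem' := by
    rintro a b ⟨g, hg, hag⟩ ⟨k, hk, hbk⟩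
    exact ⟨fun p => g p * k p, hg.mul hk, fun p => by simp [hag, hbk]⟩
  add_mem' := by
    rintro a b ⟨g, hg, hag⟩ ⟨k, hk, hbk⟩
    exact ⟨fun p => g p + k p, hg.add hk, fun p => by simp [hag, hbk]⟩
  algebraMap_mem' := fun c => ⟨fun _ => c, contDiffOn_const, fun p => by simp⟩

variable {U : TopologicalSpace.Opens (ℝ × ℝ × ℝ)}

namespace SmoothAlg

/-- An extension of a smooth function to the whole space. -/
def rep (h : SmoothAlg U) : ℝ × ℝ × ℝ → ℝ := h.2.choose

lemma contDiffOn_rep (h : SmoothAlg U) : ContDiffOn ℝ ∞ (rep h) U := h.2.choose_spec.1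

lemma rep_apply (h : SmoothAlg U) (p : U) : (rep h) p = h.1 p := (h.2.choose_spec.2 p).symm

/-- The smooth function given by a function that is smooth on the open set. -/
def of (g : ℝ × ℝ × ℝ → ℝ) (hg : ContDiffOn ℝ ∞ g U) : SmoothAlg U :=
  ⟨fun p => g p, g, hg, fun _ => rfl⟩

@[simp] lemma of_apply (g : ℝ × ℝ × ℝ → ℝ) (hg : ContDiffOn ℝ ∞ g U) (p : U) :
    (of g hg).1 p = g p := rfl

/-- Extensions of the same element agree on the open set, hence near each of its points. So the
choice made in `rep` has no influence on derivatives. -/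
lemma rep_eventuallyEq (h : SmoothAlg U) (g : ℝ × ℝ × ℝ → ℝ) (hg : ∀ p : U, h.1 p = g p) (p : U) :
    (rep h) =ᶠ[𝓝 (p : ℝ × ℝ × ℝ)] g := by
  filter_upwards [U.isOpen.mem_nhds p.2] with x hx
  rw [rep_apply h ⟨x, hx⟩, hg]

lemma contDiffAt_rep (h : SmoothAlg U) (p : U) : ContDiffAt ℝ ∞ (rep h) p :=
  (contDiffOn_rep h).contDiffAt (U.isOpen.mem_nhds p.2)

lemma differentiableAt_rep (h : SmoothAlg U) (p : U) : DifferentiableAt ℝ (rep h) p :=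
  (contDiffAt_rep h p).differentiableAt (by simp)

lemma contDiffOn_fderiv_apply {g : ℝ × ℝ × ℝ → ℝ} (hg : ContDiffOn ℝ ∞ g U) (w : ℝ × ℝ × ℝ) :
    ContDiffOn ℝ ∞ (fun p => fderiv ℝ g p w) U :=
  (hg.fderiv_of_isOpen U.isOpen (m := ∞) (by simp)).clm_apply contDiffOn_const

/-- The directional derivative, as a derivation of the algebra of smooth functions. -/
def D (w : ℝ × ℝ × ℝ) : Derivation ℝ (SmoothAlg U) (SmoothAlg U) :=
  Derivation.mk'
    { toFun := fun h => of (fun p => fderiv ℝ (rep h) p w)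
        (contDiffOn_fderiv_apply (contDiffOn_rep h) w)
      map_add' := fun a b => by
        refine Subtype.ext (funext fun p => ?_)
        have h : rep (a + b) =ᶠ[𝓝 (p : ℝ × ℝ × ℝ)] (rep a) + (rep b) :=
          rep_eventuallyEq _ _ (fun p => by simp [rep_apply]) p
        simp [h.fderiv_eq, fderiv_add (differentiableAt_rep a p) (differentiableAt_rep b p)]
      map_smul' := fun c a => by
        refine Subtype.ext (funext fun p => ?_)
        have h : rep (c • a) =ᶠ[𝓝 (p : ℝ × ℝ × ℝ)] c • (rep a) :=
          rep_eventuallyEq _ _ (fun p => by simp [rep_apply]) p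
        simp [h.fderiv_eq, fderiv_const_smul (differentiableAt_rep a p)] }
    fun a b => by
      refine Subtype.ext (funext fun p => ?_)
      have h : rep (a * b) =ᶠ[𝓝 (p : ℝ × ℝ × ℝ)] (rep a) * (rep b) :=
        rep_eventuallyEq _ _ (fun p => by simp [rep_apply]) p
      simp [h.fderiv_eq, fderiv_mul (differentiableAt_rep a p) (differentiableAt_rep b p), rep_apply]

lemma D_apply (w : ℝ × ℝ × ℝ) (h : SmoothAlg U) (p : U) : (D w h).1 p = fderiv ℝ (rep h) p w := rfl

lemma D_apply_of_eq (w : ℝ × ℝ × ℝ) (h : SmoothAlg U) (g : ℝ × ℝ × ℝ → ℝ)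
    (hg : ∀ p : U, h.1 p = g p) (p : U) : (D w h).1 p = fderiv ℝ g p w := by
  rw [D_apply, (rep_eventuallyEq h g hg p).fderiv_eq]

lemma D_comm (w w' : ℝ × ℝ × ℝ) (h : SmoothAlg U) : D w (D w' h) = D w' (D w h) := by
  refine Subtype.ext (funext fun p => ?_)
  have key : ∀ a b : ℝ × ℝ × ℝ, (D a (D b h)).1 p = fderiv ℝ (fderiv ℝ (rep h)) p a b := by
    intro a b
    rw [D_apply_of_eq a _ (fun p => fderiv ℝ (rep h) p b) (fun p => rfl)]
    have hd : DifferentiableAt ℝ (fderiv ℝ (rep h)) (p : ℝ × ℝ × ℝ) :=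
      ((contDiffAt_rep h p).fderiv_right (m := ∞) (by simp)).differentiableAt
        (by simp)
    rw [fderiv_clm_apply hd (differentiableAt_const b)]
    simp
  rw [key, key]
  exact (contDiffAt_rep h p).isSymmSndFDerivAt
    (by simpa using WithTop.coe_le_coe.2 (le_top : (2 : ℕ∞) ≤ ⊤)) w w'

lemma ext_apply {a b : SmoothAlg U} (h : ∀ p : U, a.1 p = b.1 p) : a = b :=
  Subtype.ext (funext h)

/-- `∂/∂v`. -/
abbrev Dv : Derivation ℝ (SmoothAlg U) (SmoothAlg U) := D (1, 0, 0)

/-- `∂/∂r`. -/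
abbrev Dr : Derivation ℝ (SmoothAlg U) (SmoothAlg U) := D (0, 1, 0)

/-- `∂/∂y`. -/
abbrev Dy : Derivation ℝ (SmoothAlg U) (SmoothAlg U) := D (0, 0, 1)

end SmoothAlg

/-- The box `Jv × Jr × Jy` as an open set. -/
def box (Jv Jr Jy : TopologicalSpace.Opens ℝ) : TopologicalSpace.Opens (ℝ × ℝ × ℝ) :=
  ⟨(Jv : Set ℝ) ×ˢ (Jr : Set ℝ) ×ˢ (Jy : Set ℝ), Jv.isOpen.prod (Jr.isOpen.prod Jy.isOpen)⟩

/-- The point `(v, r, y)` of the box. -/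
def boxPoint {Jv Jr Jy : TopologicalSpace.Opens ℝ} {v r y : ℝ} (hv : v ∈ Jv) (hr : r ∈ Jr)
    (hy : y ∈ Jy) : box Jv Jr Jy := ⟨(v, r, y), hv, hr, hy⟩

variable {Jv Jr Jy : TopologicalSpace.Opens ℝ}

/-- A smooth function of `(v, r, y)` as an element of the ring of smooth functions on the box. -/
def SmoothOn.toAlg {h : ℝ → ℝ → ℝ → ℝ} (hs : SmoothOn Jv Jr Jy h) : SmoothAlg (box Jv Jr Jy) :=
  SmoothAlg.of (fun p => h p.1 p.2.1 p.2.2) hs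

lemma SmoothOn.differentiableAt {h : ℝ → ℝ → ℝ → ℝ} (hs : SmoothOn Jv Jr Jy h) {v r y : ℝ}
    (hv : v ∈ Jv) (hr : r ∈ Jr) (hy : y ∈ Jy) :
    DifferentiableAt ℝ (fun p : ℝ × ℝ × ℝ => h p.1 p.2.1 p.2.2) (v, r, y) :=
  (ContDiffOn.contDiffAt hs ((box Jv Jr Jy).isOpen.mem_nhds
    (show (v, r, y) ∈ box Jv Jr Jy from ⟨hv, hr, hy⟩))).differentiableAt (by simp)

lemma SmoothOn.hasDerivAt_v' {h : ℝ → ℝ → ℝ → ℝ} (hs : SmoothOn Jv Jr Jy h) {v r y : ℝ}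
    (hv : v ∈ Jv) (hr : r ∈ Jr) (hy : y ∈ Jy) :
    HasDerivAt (fun t => h t r y)
      (fderiv ℝ (fun p : ℝ × ℝ × ℝ => h p.1 p.2.1 p.2.2) (v, r, y) (1, 0, 0)) v :=
  (hs.differentiableAt hv hr hy).hasFDerivAt.comp_hasDerivAt (f := fun t => (t, r, y)) v
    ((hasDerivAt_id v).prodMk ((hasDerivAt_const v r).prodMk (hasDerivAt_const v y)))

lemma SmoothOn.hasDerivAt_r' {h : ℝ → ℝ → ℝ → ℝ} (hs : SmoothOn Jv Jr Jy h) {v r y : ℝ}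
    (hv : v ∈ Jv) (hr : r ∈ Jr) (hy : y ∈ Jy) :
    HasDerivAt (fun t => h v t y)
      (fderiv ℝ (fun p : ℝ × ℝ × ℝ => h p.1 p.2.1 p.2.2) (v, r, y) (0, 1, 0)) r :=
  (hs.differentiableAt hv hr hy).hasFDerivAt.comp_hasDerivAt (f := fun t => (v, t, y)) r
    ((hasDerivAt_const r v).prodMk ((hasDerivAt_id r).prodMk (hasDerivAt_const r y)))

lemma SmoothOn.hasDerivAt_y' {h : ℝ → ℝ → ℝ → ℝ} (hs : SmoothOn Jv Jr Jy h) {v r y : ℝ}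
    (hv : v ∈ Jv) (hr : r ∈ Jr) (hy : y ∈ Jy) :
    HasDerivAt (fun t => h v r t)
      (fderiv ℝ (fun p : ℝ × ℝ × ℝ => h p.1 p.2.1 p.2.2) (v, r, y) (0, 0, 1)) y :=
  (hs.differentiableAt hv hr hy).hasFDerivAt.comp_hasDerivAt (f := fun t => (v, r, t)) y
    ((hasDerivAt_const y v).prodMk ((hasDerivAt_const y r).prodMk (hasDerivAt_id y)))

lemma SmoothOn.hasDerivAt_v {h : ℝ → ℝ → ℝ → ℝ} (hs : SmoothOn Jv Jr Jy h) {v r y : ℝ}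
    (hv : v ∈ Jv) (hr : r ∈ Jr) (hy : y ∈ Jy) :
    HasDerivAt (fun t => h t r y) (dv h v r y) v :=
  (hs.hasDerivAt_v' hv hr hy).differentiableAt.hasDerivAt

lemma SmoothOn.hasDerivAt_r {h : ℝ → ℝ → ℝ → ℝ} (hs : SmoothOn Jv Jr Jy h) {v r y : ℝ}
    (hv : v ∈ Jv) (hr : r ∈ Jr) (hy : y ∈ Jy) :
    HasDerivAt (fun t => h v t y) (dr h v r y) r :=
  (hs.hasDerivAt_r' hv hr hy).differentiableAt.hasDerivAt

lemma SmoothOn.hasDerivAt_y {h : ℝ → ℝ → ℝ → ℝ} (hs : SmoothOn Jv Jr Jy h) {v r y : ℝ}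
    (hv : v ∈ Jv) (hr : r ∈ Jr) (hy : y ∈ Jy) :
    HasDerivAt (fun t => h v r t) (dy h v r y) y :=
  (hs.hasDerivAt_y' hv hr hy).differentiableAt.hasDerivAt

lemma SmoothOn.dv {h : ℝ → ℝ → ℝ → ℝ} (hs : SmoothOn Jv Jr Jy h) : SmoothOn Jv Jr Jy (dv h) :=
  (SmoothAlg.contDiffOn_fderiv_apply (U := box Jv Jr Jy) hs (1, 0, 0)).congr
    fun _ hp => (hs.hasDerivAt_v' hp.1 hp.2.1 hp.2.2).deriv

lemma SmoothOn.dr {h : ℝ → ℝ → ℝ → ℝ} (hs : SmoothOn Jv Jr Jy h) : SmoothOn Jv Jr Jy (dr h) :=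
  (SmoothAlg.contDiffOn_fderiv_apply (U := box Jv Jr Jy) hs (0, 1, 0)).congr
    fun _ hp => (hs.hasDerivAt_r' hp.1 hp.2.1 hp.2.2).deriv

lemma SmoothOn.dy {h : ℝ → ℝ → ℝ → ℝ} (hs : SmoothOn Jv Jr Jy h) : SmoothOn Jv Jr Jy (dy h) :=
  (SmoothAlg.contDiffOn_fderiv_apply (U := box Jv Jr Jy) hs (0, 0, 1)).congr
    fun _ hp => (hs.hasDerivAt_y' hp.1 hp.2.1 hp.2.2).deriv

open SmoothAlg

lemma SmoothOn.Dv_toAlg {h : ℝ → ℝ → ℝ → ℝ} (hs : SmoothOn Jv Jr Jy h) :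
    Dv hs.toAlg = hs.dv.toAlg :=
  ext_apply fun p => (D_apply_of_eq _ _ _ (fun _ => rfl) p).trans
    (hs.hasDerivAt_v' p.2.1 p.2.2.1 p.2.2.2).deriv.symm

lemma SmoothOn.Dr_toAlg {h : ℝ → ℝ → ℝ → ℝ} (hs : SmoothOn Jv Jr Jy h) :
    Dr hs.toAlg = hs.dr.toAlg :=
  ext_apply fun p => (D_apply_of_eq _ _ _ (fun _ => rfl) p).trans
    (hs.hasDerivAt_r' p.2.1 p.2.2.1 p.2.2.2).deriv.symm

lemma SmoothOn.Dy_toAlg {h : ℝ → ℝ → ℝ → ℝ} (hs : SmoothOn Jv Jr Jy h) :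
    Dy hs.toAlg = hs.dy.toAlg :=
  ext_apply fun p => (D_apply_of_eq _ _ _ (fun _ => rfl) p).trans
    (hs.hasDerivAt_y' p.2.1 p.2.2.1 p.2.2.2).deriv.symm

end

end WarpedVaidya

namespace WarpedVaidya

noncomputable section

/-! ### Partial derivatives and the connection of the warped Vaidya metric -/

lemma pd_const (i : Fin 5) (c : ℝ) (x : Fin 5 → ℝ) : pd i (fun _ => c) x = 0 := by simp [pd]

lemma pd_congr {i : Fin 5} {h k : (Fin 5 → ℝ) → ℝ} {x : Fin 5 → ℝ} (e : h =ᶠ[𝓝 x] k) :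
    pd i h x = pd i k x := by
  refine Filter.EventuallyEq.deriv_eq ?_
  have hc : Tendsto (fun t => Function.update x i t) (𝓝 (x i)) (𝓝 x) := by
    have := (continuous_const (y := x)).update i continuous_id
    simpa using this.tendsto (x i)
  exact hc.eventually e

lemma pd_zero_lift (h : ℝ → ℝ → ℝ → ℝ) (x : Fin 5 → ℝ) :
    pd 0 (fun z => h (z 0) (z 1) (z 4)) x = dv h (x 0) (x 1) (x 4) := by simp [pd, dv]

lemma pd_one_lift (h : ℝ → ℝ → ℝ → ℝ) (x : Fin 5 → ℝ) :
    pd 1 (fun z => h (z 0) (z 1) (z 4)) x = dr h (x 0) (x 1) (x 4) := by simp [pd, dr]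

lemma pd_two_lift (h : ℝ → ℝ → ℝ → ℝ) (x : Fin 5 → ℝ) :
    pd 2 (fun z => h (z 0) (z 1) (z 4)) x = 0 := by simp [pd]

lemma pd_three_lift (h : ℝ → ℝ → ℝ → ℝ) (x : Fin 5 → ℝ) :
    pd 3 (fun z => h (z 0) (z 1) (z 4)) x = 0 := by simp [pd]

lemma pd_four_lift (h : ℝ → ℝ → ℝ → ℝ) (x : Fin 5 → ℝ) :
    pd 4 (fun z => h (z 0) (z 1) (z 4)) x = dy h (x 0) (x 1) (x 4) := by simp [pd, dy]

/-- The coordinate domain `Jv × Jr × (0, π) × ℝ × Jy`. -/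
def coordDomain (Jv Jr Jy : TopologicalSpace.Opens ℝ) : Set (Fin 5 → ℝ) :=
  {x | x 0 ∈ Jv ∧ x 1 ∈ Jr ∧ x 2 ∈ Ioo 0 Real.pi ∧ x 4 ∈ Jy}

lemma isOpen_coordDomain (Jv Jr Jy : TopologicalSpace.Opens ℝ) : IsOpen (coordDomain Jv Jr Jy) :=
  (Jv.isOpen.preimage (continuous_apply 0)).inter <|
    (Jr.isOpen.preimage (continuous_apply 1)).inter <|
      (isOpen_Ioo.preimage (continuous_apply 2)).inter (Jy.isOpen.preimage (continuous_apply 4))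

/-- The components of the inverse metric. -/
def invMetricMatrix (E m r s : ℝ) : Matrix (Fin 5) (Fin 5) ℝ :=
  !![0, E⁻¹, 0, 0, 0;
     E⁻¹, E⁻¹ * (1 - 2 * m / r), 0, 0, 0;
     0, 0, (E * r ^ 2)⁻¹, 0, 0;
     0, 0, 0, (E * r ^ 2 * s ^ 2)⁻¹, 0;
     0, 0, 0, 0, 1]

/-- The derivatives `∂_v g_{MN}`. -/
def dvMetric (E mv r : ℝ) : Fin 5 → Fin 5 → ℝ
  | 0, 0 => 2 * E * (mv / r)
  | _, _ => 0

/-- The derivatives `∂_r g_{MN}`. -/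
def drMetric (E m mr r s : ℝ) : Fin 5 → Fin 5 → ℝ
  | 0, 0 => 2 * E * (mr / r - m / r ^ 2)
  | 2, 2 => 2 * E * r
  | 3, 3 => 2 * E * r * s ^ 2
  | _, _ => 0

/-- The derivatives `∂_θ g_{MN}`. -/
def dθMetric (E r s c : ℝ) : Fin 5 → Fin 5 → ℝ
  | 3, 3 => 2 * E * r ^ 2 * s * c
  | _, _ => 0

/-- The derivatives `∂_y g_{MN}`. -/
def dyMetric (E A₁ m my r s : ℝ) : Fin 5 → Fin 5 → ℝ
  | 0, 0 => 2 * E * (my / r) - 2 * A₁ * E * (1 - 2 * m / r)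
  | 0, 1 => 2 * A₁ * E
  | 1, 0 => 2 * A₁ * E
  | 2, 2 => 2 * A₁ * E * r ^ 2
  | 3, 3 => 2 * A₁ * E * r ^ 2 * s ^ 2
  | _, _ => 0

/-- The partial derivatives `∂_i g_{MN}` of the components of the metric. -/
def dMetric (E A₁ m mv mr my r s c : ℝ) : Fin 5 → Fin 5 → Fin 5 → ℝ :=
  ![dvMetric E mv r, drMetric E m mr r s, dθMetric E r s c, 0, dyMetric E A₁ m my r s]

/-- The Christoffel symbols `Γ^v_{MN}`. -/
def gammaV (A₁ m mr r s : ℝ) : Fin 5 → Fin 5 → ℝ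
  | 0, 0 => m / r ^ 2 - mr / r
  | 0, 4 => A₁
  | 4, 0 => A₁
  | 2, 2 => -r
  | 3, 3 => -r * s ^ 2
  | _, _ => 0

/-- The Christoffel symbols `Γ^r_{MN}`. -/
def gammaR (A₁ m mv mr my r s : ℝ) : Fin 5 → Fin 5 → ℝ
  | 0, 0 => mv / r - (1 - 2 * m / r) * (mr / r - m / r ^ 2)
  | 0, 1 => mr / r - m / r ^ 2
  | 1, 0 => mr / r - m / r ^ 2
  | 0, 4 => my / r
  | 4, 0 => my / r
  | 1, 4 => A₁
  | 4, 1 => A₁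
  | 2, 2 => 2 * m - r
  | 3, 3 => (2 * m - r) * s ^ 2
  | _, _ => 0

/-- The Christoffel symbols `Γ^θ_{MN}`. -/
def gammaθ (A₁ r s c : ℝ) : Fin 5 → Fin 5 → ℝ
  | 1, 2 => r⁻¹
  | 2, 1 => r⁻¹
  | 2, 4 => A₁
  | 4, 2 => A₁
  | 3, 3 => -(s * c)
  | _, _ => 0

/-- The Christoffel symbols `Γ^ϕ_{MN}`. -/
def gammaϕ (A₁ r s c : ℝ) : Fin 5 → Fin 5 → ℝ
  | 1, 3 => r⁻¹
  | 3, 1 => r⁻¹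
  | 2, 3 => c / s
  | 3, 2 => c / s
  | 3, 4 => A₁
  | 4, 3 => A₁
  | _, _ => 0

/-- The Christoffel symbols `Γ^y_{MN}`. -/
def gammaY (E A₁ m my r s : ℝ) : Fin 5 → Fin 5 → ℝ
  | 0, 0 => E * (A₁ * (1 - 2 * m / r) - my / r)
  | 0, 1 => -(A₁ * E)
  | 1, 0 => -(A₁ * E)
  | 2, 2 => -(A₁ * E * r ^ 2)
  | 3, 3 => -(A₁ * E * r ^ 2 * s ^ 2)
  | _, _ => 0

/-- The Christoffel symbols `Γ^K_{MN}`. -/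
def gamma (E A₁ m mv mr my r s c : ℝ) : Fin 5 → Fin 5 → Fin 5 → ℝ :=
  ![gammaV A₁ m mr r s, gammaR A₁ m mv mr my r s, gammaθ A₁ r s c, gammaϕ A₁ r s c,
    gammaY E A₁ m my r s]

lemma sum_invMetric_mul (E m r s : ℝ) (X : Fin 5 → ℝ) (K : Fin 5) :
    ∑ L, invMetricMatrix E m r s K L * X L =
      ![E⁻¹ * X 1, E⁻¹ * X 0 + E⁻¹ * (1 - 2 * m / r) * X 1, (E * r ^ 2)⁻¹ * X 2,
        (E * r ^ 2 * s ^ 2)⁻¹ * X 3, X 4] K := by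
  fin_cases K <;> simp [Fin.sum_univ_five, invMetricMatrix]

set_option maxHeartbeats 1000000 in
lemma sum_invMetric_mul_dMetric {E A₁ m mv mr my r s c : ℝ} (hE : E ≠ 0) (hr : r ≠ 0) (hs : s ≠ 0)
    (K M N : Fin 5) :
    (1 / 2) * ∑ L, invMetricMatrix E m r s K L *
      (dMetric E A₁ m mv mr my r s c N M L + dMetric E A₁ m mv mr my r s c M N L
        - dMetric E A₁ m mv mr my r s c L M N) = gamma E A₁ m mv mr my r s c K M N := by
  rw [sum_invMetric_mul]
  -- Each row of the inverse metric has at most two nonzero entries. Moving its factor to the other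
  -- side leaves, for the 25 pairs (M, N), identities without inverses of the metric.
  have h0 : ∀ X y : ℝ, X = 2 * E * y → (1 / 2) * (E⁻¹ * X) = y := by
    rintro X y rfl; field_simp
  have h1 : ∀ X Y y : ℝ, X + (1 - 2 * m / r) * Y = 2 * E * y →
      (1 / 2) * (E⁻¹ * X + E⁻¹ * (1 - 2 * m / r) * Y) = y := by
    intro X Y y h
    rw [mul_assoc, ← mul_add, h]; field_simp
  have h2 : ∀ X y : ℝ, X = 2 * E * r ^ 2 * y → (1 / 2) * ((E * r ^ 2)⁻¹ * X) = y := by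
    rintro X y rfl; field_simp
  have h3 : ∀ X y : ℝ, X = 2 * E * r ^ 2 * s ^ 2 * y →
      (1 / 2) * ((E * r ^ 2 * s ^ 2)⁻¹ * X) = y := by
    rintro X y rfl; field_simp
  have h4 : ∀ X y : ℝ, X = 2 * y → (1 / 2) * X = y := by
    rintro X y rfl; ring
  fin_cases K
  · refine h0 _ _ ?_
    change _ = 2 * E * gammaV A₁ m mr r s M N
    fin_cases M <;> fin_cases N <;>
      simp [dMetric, dvMetric, drMetric, dθMetric, dyMetric, gammaV]
    all_goals ring1
  · refine h1 _ _ _ ?_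
    change _ = 2 * E * gammaR A₁ m mv mr my r s M N
    fin_cases M <;> fin_cases N <;>
      simp [dMetric, dvMetric, drMetric, dθMetric, dyMetric, gammaR]
    all_goals first | ring1 | (field_simp; ring1)
  · refine h2 _ _ ?_
    change _ = 2 * E * r ^ 2 * gammaθ A₁ r s c M N
    fin_cases M <;> fin_cases N <;>
      simp [dMetric, dvMetric, drMetric, dθMetric, dyMetric, gammaθ]
    all_goals first | ring1 | field_simp
  · refine h3 _ _ ?_
    change _ = 2 * E * r ^ 2 * s ^ 2 * gammaϕ A₁ r s c M N
    fin_cases M <;> fin_cases N <;>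
      simp [dMetric, dvMetric, drMetric, dθMetric, dyMetric, gammaϕ]
    all_goals first | ring1 | field_simp
  · refine h4 _ _ ?_
    change _ = 2 * gammaY E A₁ m my r s M N
    fin_cases M <;> fin_cases N <;>
      simp [dMetric, dvMetric, drMetric, dθMetric, dyMetric, gammaY]
    all_goals ring1

variable {Jv Jr Jy : TopologicalSpace.Opens ℝ} {A : ℝ → ℝ} {m : ℝ → ℝ → ℝ → ℝ}

lemma inv_metric {x : Fin 5 → ℝ} (hr : x 1 ≠ 0) (hs : Real.sin (x 2) ≠ 0) :
    (metric A m x)⁻¹ =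
      invMetricMatrix (Real.exp (2 * A (x 4))) (m (x 0) (x 1) (x 4)) (x 1) (Real.sin (x 2)) := by
  refine Matrix.inv_eq_right_inv ?_
  have hE := Real.exp_ne_zero (2 * A (x 4))
  ext i j
  fin_cases i <;> fin_cases j <;>
    simp [Matrix.mul_apply, Fin.sum_univ_five, metric, invMetricMatrix]
  all_goals field_simp
  all_goals ring

lemma hasDerivAt_warp (hA : ContDiffOn ℝ ∞ A Jy) {y : ℝ} (hy : y ∈ Jy) :
    HasDerivAt A (deriv A y) y :=
  ((hA.contDiffAt (Jy.isOpen.mem_nhds hy)).differentiableAt (by simp)).hasDerivAt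

lemma hasDerivAt_exp_warp (hA : ContDiffOn ℝ ∞ A Jy) {y : ℝ} (hy : y ∈ Jy) :
    HasDerivAt (fun t => Real.exp (2 * A t)) (2 * deriv A y * Real.exp (2 * A y)) y :=
  ((hasDerivAt_warp hA hy).const_mul 2).exp.congr_deriv (by ring)

lemma pd_metric (hA : ContDiffOn ℝ ∞ A Jy) (hm : SmoothOn Jv Jr Jy m) (h0 : (0 : ℝ) ∉ Jr)
    {x : Fin 5 → ℝ} (hx : x ∈ coordDomain Jv Jr Jy) (i M N : Fin 5) :
    pd i (fun z => metric A m z M N) x =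
      dMetric (Real.exp (2 * A (x 4))) (deriv A (x 4)) (m (x 0) (x 1) (x 4))
        (dv m (x 0) (x 1) (x 4)) (dr m (x 0) (x 1) (x 4)) (dy m (x 0) (x 1) (x 4))
        (x 1) (Real.sin (x 2)) (Real.cos (x 2)) i M N := by
  obtain ⟨hxv, hxr, -, hxy⟩ := hx
  have hr : x 1 ≠ 0 := fun h => h0 (h ▸ hxr)
  have z := fun i => pd_const i 0 x
  have o := fun i => pd_const i 1 x
  have dE := hasDerivAt_exp_warp hA hxy
  have hMv := hm.hasDerivAt_v hxv hxr hxy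
  have hMr := hm.hasDerivAt_r hxv hxr hxy
  have hMy := hm.hasDerivAt_y hxv hxr hxy
  fin_cases i
  · have a : pd 0 (fun z => metric A m z 0 0) x =
        2 * Real.exp (2 * A (x 4)) * (dv m (x 0) (x 1) (x 4) / x 1) := by
      refine (pd_zero_lift
        (fun v r y => -(Real.exp (2 * A y) * (1 - 2 * m v r y / r))) x).trans ?_
      refine HasDerivAt.deriv (HasDerivAt.congr_deriv
        ((((hMv.const_mul 2).div_const _).const_sub 1).const_mul _).neg ?_)
      ring
    have b : ∀ k : ℝ → ℝ → ℝ → ℝ, (∀ v v' r y, k v r y = k v' r y) →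
        pd 0 (fun z => k (z 0) (z 1) (z 4)) x = 0 := fun k hk => by
      rw [pd_zero_lift, dv, show (fun t => k t (x 1) (x 4)) = fun _ => k 0 (x 1) (x 4) from
        funext fun t => hk _ _ _ _, deriv_const]
    have e1 := b (fun _ _ y => Real.exp (2 * A y)) (fun _ _ _ _ => rfl)
    have e2 := b (fun _ r y => Real.exp (2 * A y) * r ^ 2) (fun _ _ _ _ => rfl)
    have e3 : pd 0 (fun z => metric A m z 3 3) x = 0 := by simp [pd, metric]
    fin_cases M <;> fin_cases N
    exacts [a, e1, z 0, z 0, z 0, e1, z 0, z 0, z 0, z 0, z 0, z 0, e2, z 0, z 0,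
      z 0, z 0, z 0, e3, z 0, z 0, z 0, z 0, z 0, o 0]
  · have a : pd 1 (fun z => metric A m z 0 0) x = 2 * Real.exp (2 * A (x 4)) *
        (dr m (x 0) (x 1) (x 4) / x 1 - m (x 0) (x 1) (x 4) / x 1 ^ 2) := by
      refine (pd_one_lift
        (fun v r y => -(Real.exp (2 * A y) * (1 - 2 * m v r y / r))) x).trans ?_
      refine HasDerivAt.deriv (HasDerivAt.congr_deriv
        ((((hMr.const_mul 2).div (hasDerivAt_id _) hr).const_sub 1).const_mul _).neg ?_)
      simp only [id]
      field_simp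
    have e1 : pd 1 (fun z : Fin 5 → ℝ => Real.exp (2 * A (z 4))) x = 0 := by simp [pd]
    have e2 : pd 1 (fun z => metric A m z 2 2) x = 2 * Real.exp (2 * A (x 4)) * x 1 := by
      simp [pd, metric]; ring
    have e3 : pd 1 (fun z => metric A m z 3 3) x =
        2 * Real.exp (2 * A (x 4)) * x 1 * Real.sin (x 2) ^ 2 := by
      simp [pd, metric]
      exact Or.inl (by ring)
    fin_cases M <;> fin_cases N
    exacts [a, e1, z 1, z 1, z 1, e1, z 1, z 1, z 1, z 1, z 1, z 1, e2, z 1, z 1,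
      z 1, z 1, z 1, e3, z 1, z 1, z 1, z 1, z 1, o 1]
  · have a : pd 2 (fun z => metric A m z 0 0) x = 0 := by simp [pd, metric]
    have e1 : pd 2 (fun z : Fin 5 → ℝ => Real.exp (2 * A (z 4))) x = 0 := by simp [pd]
    have e2 : pd 2 (fun z => metric A m z 2 2) x = 0 := by simp [pd, metric]
    have e3 : pd 2 (fun z => metric A m z 3 3) x =
        2 * Real.exp (2 * A (x 4)) * x 1 ^ 2 * Real.sin (x 2) * Real.cos (x 2) := by
      simp [pd, metric]; ring
    fin_cases M <;> fin_cases N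
    exacts [a, e1, z 2, z 2, z 2, e1, z 2, z 2, z 2, z 2, z 2, z 2, e2, z 2, z 2,
      z 2, z 2, z 2, e3, z 2, z 2, z 2, z 2, z 2, o 2]
  · have a : pd 3 (fun z => metric A m z 0 0) x = 0 := by simp [pd, metric]
    have e1 : pd 3 (fun z : Fin 5 → ℝ => Real.exp (2 * A (z 4))) x = 0 := by simp [pd]
    have e2 : pd 3 (fun z => metric A m z 2 2) x = 0 := by simp [pd, metric]
    have e3 : pd 3 (fun z => metric A m z 3 3) x = 0 := by simp [pd, metric]
    fin_cases M <;> fin_cases N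
    exacts [a, e1, z 3, z 3, z 3, e1, z 3, z 3, z 3, z 3, z 3, z 3, e2, z 3, z 3,
      z 3, z 3, z 3, e3, z 3, z 3, z 3, z 3, z 3, o 3]
  · have a : pd 4 (fun z => metric A m z 0 0) x =
        2 * Real.exp (2 * A (x 4)) * (dy m (x 0) (x 1) (x 4) / x 1) -
          2 * deriv A (x 4) * Real.exp (2 * A (x 4)) * (1 - 2 * m (x 0) (x 1) (x 4) / x 1) := by
      refine (pd_four_lift
        (fun v r y => -(Real.exp (2 * A y) * (1 - 2 * m v r y / r))) x).trans ?_
      refine HasDerivAt.deriv (HasDerivAt.congr_deriv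
        (dE.mul (((hMy.const_mul 2).div_const _).const_sub 1)).neg ?_)
      ring
    have e1 : pd 4 (fun z => metric A m z 0 1) x = 2 * deriv A (x 4) * Real.exp (2 * A (x 4)) :=
      (pd_four_lift (fun _ _ y => Real.exp (2 * A y)) x).trans dE.deriv
    have e2 : pd 4 (fun z => metric A m z 2 2) x =
        2 * deriv A (x 4) * Real.exp (2 * A (x 4)) * x 1 ^ 2 :=
      (pd_four_lift (fun _ r y => Real.exp (2 * A y) * r ^ 2) x).trans
        (dE.mul_const (x 1 ^ 2)).deriv
    have e3 : pd 4 (fun z => metric A m z 3 3) x =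
        2 * deriv A (x 4) * Real.exp (2 * A (x 4)) * x 1 ^ 2 * Real.sin (x 2) ^ 2 := by
      simp only [pd, metric]
      refine HasDerivAt.deriv ?_
      simpa using (dE.mul_const (x 1 ^ 2)).mul_const (Real.sin (x 2) ^ 2)
    fin_cases M <;> fin_cases N
    exacts [a, e1, z 4, z 4, z 4, e1, z 4, z 4, z 4, z 4, z 4, z 4, e2, z 4, z 4,
      z 4, z 4, z 4, e3, z 4, z 4, z 4, z 4, z 4, o 4]

/-- The Christoffel symbols of the warped Vaidya metric at a point. -/
def gammaAt (A : ℝ → ℝ) (m : ℝ → ℝ → ℝ → ℝ) (x : Fin 5 → ℝ) : Fin 5 → Fin 5 → Fin 5 → ℝ :=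
  gamma (Real.exp (2 * A (x 4))) (deriv A (x 4)) (m (x 0) (x 1) (x 4))
    (dv m (x 0) (x 1) (x 4)) (dr m (x 0) (x 1) (x 4)) (dy m (x 0) (x 1) (x 4))
    (x 1) (Real.sin (x 2)) (Real.cos (x 2))

lemma christoffel_metric (hA : ContDiffOn ℝ ∞ A Jy) (hm : SmoothOn Jv Jr Jy m) (h0 : (0 : ℝ) ∉ Jr)
    {x : Fin 5 → ℝ} (hx : x ∈ coordDomain Jv Jr Jy) (K M N : Fin 5) :
    christoffel (metric A m) K M N x = gammaAt A m x K M N := by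
  have hr : x 1 ≠ 0 := fun h => h0 (h ▸ hx.2.1)
  have hs : Real.sin (x 2) ≠ 0 := (Real.sin_pos_of_mem_Ioo hx.2.2.1).ne'
  rw [gammaAt, ← sum_invMetric_mul_dMetric (Real.exp_ne_zero _) hr hs K M N, christoffel,
    inv_metric hr hs]
  simp only [pd_metric hA hm h0 hx]

/-- The explicit symbols are valid only where r ≠ 0 and sin θ ≠ 0; this set contains a neighbourhood
of the point, which suffices for derivatives. -/
lemma pd_christoffel_metric (hA : ContDiffOn ℝ ∞ A Jy) (hm : SmoothOn Jv Jr Jy m)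
    (h0 : (0 : ℝ) ∉ Jr) {x : Fin 5 → ℝ} (hx : x ∈ coordDomain Jv Jr Jy) (i K M N : Fin 5) :
    pd i (christoffel (metric A m) K M N) x = pd i (fun z => gammaAt A m z K M N) x :=
  pd_congr <| by
    filter_upwards [(isOpen_coordDomain Jv Jr Jy).mem_nhds hx] with z hz
    exact christoffel_metric hA hm h0 hz K M N

end

end WarpedVaidya

namespace WarpedVaidya

noncomputable section

variable {Jv Jr Jy : TopologicalSpace.Opens ℝ} {A : ℝ → ℝ} {m : ℝ → ℝ → ℝ → ℝ}

/-! ### The Ricci tensor of the warped Vaidya metric -/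

lemma SmoothOn.dr_dv {h : ℝ → ℝ → ℝ → ℝ} (hs : SmoothOn Jv Jr Jy h) {v r y : ℝ}
    (hv : v ∈ Jv) (hr : r ∈ Jr) (hy : y ∈ Jy) :
    WarpedVaidya.dr (WarpedVaidya.dv h) v r y = WarpedVaidya.dv (WarpedVaidya.dr h) v r y := by
  have := SmoothAlg.D_comm (0, 1, 0) (1, 0, 0) hs.toAlg
  rw [hs.Dv_toAlg, hs.Dr_toAlg, hs.dv.Dr_toAlg, hs.dr.Dv_toAlg] at this
  exact congrFun (congrArg Subtype.val this) (boxPoint hv hr hy)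

/-- The sums are grouped so that the contraction Γ^K_{KL} appears as one factor, which is simple by
`sum_gamma`. -/
lemma ricci_metric (hA : ContDiffOn ℝ ∞ A Jy) (hm : SmoothOn Jv Jr Jy m)
    (h0 : (0 : ℝ) ∉ Jr) {x : Fin 5 → ℝ} (hx : x ∈ coordDomain Jv Jr Jy) (M N : Fin 5) :
    ricci (metric A m) x M N =
      (∑ K, pd K (fun z => gammaAt A m z K M N) x) - (∑ K, pd N (fun z => gammaAt A m z K M K) x)
      + ∑ L, ((∑ K, gammaAt A m x K K L) * gammaAt A m x L M N
        - ∑ K, gammaAt A m x K N L * gammaAt A m x L M K) := by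
  simp only [ricci, pd_christoffel_metric hA hm h0 hx, christoffel_metric hA hm h0 hx,
    Finset.sum_add_distrib, Finset.sum_sub_distrib, Finset.sum_mul]
  rw [Finset.sum_comm, Finset.sum_comm (f := fun K L => gammaAt A m x K N L * gammaAt A m x L M K)]

/-- The contraction is ∂_L log √|g|, and √|g| = e^{4A} r² |sin θ| does not contain the mass. -/
lemma sum_gamma {E A₁ m mv mr my r s c : ℝ} (L : Fin 5) :
    ∑ K, gamma E A₁ m mv mr my r s c K K L = ![0, 2 / r, c / s, 0, 4 * A₁] L := by
  fin_cases L <;>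
    simp [Fin.sum_univ_five, gamma, gammaV, gammaR, gammaθ, gammaϕ, gammaY] <;> ring

lemma sum_gammaAt (x : Fin 5 → ℝ) (L : Fin 5) :
    ∑ K, gammaAt A m x K K L =
      ![0, 2 / x 1, Real.cos (x 2) / Real.sin (x 2), 0, 4 * deriv A (x 4)] L := sum_gamma L

lemma hasDerivAt_sub_div {g h : ℝ → ℝ} {g' h' r : ℝ} (hg : HasDerivAt g g' r)
    (hh : HasDerivAt h h' r) (hr : r ≠ 0) :
    HasDerivAt (fun t => g t / t - h t / t ^ 2) (g' / r - g r / r ^ 2 - h' / r ^ 2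
      + 2 * h r / r ^ 3) r := by
  refine ((hg.div (hasDerivAt_id r) hr).sub (hh.div (hasDerivAt_pow 2 r)
    (pow_ne_zero 2 hr))).congr_deriv ?_
  simp only [id]
  field_simp
  ring

lemma pd_one_inv (x : Fin 5 → ℝ) : pd 1 (fun z : Fin 5 → ℝ => (z 1)⁻¹) x = -(x 1 ^ 2)⁻¹ := by
  simp [pd]

lemma pd_four_inv (x : Fin 5 → ℝ) : pd 4 (fun z : Fin 5 → ℝ => (z 1)⁻¹) x = 0 := by
  simp [pd]

lemma pd_warp_of_ne {i : Fin 5} (hi : i ≠ 4) (x : Fin 5 → ℝ) :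
    pd i (fun z : Fin 5 → ℝ => deriv A (z 4)) x = 0 := by
  simp [pd, Function.update_of_ne hi.symm]

lemma pd_four_warp (x : Fin 5 → ℝ) :
    pd 4 (fun z : Fin 5 → ℝ => deriv A (z 4)) x = deriv (deriv A) (x 4) := by
  simp [pd]

lemma hasDerivAt_deriv_warp (hA : ContDiffOn ℝ ∞ A Jy) {y : ℝ} (hy : y ∈ Jy) :
    HasDerivAt (deriv A) (deriv (deriv A) y) y :=
  hasDerivAt_warp (hA.deriv_of_isOpen Jy.isOpen (by simp)) hy

lemma ricci_rr (hA : ContDiffOn ℝ ∞ A Jy) (hm : SmoothOn Jv Jr Jy m) (h0 : (0 : ℝ) ∉ Jr)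
    {x : Fin 5 → ℝ} (hx : x ∈ coordDomain Jv Jr Jy) : ricci (metric A m) x 1 1 = 0 := by
  have hr : x 1 ≠ 0 := fun h => h0 (h ▸ hx.2.1)
  have a : ∀ K, pd K (fun z => gammaAt A m z K 1 1) x = 0 := by
    intro K; fin_cases K <;> exact pd_const _ 0 x
  have b : ∀ K, pd 1 (fun z => gammaAt A m z K 1 K) x =
      ![0, 0, -(x 1 ^ 2)⁻¹, -(x 1 ^ 2)⁻¹, 0] K := by
    intro K; fin_cases K
    exacts [pd_const _ 0 x, pd_const _ 0 x, pd_one_inv x, pd_one_inv x, pd_const _ 0 x]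
  simp only [ricci_metric hA hm h0 hx, a, b, sum_gammaAt]
  simp [Fin.sum_univ_five, gammaAt, gamma, gammaV, gammaR, gammaθ, gammaϕ, gammaY]
  field_simp
  ring

lemma ricci_ry (hA : ContDiffOn ℝ ∞ A Jy) (hm : SmoothOn Jv Jr Jy m) (h0 : (0 : ℝ) ∉ Jr)
    {x : Fin 5 → ℝ} (hx : x ∈ coordDomain Jv Jr Jy) : ricci (metric A m) x 1 4 = 0 := by
  have hr : x 1 ≠ 0 := fun h => h0 (h ▸ hx.2.1)
  have a : ∀ K, pd K (fun z => gammaAt A m z K 1 4) x = 0 := by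
    intro K; fin_cases K
    exacts [pd_const _ 0 x, pd_warp_of_ne (by decide) x, pd_const _ 0 x, pd_const _ 0 x,
      pd_const _ 0 x]
  have b : ∀ K, pd 4 (fun z => gammaAt A m z K 1 K) x = 0 := by
    intro K; fin_cases K
    exacts [pd_const _ 0 x, pd_const _ 0 x, pd_four_inv x, pd_four_inv x, pd_const _ 0 x]
  simp only [ricci_metric hA hm h0 hx, a, b, sum_gammaAt]
  simp [Fin.sum_univ_five, gammaAt, gamma, gammaV, gammaR, gammaθ, gammaϕ, gammaY]
  field_simp
  ring

lemma ricci_vy (hA : ContDiffOn ℝ ∞ A Jy) (hm : SmoothOn Jv Jr Jy m) (h0 : (0 : ℝ) ∉ Jr)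
    {x : Fin 5 → ℝ} (hx : x ∈ coordDomain Jv Jr Jy) : ricci (metric A m) x 0 4 =
      dr (dy m) (x 0) (x 1) (x 4) / x 1 + dy m (x 0) (x 1) (x 4) / x 1 ^ 2 := by
  have hr : x 1 ≠ 0 := fun h => h0 (h ▸ hx.2.1)
  have e1 : pd 1 (fun z : Fin 5 → ℝ => dy m (z 0) (z 1) (z 4) / z 1) x =
      dr (dy m) (x 0) (x 1) (x 4) / x 1 - dy m (x 0) (x 1) (x 4) / x 1 ^ 2 := by
    refine (pd_one_lift (fun v r y => dy m v r y / r) x).trans (HasDerivAt.deriv ?_)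
    refine ((hm.dy.hasDerivAt_r hx.1 hx.2.1 hx.2.2.2).div (hasDerivAt_id (x 1)) hr).congr_deriv ?_
    simp only [id]
    field_simp
  have a : ∀ K, pd K (fun z => gammaAt A m z K 0 4) x =
      ![0, dr (dy m) (x 0) (x 1) (x 4) / x 1 - dy m (x 0) (x 1) (x 4) / x 1 ^ 2, 0, 0, 0] K := by
    intro K; fin_cases K
    exacts [pd_warp_of_ne (i := 0) (by decide) x, e1, pd_const _ 0 x, pd_const _ 0 x, pd_const _ 0 x]
  -- Since Γ^r_{vr} = −Γ^v_{vv}, the two y-derivatives cancel in the trace and need not be computed.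
  have e2 : pd 4 (fun z => gammaAt A m z 1 0 1) x = -pd 4 (fun z => gammaAt A m z 0 0 0) x := by
    rw [pd, pd, ← deriv.neg]
    congr 1
    funext t
    exact (neg_sub _ _).symm
  have b : ∀ K, pd 4 (fun z => gammaAt A m z K 0 K) x =
      ![pd 4 (fun z => gammaAt A m z 0 0 0) x, -pd 4 (fun z => gammaAt A m z 0 0 0) x, 0, 0, 0]
        K := by
    intro K; fin_cases K
    exacts [rfl, e2, pd_const _ 0 x, pd_const _ 0 x, pd_const _ 0 x]
  generalize pd 4 (fun z => gammaAt A m z 0 0 0) x = g at b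
  simp only [ricci_metric hA hm h0 hx, a, b, sum_gammaAt]
  simp [Fin.sum_univ_five, gammaAt, gamma, gammaV, gammaR, gammaθ, gammaϕ, gammaY]
  field_simp
  ring

lemma ricci_vr (hA : ContDiffOn ℝ ∞ A Jy) (hm : SmoothOn Jv Jr Jy m) (h0 : (0 : ℝ) ∉ Jr)
    {x : Fin 5 → ℝ} (hx : x ∈ coordDomain Jv Jr Jy) : ricci (metric A m) x 0 1 =
      dr (dr m) (x 0) (x 1) (x 4) / x 1
      - (4 * deriv A (x 4) ^ 2 + deriv (deriv A) (x 4)) * Real.exp (2 * A (x 4)) := by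
  have hr : x 1 ≠ 0 := fun h => h0 (h ▸ hx.2.1)
  have e1 : pd 1 (fun z => gammaAt A m z 1 0 1) x = dr (dr m) (x 0) (x 1) (x 4) / x 1
      - dr m (x 0) (x 1) (x 4) / x 1 ^ 2 - dr m (x 0) (x 1) (x 4) / x 1 ^ 2
      + 2 * m (x 0) (x 1) (x 4) / x 1 ^ 3 :=
    (pd_one_lift (fun v r y => dr m v r y / r - m v r y / r ^ 2) x).trans
      (hasDerivAt_sub_div (hm.dr.hasDerivAt_r hx.1 hx.2.1 hx.2.2.2)
        (hm.hasDerivAt_r hx.1 hx.2.1 hx.2.2.2) hr).deriv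
  have e2 : pd 1 (fun z => gammaAt A m z 0 0 0) x = -pd 1 (fun z => gammaAt A m z 1 0 1) x := by
    rw [pd, pd, ← deriv.neg]
    congr 1
    funext t
    exact (neg_sub _ _).symm
  have e3 : pd 4 (fun z => gammaAt A m z 4 0 1) x =
      -(deriv (deriv A) (x 4) * Real.exp (2 * A (x 4))
        + deriv A (x 4) * (2 * deriv A (x 4) * Real.exp (2 * A (x 4)))) :=
    (pd_four_lift (fun _ _ y => -(deriv A y * Real.exp (2 * A y))) x).trans
      ((hasDerivAt_deriv_warp hA hx.2.2.2).mul (hasDerivAt_exp_warp hA hx.2.2.2)).neg.deriv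
  have a : ∀ K, pd K (fun z => gammaAt A m z K 0 1) x =
      ![0, pd 1 (fun z => gammaAt A m z 1 0 1) x, 0, 0,
        pd 4 (fun z => gammaAt A m z 4 0 1) x] K := by
    intro K; fin_cases K
    exacts [pd_const _ 0 x, rfl, pd_const _ 0 x, pd_const _ 0 x, rfl]
  have b : ∀ K, pd 1 (fun z => gammaAt A m z K 0 K) x =
      ![-pd 1 (fun z => gammaAt A m z 1 0 1) x, pd 1 (fun z => gammaAt A m z 1 0 1) x, 0, 0, 0]
        K := by
    intro K; fin_cases K
    exacts [e2, rfl, pd_const _ 0 x, pd_const _ 0 x, pd_const _ 0 x]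
  rw [e1, e3] at a
  rw [e1] at b
  simp only [ricci_metric hA hm h0 hx, a, b, sum_gammaAt]
  simp [Fin.sum_univ_five, gammaAt, gamma, gammaV, gammaR, gammaθ, gammaϕ, gammaY]
  field_simp
  ring

lemma ricci_θθ (hA : ContDiffOn ℝ ∞ A Jy) (hm : SmoothOn Jv Jr Jy m) (h0 : (0 : ℝ) ∉ Jr)
    {x : Fin 5 → ℝ} (hx : x ∈ coordDomain Jv Jr Jy) : ricci (metric A m) x 2 2 =
      2 * dr m (x 0) (x 1) (x 4) - (4 * deriv A (x 4) ^ 2 + deriv (deriv A) (x 4))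
        * Real.exp (2 * A (x 4)) * x 1 ^ 2 := by
  have hr : x 1 ≠ 0 := fun h => h0 (h ▸ hx.2.1)
  have hs : Real.sin (x 2) ≠ 0 := (Real.sin_pos_of_mem_Ioo hx.2.2.1).ne'
  have e0 : pd 0 (fun z : Fin 5 → ℝ => -(z 1)) x = 0 := by simp [pd]
  have e1 : pd 1 (fun z => gammaAt A m z 1 2 2) x = 2 * dr m (x 0) (x 1) (x 4) - 1 :=
    (pd_one_lift (fun v r y => 2 * m v r y - r) x).trans
      (((hm.hasDerivAt_r hx.1 hx.2.1 hx.2.2.2).const_mul 2).sub (hasDerivAt_id _)).deriv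
  have e3 : pd 4 (fun z => gammaAt A m z 4 2 2) x =
      -((deriv (deriv A) (x 4) * Real.exp (2 * A (x 4))
        + deriv A (x 4) * (2 * deriv A (x 4) * Real.exp (2 * A (x 4)))) * x 1 ^ 2) :=
    (pd_four_lift (fun _ r y => -(deriv A y * Real.exp (2 * A y) * r ^ 2)) x).trans
      (((hasDerivAt_deriv_warp hA hx.2.2.2).mul
        (hasDerivAt_exp_warp hA hx.2.2.2)).mul_const (x 1 ^ 2)).neg.deriv
  have e4 : pd 2 (fun z : Fin 5 → ℝ => Real.cos (z 2) / Real.sin (z 2)) x =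
      (-Real.sin (x 2) * Real.sin (x 2) - Real.cos (x 2) * Real.cos (x 2))
        / Real.sin (x 2) ^ 2 := by
    simp only [pd, Function.update_self]
    exact ((Real.hasDerivAt_cos _).div (Real.hasDerivAt_sin _) hs).deriv
  have a : ∀ K, pd K (fun z => gammaAt A m z K 2 2) x =
      ![0, pd 1 (fun z => gammaAt A m z 1 2 2) x, 0, 0,
        pd 4 (fun z => gammaAt A m z 4 2 2) x] K := by
    intro K; fin_cases K
    exacts [e0, rfl, pd_const _ 0 x, pd_const _ 0 x, rfl]
  have b : ∀ K, pd 2 (fun z => gammaAt A m z K 2 K) x =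
      ![0, 0, 0, (-Real.sin (x 2) * Real.sin (x 2) - Real.cos (x 2) * Real.cos (x 2))
        / Real.sin (x 2) ^ 2, 0] K := by
    intro K; fin_cases K
    exacts [pd_const _ 0 x, pd_const _ 0 x, pd_const _ 0 x, e4, pd_const _ 0 x]
  rw [e1, e3] at a
  simp only [ricci_metric hA hm h0 hx, a, b, sum_gammaAt]
  simp [Fin.sum_univ_five, gammaAt, gamma, gammaV, gammaR, gammaθ, gammaϕ, gammaY]
  field_simp
  ring

lemma ricci_yy (hA : ContDiffOn ℝ ∞ A Jy) (hm : SmoothOn Jv Jr Jy m) (h0 : (0 : ℝ) ∉ Jr)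
    {x : Fin 5 → ℝ} (hx : x ∈ coordDomain Jv Jr Jy) : ricci (metric A m) x 4 4 =
      -(4 * deriv A (x 4) ^ 2 + 4 * deriv (deriv A) (x 4)) := by
  have a : ∀ K, pd K (fun z => gammaAt A m z K 4 4) x = 0 := by
    intro K; fin_cases K <;> exact pd_const _ 0 x
  have b : ∀ K, pd 4 (fun z => gammaAt A m z K 4 K) x =
      ![deriv (deriv A) (x 4), deriv (deriv A) (x 4), deriv (deriv A) (x 4),
        deriv (deriv A) (x 4), 0] K := by
    intro K; fin_cases K
    exacts [pd_four_warp x, pd_four_warp x, pd_four_warp x, pd_four_warp x, pd_const _ 0 x]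
  simp only [ricci_metric hA hm h0 hx, a, b, sum_gammaAt]
  simp [Fin.sum_univ_five, gammaAt, gamma, gammaV, gammaR, gammaθ, gammaϕ, gammaY]
  ring

lemma ricci_vv (hA : ContDiffOn ℝ ∞ A Jy) (hm : SmoothOn Jv Jr Jy m) (h0 : (0 : ℝ) ∉ Jr)
    {x : Fin 5 → ℝ} (hx : x ∈ coordDomain Jv Jr Jy) : ricci (metric A m) x 0 0 =
      Real.exp (2 * A (x 4)) * ((4 * deriv A (x 4) ^ 2 + deriv (deriv A) (x 4))
          * (1 - 2 * m (x 0) (x 1) (x 4) / x 1)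
        - 4 * deriv A (x 4) * dy m (x 0) (x 1) (x 4) / x 1
        - dy (dy m) (x 0) (x 1) (x 4) / x 1)
      - (1 - 2 * m (x 0) (x 1) (x 4) / x 1) * dr (dr m) (x 0) (x 1) (x 4) / x 1
      + 2 * dv m (x 0) (x 1) (x 4) / x 1 ^ 2 := by
  have hr : x 1 ≠ 0 := fun h => h0 (h ▸ hx.2.1)
  have hMr := hm.hasDerivAt_r hx.1 hx.2.1 hx.2.2.2
  have hMy := hm.hasDerivAt_y hx.1 hx.2.1 hx.2.2.2
  have hMrr := hm.dr.hasDerivAt_r hx.1 hx.2.1 hx.2.2.2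
  have hMvr := hm.dv.hasDerivAt_r hx.1 hx.2.1 hx.2.2.2
  have hMyy := hm.dy.hasDerivAt_y hx.1 hx.2.1 hx.2.2.2
  have hMv := hm.hasDerivAt_v hx.1 hx.2.1 hx.2.2.2
  have hMrv := hm.dr.hasDerivAt_v hx.1 hx.2.1 hx.2.2.2
  rw [hm.dr_dv hx.1 hx.2.1 hx.2.2.2] at hMvr
  have e0 : pd 0 (fun z => gammaAt A m z 1 0 1) x = dv (dr m) (x 0) (x 1) (x 4) / x 1
      - dv m (x 0) (x 1) (x 4) / x 1 ^ 2 :=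
    (pd_zero_lift (fun v r y => dr m v r y / r - m v r y / r ^ 2) x).trans
      ((hMrv.div_const _).sub (hMv.div_const _)).deriv
  have e1 : pd 1 (fun z => gammaAt A m z 1 0 0) x =
      dv (dr m) (x 0) (x 1) (x 4) / x 1 - dv m (x 0) (x 1) (x 4) / x 1 ^ 2
      - ((2 * m (x 0) (x 1) (x 4) / x 1 ^ 2 - 2 * dr m (x 0) (x 1) (x 4) / x 1)
          * (dr m (x 0) (x 1) (x 4) / x 1 - m (x 0) (x 1) (x 4) / x 1 ^ 2)
        + (1 - 2 * m (x 0) (x 1) (x 4) / x 1) * (dr (dr m) (x 0) (x 1) (x 4) / x 1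
          - dr m (x 0) (x 1) (x 4) / x 1 ^ 2 - dr m (x 0) (x 1) (x 4) / x 1 ^ 2
          + 2 * m (x 0) (x 1) (x 4) / x 1 ^ 3)) := by
    refine (pd_one_lift (fun v r y => dv m v r y / r
      - (1 - 2 * m v r y / r) * (dr m v r y / r - m v r y / r ^ 2)) x).trans (HasDerivAt.deriv ?_)
    refine ((hMvr.div (hasDerivAt_id _) hr).sub
      ((((hMr.const_mul 2).div (hasDerivAt_id _) hr).const_sub 1).mul
        (hasDerivAt_sub_div hMrr hMr hr))).congr_deriv ?_
    simp only [id, Pi.div_apply]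
    field_simp
    ring
  have e4 : pd 4 (fun z => gammaAt A m z 4 0 0) x =
      2 * deriv A (x 4) * Real.exp (2 * A (x 4))
        * (deriv A (x 4) * (1 - 2 * m (x 0) (x 1) (x 4) / x 1) - dy m (x 0) (x 1) (x 4) / x 1)
      + Real.exp (2 * A (x 4)) * (deriv (deriv A) (x 4) * (1 - 2 * m (x 0) (x 1) (x 4) / x 1)
        + deriv A (x 4) * -(2 * dy m (x 0) (x 1) (x 4) / x 1)
        - dy (dy m) (x 0) (x 1) (x 4) / x 1) :=
    (pd_four_lift (fun v r y => Real.exp (2 * A y)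
      * (deriv A y * (1 - 2 * m v r y / r) - dy m v r y / r)) x).trans
      ((hasDerivAt_exp_warp hA hx.2.2.2).mul
        (((hasDerivAt_deriv_warp hA hx.2.2.2).mul
          (((hMy.const_mul 2).div_const _).const_sub 1)).sub (hMyy.div_const _))).deriv
  have a : ∀ K, pd K (fun z => gammaAt A m z K 0 0) x =
      ![pd 0 (fun z => gammaAt A m z 0 0 0) x, pd 1 (fun z => gammaAt A m z 1 0 0) x, 0, 0,
        pd 4 (fun z => gammaAt A m z 4 0 0) x] K := by
    intro K; fin_cases K
    exacts [rfl, rfl, pd_const _ 0 x, pd_const _ 0 x, rfl]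
  have b : ∀ K, pd 0 (fun z => gammaAt A m z K 0 K) x =
      ![pd 0 (fun z => gammaAt A m z 0 0 0) x, pd 0 (fun z => gammaAt A m z 1 0 1) x, 0, 0, 0]
        K := by
    intro K; fin_cases K
    exacts [rfl, rfl, pd_const _ 0 x, pd_const _ 0 x, pd_const _ 0 x]
  rw [e1, e4] at a
  rw [e0] at b
  -- ∂_v Γ^v_{vv} occurs in both sums with opposite signs, so its value is irrelevant.
  generalize pd 0 (fun z => gammaAt A m z 0 0 0) x = g at a b
  simp only [ricci_metric hA hm h0 hx, a, b, sum_gammaAt]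
  simp [Fin.sum_univ_five, gammaAt, gamma, gammaV, gammaR, gammaθ, gammaϕ, gammaY]
  field_simp
  ring

end

end WarpedVaidya

namespace WarpedVaidya

noncomputable section

variable {Jv Jr Jy : TopologicalSpace.Opens ℝ} {A : ℝ → ℝ} {m : ℝ → ℝ → ℝ → ℝ}

/-! ### The components of the field equations -/

/-- The field equations after elimination of the potential, as equations at the point
`(v, r, y)`; here `F = f(φ, χ)`. -/
structure ComponentEquations (A : ℝ → ℝ) (m φ χ F : ℝ → ℝ → ℝ → ℝ) (v r y : ℝ) : Prop where
  rr :
    dr φ v r y * dr φ v r y + dr χ v r y * dr χ v r y + dr (dr F) v r y = 0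
  ry :
    dr φ v r y * dy φ v r y + dr χ v r y * dy χ v r y + dr (dy F) v r y
      - deriv A y * dr F v r y = 0
  vy :
    F v r y * (r * dr (dy m) v r y + dy m v r y) + r * dy m v r y * dr F v r y =
      r ^ 2 * (dv φ v r y * dy φ v r y + dv χ v r y * dy χ v r y + dv (dy F) v r y
        - deriv A y * dv F v r y)
  rθ :
    F v r y * (r * dr (dr m) v r y - 2 * dr m v r y) =
      r ^ 2 * (dv φ v r y * dr φ v r y + dv χ v r y * dr χ v r y + dv (dr F) v r y)
        - r * dv F v r y + dr F v r y * (3 * m v r y - r * dr m v r y - r)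
  θy :
    2 * (F v r y * dr m v r y + dr F v r y * m v r y) =
      r * (dv F v r y + dr F v r y) + r ^ 2 * Real.exp (2 * A y) *
        (deriv A y * dy F v r y - dy φ v r y * dy φ v r y - dy χ v r y * dy χ v r y
          - dy (dy F) v r y - 3 * deriv (deriv A) y * F v r y)
  vv :
    F v r y * (2 * dv m v r y - r * Real.exp (2 * A y) *
        (dy (dy m) v r y + 4 * deriv A y * dy m v r y)) =
      r ^ 2 * (dv φ v r y * dv φ v r y + dv χ v r y * dv χ v r y)
        + (r ^ 2 - 2 * m v r y * r) *
          (dv φ v r y * dr φ v r y + dv χ v r y * dr χ v r y + dv (dr F) v r y)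
        + r ^ 2 * dv (dv F) v r y + r * Real.exp (2 * A y) * dy F v r y * dy m v r y
        - r * dr F v r y * dv m v r y + dv F v r y * (r * dr m v r y - m v r y)

/-- The scalar curvature, the kinetic traces, the potential, □F and Λ all multiply g_{MN}.
Collecting them in one unknown Ω avoids computing any trace. -/
lemma exists_ricci_eq {f V : ℝ → ℝ → ℝ} {Λ : ℝ} {φ χ : ℝ → ℝ → ℝ → ℝ}
    (hfield : FieldEquations Jv Jr Jy A m φ χ f V Λ) {x : Fin 5 → ℝ}
    (hx : x ∈ coordDomain Jv Jr Jy) :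
    ∃ Ω : ℝ, ∀ M N : Fin 5, f (lift φ x) (lift χ x) * ricci (metric A m) x M N =
      pd M (lift φ) x * pd N (lift φ) x + pd M (lift χ) x * pd N (lift χ) x
      + hessian (metric A m) (lift fun v r y => f (φ v r y) (χ v r y)) x M N
      + metric A m x M N * Ω := by
  refine ⟨f (lift φ x) (lift χ x) * ((1 / 2) * trace (metric A m) x (ricci (metric A m) x))
    - (trace (metric A m) x (fun K L => pd K (lift φ) x * pd L (lift φ) x) / 2
      + trace (metric A m) x (fun K L => pd K (lift χ) x * pd L (lift χ) x) / 2
      + V (lift φ x) (lift χ x))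
    - trace (metric A m) x (hessian (metric A m) (lift fun v r y => f (φ v r y) (χ v r y)) x)
    - Λ, fun M N => ?_⟩
  have h := hfield x hx.1 hx.2.1 hx.2.2.1 hx.2.2.2 M N
  rw [einstein, energyMomentum] at h
  change _ = _ + hessian (metric A m) (lift fun v r y => f (φ v r y) (χ v r y)) x M N - _ *
    trace (metric A m) x (hessian (metric A m) (lift fun v r y => f (φ v r y) (χ v r y)) x) - _ at h
  linear_combination h

lemma pd_zero_fun (h : ℝ → ℝ → ℝ → ℝ) : pd 0 (lift h) = lift (dv h) :=
  funext fun x => pd_zero_lift h x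

lemma pd_one_fun (h : ℝ → ℝ → ℝ → ℝ) : pd 1 (lift h) = lift (dr h) :=
  funext fun x => pd_one_lift h x

lemma pd_two_fun (h : ℝ → ℝ → ℝ → ℝ) : pd 2 (lift h) = fun _ => 0 :=
  funext fun x => pd_two_lift h x

lemma pd_three_fun (h : ℝ → ℝ → ℝ → ℝ) : pd 3 (lift h) = fun _ => 0 :=
  funext fun x => pd_three_lift h x

lemma pd_four_fun (h : ℝ → ℝ → ℝ → ℝ) : pd 4 (lift h) = lift (dy h) :=
  funext fun x => pd_four_lift h x

lemma hessian_metric (hA : ContDiffOn ℝ ∞ A Jy) (hm : SmoothOn Jv Jr Jy m)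
    (h0 : (0 : ℝ) ∉ Jr) {x : Fin 5 → ℝ} (hx : x ∈ coordDomain Jv Jr Jy) (F : ℝ → ℝ → ℝ → ℝ)
    (M N : Fin 5) :
    hessian (metric A m) (lift F) x M N = pd M (pd N (lift F)) x
      - (gammaAt A m x 0 M N * dv F (x 0) (x 1) (x 4) + gammaAt A m x 1 M N * dr F (x 0) (x 1) (x 4)
        + gammaAt A m x 4 M N * dy F (x 0) (x 1) (x 4)) := by
  simp only [hessian, christoffel_metric hA hm h0 hx, Fin.sum_univ_five, pd_zero_fun, pd_one_fun,
    pd_two_fun, pd_three_fun, pd_four_fun, mul_zero, add_zero]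
  rfl

/-- The rr, ry and vy components of the metric vanish, so those equations are free of Ω. The other
three come from eliminating Ω between two components each. -/
lemma componentEquations (hA : ContDiffOn ℝ ∞ A Jy) (hm : SmoothOn Jv Jr Jy m)
    (h0 : (0 : ℝ) ∉ Jr) {f V : ℝ → ℝ → ℝ} {Λ : ℝ} {φ χ : ℝ → ℝ → ℝ → ℝ}
    (hfield : FieldEquations Jv Jr Jy A m φ χ f V Λ) {v r y : ℝ} (hv : v ∈ Jv) (hr : r ∈ Jr)
    (hy : y ∈ Jy) :
    ComponentEquations A m φ χ (fun v r y => f (φ v r y) (χ v r y)) v r y := by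
  -- The equator θ = π/2 is an arbitrary choice of angles inside the coordinate domain.
  obtain ⟨x, hx, rfl, rfl, rfl⟩ : ∃ x ∈ coordDomain Jv Jr Jy, x 0 = v ∧ x 1 = r ∧ x 4 = y :=
    ⟨![v, r, Real.pi / 2, 0, y], ⟨hv, hr, ⟨half_pos Real.pi_pos, half_lt_self Real.pi_pos⟩, hy⟩,
      rfl, rfl, rfl⟩
  obtain ⟨Ω, hΩ⟩ := exists_ricci_eq hfield hx
  have hr0 : x 1 ≠ 0 := fun h => h0 (h ▸ hr)
  have hE : Real.exp (2 * A (x 4)) ≠ 0 := Real.exp_ne_zero _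
  have e11 := hΩ 1 1
  have e14 := hΩ 1 4
  have e04 := hΩ 0 4
  have e01 := hΩ 0 1
  have e22 := hΩ 2 2
  have e44 := hΩ 4 4
  have e00 := hΩ 0 0
  clear hΩ
  rw [ricci_rr hA hm h0 hx, hessian_metric hA hm h0 hx] at e11
  rw [ricci_ry hA hm h0 hx, hessian_metric hA hm h0 hx] at e14
  rw [ricci_vy hA hm h0 hx, hessian_metric hA hm h0 hx] at e04
  rw [ricci_vr hA hm h0 hx, hessian_metric hA hm h0 hx] at e01
  rw [ricci_θθ hA hm h0 hx, hessian_metric hA hm h0 hx] at e22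
  rw [ricci_yy hA hm h0 hx, hessian_metric hA hm h0 hx] at e44
  rw [ricci_vv hA hm h0 hx, hessian_metric hA hm h0 hx] at e00
  simp only [pd_zero_fun, pd_one_fun, pd_two_fun, pd_four_fun, pd_const] at e11 e14 e04 e01 e22 e44 e00
  simp [metric, gammaAt, gamma, gammaV, gammaR, gammaY] at e11 e14 e04 e01 e22 e44 e00
  simp only [lift] at e11 e14 e04 e01 e22 e44 e00
  set F : ℝ → ℝ → ℝ → ℝ := fun v r y => f (φ v r y) (χ v r y) with hF
  change F (x 0) (x 1) (x 4) * _ = _ at e04 e01 e22 e44 e00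
  constructor
  · linear_combination -e11
  · linear_combination -e14
  · linear_combination (norm := (field_simp; ring)) x 1 ^ 2 * e04
  -- The multipliers cancel Ω: g_vr = E, g_θθ = E r², g_yy = 1 and g_vv = −E (1 − 2m/r).
  · linear_combination (norm := (field_simp; ring)) x 1 ^ 2 * e01 - e22
  · linear_combination (norm := (field_simp; ring)) e22 - Real.exp (2 * A (x 4)) * x 1 ^ 2 * e44
  · linear_combination (norm := (field_simp; ring))
      x 1 ^ 2 * e00 + x 1 ^ 2 * (1 - 2 * m (x 0) (x 1) (x 4) / x 1) * e01

end

end WarpedVaidya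

namespace WarpedVaidya

noncomputable section

/-! ### The field equations in a differential ring -/

/-- The reduced field equations in a ring with three commuting derivations. -/
structure ReducedSystem (R : Type*) [CommRing R] [Algebra ℝ R] where
  Dv : Derivation ℝ R R
  Dr : Derivation ℝ R R
  Dy : Derivation ℝ R R
  vr : ∀ x, Dv (Dr x) = Dr (Dv x)
  vy : ∀ x, Dv (Dy x) = Dy (Dv x)
  yr : ∀ x, Dy (Dr x) = Dr (Dy x)
  (r s E A₁ A₂ m φ χ F : R)
  rs : r * s = 1
  v_r : Dv r = 0
  r_r : Dr r = 1
  y_r : Dy r = 0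
  v_E : Dv E = 0
  r_E : Dr E = 0
  v_A₁ : Dv A₁ = 0
  r_A₁ : Dr A₁ = 0
  v_A₂ : Dv A₂ = 0
  r_A₂ : Dr A₂ = 0
  eq_rr : Dr φ * Dr φ + Dr χ * Dr χ + Dr (Dr F) = 0
  eq_ry : Dr φ * Dy φ + Dr χ * Dy χ + Dr (Dy F) - A₁ * Dr F = 0
  eq_vy : F * (r * Dr (Dy m) + Dy m) + r * Dy m * Dr F =
    r ^ 2 * (Dv φ * Dy φ + Dv χ * Dy χ + Dy (Dv F) - A₁ * Dv F)
  eq_rθ : F * (r * Dr (Dr m) - 2 * Dr m) =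
    r ^ 2 * (Dv φ * Dr φ + Dv χ * Dr χ + Dr (Dv F)) - r * Dv F + Dr F * (3 * m - r * Dr m - r)
  eq_θy : 2 * (F * Dr m + Dr F * m) = r * (Dv F + Dr F) + r ^ 2 * E *
    (A₁ * Dy F - Dy φ * Dy φ - Dy χ * Dy χ - Dy (Dy F) - 3 * A₂ * F)
  eq_vv : F * (2 * Dv m - r * E * (Dy (Dy m) + 4 * A₁ * Dy m)) =
    r ^ 2 * (Dv φ * Dv φ + Dv χ * Dv χ)
      + (r ^ 2 - 2 * m * r) * (Dv φ * Dr φ + Dv χ * Dr χ + Dr (Dv F))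
      + r ^ 2 * Dv (Dv F) + r * E * Dy F * Dy m - r * Dr F * Dv m + Dv F * (r * Dr m - m)

namespace ReducedSystem

variable {R : Type*} [CommRing R] [Algebra ℝ R] (W : ReducedSystem R)

lemma eq_zero_of_r_mul {x : R} (h : W.r * x = 0) : x = 0 := by
  linear_combination W.s * h - x * W.rs

/-- The third derivative F_rry is eliminated between the y-derivative of the rr equation and the
r-derivative of the ry equation; the remaining A' F_rr is replaced by means of the rr equation. For
a field with φ_r = 0 or φ_y = 0 the left side has no contribution. -/
lemma radial_identity :
    W.Dr W.φ * W.Dr (W.Dy W.φ) - W.Dr (W.Dr W.φ) * W.Dy W.φ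
      + (W.Dr W.χ * W.Dr (W.Dy W.χ) - W.Dr (W.Dr W.χ) * W.Dy W.χ) =
    W.A₁ * (W.Dr W.φ * W.Dr W.φ + W.Dr W.χ * W.Dr W.χ) := by
  have h1 := congrArg W.Dy W.eq_rr
  have h2 := congrArg W.Dr W.eq_ry
  simp only [map_add, map_sub, map_zero, Derivation.leibniz, smul_eq_mul, W.yr, W.r_A₁] at h1 h2
  linear_combination h1 - h2 - W.A₁ * W.eq_rr

lemma map_two (D : Derivation ℝ R R) : D 2 = 0 := by simpa using D.map_natCast 2

lemma map_three (D : Derivation ℝ R R) : D 3 = 0 := by simpa using D.map_natCast 3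

lemma map_four (D : Derivation ℝ R R) : D 4 = 0 := by simpa using D.map_natCast 4

lemma eq_zero_of_two_mul {x : R} (h : 2 * x = 0) : x = 0 := by
  have h2 : algebraMap ℝ R (1 / 2) * 2 = 1 := by
    rw [← map_ofNat (algebraMap ℝ R) 2, ← map_mul]; norm_num
  linear_combination algebraMap ℝ R (1 / 2) * h - x * h2

/-- When nothing but m depends on r, the θy equation is 2 F m_r = r F_v + r² E X with X independent
of r. Its r-derivative is compatible with the rθ equation only if F_v = 0, so m_r is r² times a
function of (v, y). Inserted into the vy equation this gives F r Q_y = k with F, Q_y and k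
independent of r; hence Q_y = k = 0, and then m_y = 0. -/
lemma of_no_radial (Fi : R) (hF : W.F * Fi = 1) (hφ : W.Dr W.φ = 0) (hχ : W.Dr W.χ = 0)
    (hFr : W.Dr W.F = 0) :
    W.Dv W.F = 0 ∧ W.Dy W.m = 0 ∧ ∃ Q, 2 * W.Dr W.m = W.r ^ 2 * Q ∧ W.Dr Q = 0 ∧ W.Dy Q = 0 := by
  have c1 : W.Dr (W.Dv W.F) = 0 := by rw [← W.vr, hFr, map_zero]
  have c2 : W.Dr (W.Dy W.F) = 0 := by rw [← W.yr, hFr, map_zero]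
  have c3 : W.Dr (W.Dy (W.Dy W.F)) = 0 := by rw [← W.yr, c2, map_zero]
  have c4 : W.Dr (W.Dy W.φ) = 0 := by rw [← W.yr, hφ, map_zero]
  have c5 : W.Dr (W.Dy W.χ) = 0 := by rw [← W.yr, hχ, map_zero]
  have c6 : W.Dr (W.Dv W.φ) = 0 := by rw [← W.vr, hφ, map_zero]
  have c7 : W.Dr (W.Dv W.χ) = 0 := by rw [← W.vr, hχ, map_zero]
  have hFi : W.Dr Fi = 0 := by
    have := congrArg W.Dr hF
    simp only [Derivation.leibniz, smul_eq_mul, hFr, mul_zero, add_zero,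
      Derivation.map_one_eq_zero] at this
    linear_combination Fi * this - W.Dr Fi * hF
  have hFF : ∀ x, W.F * x = 0 → x = 0 := fun x h => by linear_combination Fi * h - x * hF
  have h1 := congrArg W.Dr W.eq_θy
  simp only [map_add, map_sub, map_zero, Derivation.leibniz, Derivation.leibniz_pow, smul_eq_mul,
    W.r_A₁, W.r_A₂, W.r_E, W.r_r, c1, c2, c3, c4, c5, hFr, map_two, map_three, mul_zero, zero_mul,
    nsmul_eq_mul] at h1
  have e1 := W.eq_rθ
  have e2 := W.eq_θy
  have e3 := W.eq_vy
  rw [hφ, hχ, c1, hFr] at e1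
  rw [hFr] at e2 e3
  have hFv : W.Dv W.F = 0 := by
    refine W.eq_zero_of_r_mul ?_
    push_cast at h1
    linear_combination 2 * e1 - W.r * h1 + 2 * e2
  refine ⟨hFv, ?_⟩
  rw [hFv, map_zero] at e3
  set X := W.A₁ * W.Dy W.F - W.Dy W.φ * W.Dy W.φ - W.Dy W.χ * W.Dy W.χ - W.Dy (W.Dy W.F)
    - 3 * W.A₂ * W.F with hX
  have hQ : 2 * W.Dr W.m = W.r ^ 2 * (Fi * W.E * X) := by
    rw [hFv] at e2
    linear_combination Fi * e2 - 2 * W.Dr W.m * hF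
  have hXr : W.Dr X = 0 := by
    simp only [hX, map_sub, Derivation.leibniz, smul_eq_mul, W.r_A₁, W.r_A₂, hFr, c2, c3, c4, c5,
      map_three]
    ring
  have hQr : W.Dr (Fi * W.E * X) = 0 := by
    simp only [Derivation.leibniz, smul_eq_mul, hFi, W.r_E, hXr]
    ring
  generalize Fi * W.E * X = Q at hQ hQr
  set k := W.Dv W.φ * W.Dy W.φ + W.Dv W.χ * W.Dy W.χ with hk
  have hkr : W.Dr k = 0 := by
    simp only [hk, map_add, Derivation.leibniz, smul_eq_mul, c4, c5, c6, c7]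
    ring
  have hQy := congrArg W.Dy hQ
  have hQyr : W.Dr (W.Dy Q) = 0 := by rw [← W.yr, hQr, map_zero]
  simp only [Derivation.leibniz, Derivation.leibniz_pow, smul_eq_mul, W.yr, W.y_r, map_two,
    mul_zero, add_zero, smul_zero] at hQy
  have e4 := congrArg W.Dr e3
  simp only [map_add, map_sub, Derivation.leibniz, Derivation.leibniz_pow, smul_eq_mul,
    W.r_r, hFr, hkr, map_zero, mul_zero, add_zero, nsmul_eq_mul] at e4
  have e5 := congrArg W.Dr hQy
  simp only [Derivation.leibniz, Derivation.leibniz_pow, smul_eq_mul, W.r_r, map_two, hQyr,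
    mul_zero, add_zero, zero_add, nsmul_eq_mul] at e5
  push_cast at e4 e5
  -- The r-derivative of the vy equation, with m_ry and m_rry expressed by Q_y, is a multiple of r.
  have e6 : 2 * (2 * (W.F * W.r * W.Dy Q - k)) = 0 := by
    refine W.eq_zero_of_r_mul ?_
    linear_combination 2 * e4 - 2 * W.F * hQy - W.F * W.r * e5
  have e7 := eq_zero_of_two_mul (eq_zero_of_two_mul e6)
  have e8 := congrArg W.Dr e7
  simp only [map_sub, Derivation.leibniz, smul_eq_mul, W.r_r, hFr, hkr, hQyr, map_zero, mul_zero,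
    add_zero, zero_add, sub_zero] at e8
  have hQ0 : W.Dy Q = 0 := hFF _ (by linear_combination e8)
  refine ⟨hFF _ ?_, Q, hQ, hQr, hQ0⟩
  rw [hQ0] at e7 hQy
  have e9 := eq_zero_of_two_mul (x := W.Dr (W.Dy W.m)) (by linear_combination hQy)
  linear_combination e3 - W.F * W.r * e9 - W.r ^ 2 * e7

/-- The coefficient of `r` in `∂F/∂v`. -/
def β : R := W.Dr (W.Dv W.F)

/-- The constant term of `∂F/∂v` as a function of `r`. -/
def α : R := W.Dv W.F - W.r * W.β

/-- The source of the `vy` equation. -/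
def K : R := W.Dv W.φ * W.Dy W.φ + W.Dv W.χ * W.Dy W.χ + W.Dy (W.Dv W.F) - W.A₁ * W.Dv W.F

/-- The integration constant of the `vy` equation. -/
def k : R := 3 * (W.r * W.Dy W.m * W.F) - W.r ^ 3 * W.K

/-- The products of derivatives of the fields in the `rr`, `ry` and `vy` equations behave as if one
of the fields did not depend on `v`. -/
structure Adapted : Prop where
  rr : W.Dv (W.Dr W.φ * W.Dr W.φ + W.Dr W.χ * W.Dr W.χ) = 0
  ry : W.Dv (W.Dr W.φ * W.Dy W.φ + W.Dr W.χ * W.Dy W.χ) = 0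
  vy : W.Dr (W.Dv W.φ * W.Dy W.φ + W.Dv W.χ * W.Dy W.χ) = 0

/-- The first equation for the coefficients of the mass: it expresses that the coupling is the
quotient of `k + r ^ 3 K` and `3 r ∂m/∂y`. -/
lemma radial_eq (u q w : R) (hu : u = W.r * W.Dy W.m)
    (hq : q = 3 * W.m - W.r * W.Dr W.m - W.r)
    (hw : w = 2 * W.Dr W.m - W.r * W.Dr (W.Dr W.m)) :
    (W.k + W.r ^ 3 * W.K) * u * w + (3 * W.r ^ 2 * W.K * u - (W.k + W.r ^ 3 * W.K) * W.Dr u) * q =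
      3 * (W.α * W.r - W.r ^ 2 * (W.Dv W.φ * W.Dr W.φ + W.Dv W.χ * W.Dr W.χ)) * u ^ 2 := by
  have h1 := W.eq_rθ
  have h2 := W.eq_vy
  have h3 : W.Dr u = W.r * W.Dr (W.Dy W.m) + W.Dy W.m := by
    simp only [hu, Derivation.leibniz, W.r_r, smul_eq_mul]; ring
  rw [k, h3, hq, hw, K, hu, α, β]
  linear_combination (-3) * W.r ^ 2 * W.Dy W.m ^ 2 * h1
    - 3 * W.r * W.Dy W.m * (3 * W.m - W.r * W.Dr W.m - W.r) * h2

namespace Adapted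

variable {W}

/-- The v-derivative of the rr equation leaves only ∂_r² F_v = 0, so F_v is affine in r. -/
lemma r_β (h : W.Adapted) : W.Dr W.β = 0 := by
  have h1 := congrArg W.Dv W.eq_rr
  rw [map_add, h.rr, map_zero, zero_add, W.vr, W.vr] at h1
  exact h1

/-- The v-derivative of the ry equation leaves only ∂_r ∂_y F_v = A' ∂_r F_v. -/
lemma y_β (h : W.Adapted) : W.Dy W.β = W.A₁ * W.β := by
  have h1 := congrArg W.Dv W.eq_ry
  rw [map_sub, map_add, h.ry, map_zero, zero_add, W.vr, W.vy, Derivation.leibniz, W.vr,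
    W.v_A₁] at h1
  rw [β, W.yr]
  simp only [smul_eq_mul] at h1
  linear_combination h1

lemma r_α (h : W.Adapted) : W.Dr W.α = 0 := by
  rw [α, map_sub, Derivation.leibniz, h.r_β, W.r_r, β]
  simp

/-- The products of the fields in K are independent of r, and the remaining terms contribute β_y −
A' β = 0. -/
lemma r_K (h : W.Adapted) : W.Dr W.K = 0 := by
  have := h.y_β
  rw [β, W.yr] at this
  simp only [K, map_sub, map_add _ _ (W.Dy _), h.vy, Derivation.leibniz, W.r_A₁, smul_eq_mul, this]
  ring

/-- The vy equation is ∂_r (r m_y F) = r² K, and K is independent of r. -/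
lemma r_k (h : W.Adapted) : W.Dr W.k = 0 := by
  have h1 := W.eq_vy
  simp only [k, map_sub, Derivation.leibniz, Derivation.leibniz_pow, h.r_K, map_three, W.r_r,
    smul_eq_mul, nsmul_eq_mul]
  push_cast
  rw [K]
  linear_combination 3 * h1

/-- The consequence of the `vv` equation, in terms of `s = ∂φ/∂v ∂φ/∂r + ∂χ/∂v ∂χ/∂r` and the
products `p = ∂φ/∂v ∂φ/∂v + ∂χ/∂v ∂χ/∂v` and `z = ∂φ/∂y ∂φ/∂y + ∂χ/∂y ∂χ/∂y`. -/
lemma vv_eq (h : W.Adapted) (s p z : R) (hs : s = W.Dv W.φ * W.Dr W.φ + W.Dv W.χ * W.Dr W.χ)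
    (hp : p = W.Dv W.φ * W.Dv W.φ + W.Dv W.χ * W.Dv W.χ)
    (hz : z = W.Dy W.φ * W.Dy W.φ + W.Dy W.χ * W.Dy W.χ) :
    2 * W.Dr ((W.r ^ 2 - 2 * W.r * W.m) * s) + 2 * W.r ^ 2 * W.Dv s + 2 * W.Dr (W.r ^ 2 * p)
      + 2 * W.Dr (W.α * W.m + (W.α + W.r * W.β) * (W.r * W.Dr W.m)) =
    -(W.r * (W.Dv W.α + W.β))
      + 2 * W.r ^ 2 * (W.E * (W.A₁ * W.Dy W.α - W.Dy (W.Dy W.α) - 3 * W.A₂ * W.α)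
        - W.E * W.Dy W.K - 4 * W.A₁ * W.E * W.K - 2 * W.Dv W.β)
      + 3 * W.r ^ 3 * (W.E * (W.A₁ * W.Dy W.β - W.Dy (W.Dy W.β) - 3 * W.A₂ * W.β))
      - W.r * W.Dr (W.r ^ 2 * (W.E * W.Dv z)) := by
  obtain ⟨ℓ, hℓ⟩ : ∃ ℓ, ℓ = W.Dv W.F := ⟨_, rfl⟩
  have hα : ℓ = W.α + W.r * W.β := by rw [hℓ, α]; ring
  have hb : W.Dr ℓ = W.β := by rw [hℓ, β]
  have e1 := congrArg W.Dv W.eq_rθ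
  have e2 := congrArg W.Dr (congrArg W.Dv W.eq_θy)
  have e3 := congrArg W.Dr W.eq_vv
  have e4' := W.eq_vy
  have e5 := W.eq_vy
  have hK : W.Dv W.φ * W.Dy W.φ + W.Dv W.χ * W.Dy W.χ + W.Dy (W.Dv W.F) - W.A₁ * W.Dv W.F = W.K :=
    rfl
  rw [hK] at e4' e5
  have e4 := congrArg W.Dy e4'
  rw [← hs, ← hℓ, hb] at e1
  rw [sub_sub (W.A₁ * W.Dy W.F), ← hz] at e2
  rw [← hs, ← hp, ← hℓ, hb] at e3
  have dα := h.r_α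
  have dβ := h.r_β
  have dαv : W.Dr (W.Dv W.α) = 0 := by rw [← W.vr, dα, map_zero]
  have dαy : W.Dr (W.Dy W.α) = 0 := by rw [← W.yr, dα, map_zero]
  have dαyy : W.Dr (W.Dy (W.Dy W.α)) = 0 := by rw [← W.yr, dαy, map_zero]
  have dβv : W.Dr (W.Dv W.β) = 0 := by rw [← W.vr, dβ, map_zero]
  have dβy : W.Dr (W.Dy W.β) = 0 := by rw [← W.yr, dβ, map_zero]
  have dβyy : W.Dr (W.Dy (W.Dy W.β)) = 0 := by rw [← W.yr, dβy, map_zero]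
  simp only [map_add, map_sub, map_zero, Derivation.leibniz, Derivation.leibniz_pow, smul_eq_mul,
    nsmul_eq_mul, W.vr, W.vy, W.yr, W.r_r, W.v_r, W.y_r, W.r_E, W.v_E, W.r_A₁, W.v_A₁,
    W.r_A₂, W.v_A₂, map_two, map_three, map_four, ← hℓ, hb] at e1 e2 e3 e4 ⊢
  simp only [hα, map_add, Derivation.leibniz, smul_eq_mul, W.r_r, W.v_r, W.y_r, dα, dβ, dαv, dαy,
    dαyy, dβv, dβy, dβyy, map_zero] at e1 e2 e3 e4 ⊢
  push_cast at *
  -- The multipliers make the terms F m_vrr, F m_vr, F m_yyr and F A' m_yr cancel. What is left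
  -- contains m only together with α, β or s.
  linear_combination (-2) * e1 + W.r * e2 - 2 * e3 - 2 * W.E * e4 - 8 * W.A₁ * W.E * e5

end Adapted

end ReducedSystem

end

end WarpedVaidya

/-! ### The three kinds of dependence on the coordinates lead to one mass equation -/

namespace WarpedVaidya

noncomputable section

namespace ReducedSystem

variable {R : Type*} [CommRing R] [Algebra ℝ R] (W : ReducedSystem R)

/-- The consequences of the field equations that the three possible dependences of the fields on the
coordinates have in common. -/
structure MassEquation : Prop where
  adapted : W.Adapted
  K_eq_zero : W.Dv W.F = 0 → W.K = 0
  source : ∃ ε c₀ c₂ c₃ c₄, W.Dr ε = 0 ∧ W.Dr c₀ = 0 ∧ W.Dr c₂ = 0 ∧ W.Dr c₃ = 0 ∧ W.Dr c₄ = 0 ∧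
    48 * (W.Dv W.φ * W.Dr W.φ + W.Dv W.χ * W.Dr W.χ) * (W.r * W.Dy W.m) =
      ε * W.Dy (W.α * W.m + (W.α + W.r * W.β) * (W.r * W.Dr W.m)) + c₀ + c₂ * W.r ^ 2
        + c₃ * W.r ^ 3 + c₄ * W.r ^ 4

/-- All products that contain a v-derivative of a field vanish. -/
lemma massEquation_of_static (hφ : W.Dv W.φ = 0) (hχ : W.Dv W.χ = 0) : W.MassEquation where
  adapted := by
    constructor <;> simp [W.vr, W.vy, hφ, hχ]
  K_eq_zero h := by simp [K, hφ, hχ, h]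
  source := ⟨0, 0, 0, 0, 0, by simp [hφ, hχ]⟩

/-- Here φ_v χ-type products with r-derivatives vanish, so the source is zero. If F_v = 0, then K =
χ_v χ_y, and `vv_eq` becomes 2 χ_v² = r · (a term independent of r), which forces χ_v = 0. -/
lemma massEquation_of_radial_eq_zero [IsReduced R] (hφ : W.Dv W.φ = 0) (hχ : W.Dr W.χ = 0) :
    W.MassEquation := by
  have c1 : W.Dr (W.Dv W.χ) = 0 := by rw [← W.vr, hχ, map_zero]
  have c2 : W.Dr (W.Dy W.χ) = 0 := by rw [← W.yr, hχ, map_zero]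
  have c3 : W.Dr (W.Dy (W.Dv W.χ)) = 0 := by rw [← W.yr, c1, map_zero]
  have h : W.Adapted := by
    constructor <;> simp [W.vr, W.vy, hφ, hχ, c1, c2]
  refine ⟨h, fun hF => ?_, 0, 0, 0, 0, 0, by simp [hφ, hχ]⟩
  have hβ : W.β = 0 := by simp [β, hF]
  have hα : W.α = 0 := by simp [α, hF, hβ]
  have dK := h.r_K
  have dKy : W.Dr (W.Dy W.K) = 0 := by rw [← W.yr, dK, map_zero]
  have h1 := h.vv_eq 0 (W.Dv W.χ * W.Dv W.χ) (W.Dy W.φ * W.Dy W.φ + W.Dy W.χ * W.Dy W.χ)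
    (by simp [hφ, hχ]) (by simp [hφ]) rfl
  simp only [hα, hβ, hφ, c1, c2, c3, map_add, map_zero, mul_zero, zero_mul, zero_add, add_zero,
    sub_zero, neg_zero, Derivation.leibniz, Derivation.leibniz_pow, smul_eq_mul, nsmul_eq_mul,
    W.vy, W.r_r, W.r_E] at h1
  have h2 : 2 * (2 * (W.Dv W.χ * W.Dv W.χ) - W.r * (- W.E * W.Dy W.K - 4 * W.A₁ * W.E * W.K
      - 2 * W.E * W.Dy W.χ * W.Dy (W.Dv W.χ))) = 0 := by
    refine W.eq_zero_of_r_mul ?_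
    push_cast at h1
    linear_combination h1
  have h3 := eq_zero_of_two_mul h2
  have h4 := congrArg W.Dr h3
  simp only [dK, dKy, c1, c2, c3, map_sub, map_neg, map_zero, mul_zero, zero_add,
    add_zero, sub_zero, neg_zero, Derivation.leibniz, smul_eq_mul, W.r_r, W.r_E, W.r_A₁, map_two,
    map_four] at h4
  have h5 : 2 * (W.Dv W.χ * W.Dv W.χ) = 0 := by linear_combination h3 - W.r * h4
  have h6 : W.Dv W.χ = 0 := by
    rw [← pow_eq_zero_iff two_ne_zero, pow_two, eq_zero_of_two_mul h5]
  simp [K, hφ, h6, hF]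

/-- With χ_y = 0 the product s = χ_v χ_r is independent of y. The y-derivative of `vv_eq` is
therefore a total r-derivative in which m enters through r m_y s and the α, β term; its integral is
the source equation. -/
lemma massEquation_of_transverse_eq_zero [IsReduced R] (Ai : R) (hA : W.A₁ * Ai = 1)
    (hφ : W.Dv W.φ = 0) (hχ : W.Dy W.χ = 0) : W.MassEquation := by
  have c1 : W.Dr (W.Dy W.χ) = 0 := by rw [hχ, map_zero]
  have c2 : W.Dy (W.Dv W.χ) = 0 := by rw [← W.vy, hχ, map_zero]
  have h0 : W.Dr (W.Dv W.χ) = 0 := by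
    -- Only the χ_r² term of the radial identity can depend on v, so χ_r χ_rv = 0. Differentiating
    -- once more in v and multiplying by χ_rv gives χ_rv³ = 0.
    have h1 := congrArg W.Dv W.radial_identity
    simp only [hχ, W.vr, W.vy, hφ, W.v_A₁, map_add, map_sub, map_zero, mul_zero,
      zero_add, add_zero, sub_zero, Derivation.leibniz, smul_eq_mul] at h1
    have h2 : W.Dr W.χ * W.Dr (W.Dv W.χ) = 0 := by
      refine eq_zero_of_two_mul ?_
      linear_combination (-Ai) * h1 - 2 * W.Dr W.χ * W.Dr (W.Dv W.χ) * hA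
    have h3 := congrArg W.Dv h2
    simp only [W.vr, map_zero, Derivation.leibniz, smul_eq_mul] at h3
    rw [← pow_eq_zero_iff three_ne_zero]
    linear_combination W.Dr (W.Dv W.χ) * h3 - W.Dr (W.Dv (W.Dv W.χ)) * h2
  have c3 : W.Dr (W.Dv (W.Dv W.χ)) = 0 := by rw [← W.vr, h0, map_zero]
  have h : W.Adapted := by
    constructor <;> simp [W.vr, W.vy, hφ, hχ, h0]
  refine ⟨h, fun hF => by simp [K, hφ, hχ, hF], ?_⟩
  have h1 := h.vv_eq (W.Dv W.χ * W.Dr W.χ) (W.Dv W.χ * W.Dv W.χ)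
    (W.Dy W.φ * W.Dy W.φ) (by simp [hφ]) (by simp [hφ]) (by simp [hχ])
  have hs : W.Dy (W.Dv W.χ * W.Dr W.χ) = 0 := by simp [W.yr, c1, c2]
  have hsv : W.Dy (W.Dv (W.Dv W.χ * W.Dr W.χ)) = 0 := by rw [← W.vy, hs, map_zero]
  have hp : W.Dy (W.Dr (W.r ^ 2 * (W.Dv W.χ * W.Dv W.χ))) = 0 := by
    rw [W.yr]; simp [W.y_r, c2]
  have hz : W.Dv (W.Dy W.φ * W.Dy W.φ) = 0 := by simp [W.vy, hφ]
  rw [hz, mul_zero, mul_zero, map_zero, mul_zero, sub_zero] at h1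
  set x₀ := W.E * (W.A₁ * W.Dy W.α - W.Dy (W.Dy W.α) - 3 * W.A₂ * W.α)
        - W.E * W.Dy W.K - 4 * W.A₁ * W.E * W.K - 2 * W.Dv W.β with hx₀
  set x₁ := W.E * (W.A₁ * W.Dy W.β - W.Dy (W.Dy W.β) - 3 * W.A₂ * W.β) with hx₁
  have dα := h.r_α
  have dβ := h.r_β
  have dK := h.r_K
  have dαv : W.Dr (W.Dv W.α) = 0 := by rw [← W.vr, dα, map_zero]
  have dαy : W.Dr (W.Dy W.α) = 0 := by rw [← W.yr, dα, map_zero]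
  have dαyy : W.Dr (W.Dy (W.Dy W.α)) = 0 := by rw [← W.yr, dαy, map_zero]
  have dβv : W.Dr (W.Dv W.β) = 0 := by rw [← W.vr, dβ, map_zero]
  have dβy : W.Dr (W.Dy W.β) = 0 := by rw [← W.yr, dβ, map_zero]
  have dβyy : W.Dr (W.Dy (W.Dy W.β)) = 0 := by rw [← W.yr, dβy, map_zero]
  have dKy : W.Dr (W.Dy W.K) = 0 := by rw [← W.yr, dK, map_zero]
  have dx₀ : W.Dr x₀ = 0 := by
    simp [hx₀, W.r_E, W.r_A₁, W.r_A₂, dα, dαy, dαyy, dβv, dK, dKy, map_two, map_three, map_four]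
  have dx₁ : W.Dr x₁ = 0 := by
    simp [hx₁, W.r_E, W.r_A₁, W.r_A₂, dβ, dβy, dβyy, map_three]
  have dx₀y : W.Dr (W.Dy x₀) = 0 := by rw [← W.yr, dx₀, map_zero]
  have dx₁y : W.Dr (W.Dy x₁) = 0 := by rw [← W.yr, dx₁, map_zero]
  have dy₁ : W.Dr (W.Dy (W.Dv W.α + W.β)) = 0 := by
    rw [← W.yr, map_add, dαv, dβ, add_zero, map_zero]
  generalize x₀ = X at *
  generalize x₁ = Y at *
  generalize hZ : W.Dv W.α + W.β = Z at *
  generalize hM : W.α * W.m + (W.α + W.r * W.β) * (W.r * W.Dr W.m) = M at *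
  have h2 := congrArg W.Dy h1
  simp only [map_add, map_neg, Derivation.leibniz _ (2 : R), Derivation.leibniz _ (2 * W.r ^ 2),
    Derivation.leibniz _ (3 * W.r ^ 3), Derivation.leibniz _ (W.r) Z, smul_eq_mul, hsv, hp, map_two,
    map_three, Derivation.leibniz_pow, Derivation.leibniz _ (3 : R), W.y_r, smul_zero, mul_zero,
    add_zero] at h2
  rw [W.yr, W.yr, Derivation.leibniz _ (W.r ^ 2 - 2 * W.r * W.m), hs, map_sub] at h2
  simp only [Derivation.leibniz W.Dy, Derivation.leibniz_pow W.Dy, smul_eq_mul, W.y_r, mul_zero,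
    map_two, add_zero, smul_zero, zero_add, zero_sub] at h2
  refine ⟨24, _, 6 * W.Dy Z, -8 * W.Dy X, -9 * W.Dy Y, by simpa using W.Dr.map_natCast 24, ?_,
    ?_, ?_, ?_, eq_add_of_sub_eq (eq_add_of_sub_eq (eq_add_of_sub_eq (sub_eq_iff_eq_add'.1 rfl)))⟩
  · rw [hφ, zero_mul, zero_add]
    obtain ⟨t, ht⟩ : ∃ t, t = W.Dv W.χ * W.Dr W.χ := ⟨_, rfl⟩
    rw [← ht] at h2 ⊢
    have h24 : W.Dr 24 = 0 := by simpa using W.Dr.map_natCast 24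
    have h48 : W.Dr 48 = 0 := by simpa using W.Dr.map_natCast 48
    have h6 : W.Dr 6 = 0 := by simpa using W.Dr.map_natCast 6
    have h8 : W.Dr (-8) = 0 := by simpa using W.Dr.map_natCast 8
    have h9 : W.Dr (-9) = 0 := by simpa using W.Dr.map_natCast 9
    simp only [map_sub, map_neg, Derivation.leibniz, Derivation.leibniz_pow, smul_eq_mul, W.r_r,
      nsmul_eq_mul, dx₀y, dx₁y, dy₁, map_two, h6, h8, h9, h24, h48] at h2 ⊢
    push_cast at h2 ⊢
    linear_combination (-12) * h2
  · rw [Derivation.leibniz, dy₁, show W.Dr 6 = 0 by simpa using W.Dr.map_natCast 6]; simp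
  · rw [Derivation.leibniz, dx₀y, show W.Dr (-8) = 0 by simpa using W.Dr.map_natCast 8]; simp
  · rw [Derivation.leibniz, dx₁y, show W.Dr (-9) = 0 by simpa using W.Dr.map_natCast 9]; simp

end ReducedSystem

end

end WarpedVaidya

namespace WarpedVaidya

noncomputable section

/-! ### Leading coefficients of Laurent polynomials -/

/-- On `J`, the function `g` is a Laurent polynomial of order at least `e`, in which the
coefficient of `r ^ e` is `c`. -/
def IsLead (J : Set ℝ) (e : ℤ) (g : ℝ → ℝ) (c : ℝ) : Prop :=
  ∃ P : Polynomial ℝ, P.eval 0 = c ∧ ∀ r ∈ J, g r = r ^ e * P.eval r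

namespace IsLead

variable {J : Set ℝ} {e e' : ℤ} {g h : ℝ → ℝ} {c c' : ℝ}

lemma congr (hg : IsLead J e g c) (hh : ∀ r ∈ J, h r = g r) : IsLead J e h c := by
  obtain ⟨P, hP, hg⟩ := hg
  exact ⟨P, hP, fun r hr => by rw [hh r hr, hg r hr]⟩

lemma add (hg : IsLead J e g c) (hh : IsLead J e h c') :
    IsLead J e (fun r => g r + h r) (c + c') := by
  obtain ⟨P, hP, hg⟩ := hg
  obtain ⟨Q, hQ, hh⟩ := hh
  refine ⟨P + Q, by simp [hP, hQ], fun r hr => ?_⟩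
  simp only [hg r hr, hh r hr, Polynomial.eval_add, mul_add]

lemma sub (hg : IsLead J e g c) (hh : IsLead J e h c') :
    IsLead J e (fun r => g r - h r) (c - c') := by
  obtain ⟨P, hP, hg⟩ := hg
  obtain ⟨Q, hQ, hh⟩ := hh
  refine ⟨P - Q, by simp [hP, hQ], fun r hr => ?_⟩
  simp only [hg r hr, hh r hr, Polynomial.eval_sub, mul_sub]

lemma mul (hJ : J ⊆ Ioi 0) (hg : IsLead J e g c) (hh : IsLead J e' h c') :
    IsLead J (e + e') (fun r => g r * h r) (c * c') := by
  obtain ⟨P, hP, hg⟩ := hg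
  obtain ⟨Q, hQ, hh⟩ := hh
  refine ⟨P * Q, by simp [hP, hQ], fun r hr => ?_⟩
  have : r ≠ 0 := (hJ hr).ne'
  simp only [hg r hr, hh r hr, Polynomial.eval_mul, zpow_add₀ this]
  ring

lemma const (J : Set ℝ) (c : ℝ) : IsLead J 0 (fun _ => c) c :=
  ⟨Polynomial.C c, by simp, fun r _ => by simp⟩

lemma zpow (J : Set ℝ) (n : ℤ) : IsLead J n (fun r => r ^ n) 1 :=
  ⟨1, by simp, fun r _ => by simp⟩

lemma pow (J : Set ℝ) (n : ℕ) : IsLead J n (fun r => r ^ n) 1 :=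
  ⟨1, by simp, fun r _ => by simp⟩

/-- At a lower order the leading coefficient is zero; this is how terms of higher order drop out of
a comparison. -/
lemma of_lt (hJ : J ⊆ Ioi 0) (hg : IsLead J e g c) (he : e' < e) : IsLead J e' g 0 := by
  obtain ⟨P, hP, hg⟩ := hg
  obtain ⟨n, hn⟩ := Int.eq_ofNat_of_zero_le (sub_nonneg.2 he.le)
  refine ⟨Polynomial.X ^ n * P, ?_, fun r hr => ?_⟩
  · have : n ≠ 0 := by omega
    simp [this]
  · have : r ≠ 0 := (hJ hr).ne'
    rw [hg r hr, Polynomial.eval_mul, Polynomial.eval_pow, Polynomial.eval_X, ← mul_assoc,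
      ← zpow_natCast, ← zpow_add₀ this, ← hn]
    congr 2
    ring

lemma of_le (hJ : J ⊆ Ioi 0) (hg : IsLead J e g c) (he : e' ≤ e) : ∃ c', IsLead J e' g c' := by
  rcases he.eq_or_lt with rfl | he
  · exact ⟨c, hg⟩
  · exact ⟨0, hg.of_lt hJ he⟩

/-- After division by r ^ e both sides are polynomials that agree at infinitely many points. -/
lemma unique (hJ : J ⊆ Ioi 0) (hJ' : J.Infinite) (hg : IsLead J e g c) (hh : IsLead J e g c') :
    c = c' := by
  obtain ⟨P, hP, hg⟩ := hg
  obtain ⟨Q, hQ, hh⟩ := hh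
  have : P = Q := by
    refine Polynomial.eq_of_infinite_eval_eq P Q (hJ'.mono fun r hr => ?_)
    have h1 : r ^ e ≠ 0 := (zpow_pos (hJ hr) e).ne'
    exact mul_left_cancel₀ h1 ((hg r hr).symm.trans (hh r hr))
  rw [← hP, ← hQ, this]

lemma sum (hJ : J ⊆ Ioi 0) (S : Finset ℤ) (b : ℤ → ℝ) (hS : ∀ n ∉ S, b n = 0)
    (he : ∀ n < e, b n = 0) : IsLead J e (fun r => ∑ n ∈ S, b n * r ^ n) (b e) := by
  refine ⟨∑ n ∈ S, Polynomial.C (b n) * Polynomial.X ^ (n - e).toNat, ?_, fun r hr => ?_⟩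
  · rw [Polynomial.eval_finsetSum, Finset.sum_eq_single e]
    · simp
    · intro n _ hne
      rcases lt_or_gt_of_ne hne with h | h
      · simp [he n h]
      · have : (n - e).toNat ≠ 0 := by omega
        simp [this]
    · intro h
      simp [hS e h]
  · rw [Polynomial.eval_finsetSum, Finset.mul_sum]
    refine Finset.sum_congr rfl fun n _ => ?_
    have hr0 : r ≠ 0 := (hJ hr).ne'
    rcases lt_or_ge n e with h | h
    · simp [he n h]
    · have : (r : ℝ) ^ n = r ^ e * r ^ (n - e).toNat := by
        rw [← zpow_natCast, ← zpow_add₀ hr0, Int.toNat_of_nonneg (by omega)]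
        congr 1
        ring
      rw [this, Polynomial.eval_mul, Polynomial.eval_C, Polynomial.eval_pow, Polynomial.eval_X]
      ring

end IsLead

/-- The lowest exponent in the support of a finite family of coefficients. -/
lemma exists_lowest {S : Finset ℤ} {b : ℤ → ℝ} (hS : ∀ n ∉ S, b n = 0) (hb : ∃ n, b n ≠ 0) :
    ∃ e ∈ S, b e ≠ 0 ∧ ∀ n < e, b n = 0 := by
  classical
  have hne : (S.filter fun n => b n ≠ 0).Nonempty := by
    obtain ⟨n, hn⟩ := hb
    exact ⟨n, Finset.mem_filter.2 ⟨by_contra fun h => hn (hS n h), hn⟩⟩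
  obtain ⟨e, he, hmin⟩ := Finset.exists_min_image _ id hne
  rw [Finset.mem_filter] at he
  refine ⟨e, he.1, he.2, fun n hn => by_contra fun h => ?_⟩
  have := hmin n (Finset.mem_filter.2 ⟨by_contra fun h' => h (hS n h'), h⟩)
  simp only [id] at this
  omega

/-- Coefficients of a mass function without black hole: no constant term, no negative powers, and
a linear term whose coefficient is one of finitely many numbers above `1 / 2`. -/
def RigidCoefficients (S : Finset ℤ) (a : ℤ → ℝ) : Prop :=
  (∀ n ≤ 0, a n = 0) ∧ ∃ j ∈ S, 1 ≤ j ∧ 2 * a 1 * j = j + 1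

/-- If the coupling has a nonvanishing limit `k / (3 r ∂m/∂y)` in lowest order, then the
coefficients are rigid. -/
lemma rigidCoefficients_of_radial_eq {J : Set ℝ} (hJ : J ⊆ Ioi 0) (hJ' : J.Infinite)
    (S : Finset ℤ) (a b : ℤ → ℝ) (hS : ∀ n ∉ S, a n = 0) (hab : ∀ n, a n = 0 → b n = 0)
    (hb : ∃ n, b n ≠ 0) (k K α β α' β' ε c₀ c₂ c₃ c₄ : ℝ) (hk : k ≠ 0) (T : ℝ → ℝ)
    (hT : ∀ r ∈ J, T r = ε * (α' * ∑ n ∈ S, a n * r ^ n + α * ∑ n ∈ S, b n * r ^ n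
        + (α' + r * β') * ∑ n ∈ S, (n * a n) * r ^ n + (α + r * β) * ∑ n ∈ S, (n * b n) * r ^ n)
      + c₀ + c₂ * r ^ 2 + c₃ * r ^ 3 + c₄ * r ^ 4)
    (heq : ∀ r ∈ J,
      16 * ((k + r ^ 3 * K) * (∑ n ∈ S, b n * r ^ n) * (∑ n ∈ S, (n * (3 - n) * a n) * r ^ n)
        + (3 * r ^ 3 * K * (∑ n ∈ S, b n * r ^ n)
            - (k + r ^ 3 * K) * ((∑ n ∈ S, b n * r ^ n) + ∑ n ∈ S, (n * b n) * r ^ n))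
          * ((∑ n ∈ S, ((3 - n) * a n) * r ^ n) - r)) =
      48 * α * r ^ 3 * (∑ n ∈ S, b n * r ^ n) ^ 2 - r ^ 3 * (∑ n ∈ S, b n * r ^ n) * T r) :
    RigidCoefficients S a := by
  have hbS : ∀ n ∉ S, b n = 0 := fun n hn => hab n (hS n hn)
  obtain ⟨d, hdS, hd, hdmin⟩ := exists_lowest hbS hb
  obtain ⟨e, heS, he, hemin⟩ := exists_lowest hS ⟨d, fun h => hd (hab d h)⟩
  have hed : e ≤ d := by
    by_contra h
    exact hd (hab d (hemin d (by omega)))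
  -- The factor 3m − r m_r − r contains the term −r, so the order 1 competes with the lowest
  -- exponent e of m.
  set e₀ := min e 1 with he₀
  have ha₀ : ∀ n < e₀, a n = 0 := fun n hn => hemin n (by omega)
  have hb₀ : ∀ n < e₀, b n = 0 := fun n hn => hab n (ha₀ n hn)
  have lsum := fun (c : ℤ → ℝ) (e : ℤ) (h1 : ∀ n ∉ S, c n = 0) (h2 : ∀ n < e, c n = 0) =>
    IsLead.sum (e := e) hJ S c h1 h2
  have lB := lsum b d hbS hdmin
  have lBn := lsum (fun n => n * b n) d (fun n hn => by simp [hbS n hn])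
    (fun n hn => by simp [hdmin n hn])
  have lW := lsum (fun n => n * (3 - n) * a n) e₀ (fun n hn => by simp [hS n hn])
    (fun n hn => by simp [ha₀ n hn])
  have lq₀ := lsum (fun n => (3 - n) * a n) e₀ (fun n hn => by simp [hS n hn])
    (fun n hn => by simp [ha₀ n hn])
  have lr : IsLead J 1 (fun r => r) 1 := (IsLead.pow J 1).congr (by simp)
  have lr₀ : IsLead J e₀ (fun r => r) (if e₀ = 1 then 1 else 0) := by
    split_ifs with h
    · rw [h]; exact lr
    · exact lr.of_lt hJ (by omega)
  have lk : IsLead J 0 (fun r => k + r ^ 3 * K) (k + 0) := (IsLead.const J k).add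
    (((IsLead.pow J 3).mul hJ (IsLead.const J K)).of_lt hJ (by norm_num))
  have l1 := (lk.mul hJ lB).mul hJ lW
  have l2 : IsLead J d (fun r => 3 * r ^ 3 * K * (∑ n ∈ S, b n * r ^ n)) 0 :=
    (((((IsLead.const J 3).mul hJ (IsLead.pow J 3)).mul hJ (IsLead.const J K)).mul hJ lB)).of_lt
      hJ (by push_cast; omega)
  have l3 := lk.mul hJ (lB.add lBn)
  rw [zero_add] at l3
  have l4 := (l2.sub l3).mul hJ (lq₀.sub lr₀)
  rw [zero_add] at l1
  have lL := (IsLead.const J 16).mul hJ (l1.add l4)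
  rw [zero_add] at lL
  -- the order of `T`
  set t := min e₀ 0 with ht
  have lT : ∃ c, IsLead J t T c := by
    have low : ∀ {g : ℝ → ℝ} {e' : ℤ} {c : ℝ}, IsLead J e' g c → t ≤ e' → ∃ c, IsLead J t g c :=
      fun h1 h2 => h1.of_le hJ h2
    have lcm : ∀ {g : ℝ → ℝ} (x : ℝ), (∃ c, IsLead J t g c) →
        ∃ c, IsLead J t (fun r => x * g r) c := fun {g} x ⟨c, h⟩ => ⟨_, by
      simpa using (IsLead.const J x).mul hJ h⟩
    have lrm : ∀ {g : ℝ → ℝ} (x y : ℝ), (∃ c, IsLead J t g c) →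
        ∃ c, IsLead J t (fun r => (x + r * y) * g r) c := fun {g} x y ⟨c, h⟩ => by
      have := ((IsLead.const J x).add
        ((lr.mul hJ (IsLead.const J y)).of_lt hJ (by norm_num))).mul hJ h
      exact ⟨_, by simpa using this⟩
    have ladd : ∀ {g h : ℝ → ℝ}, (∃ c, IsLead J t g c) → (∃ c, IsLead J t h c) →
        ∃ c, IsLead J t (fun r => g r + h r) c := fun ⟨_, h1⟩ ⟨_, h2⟩ => ⟨_, h1.add h2⟩
    have lcr : ∀ (x : ℝ) (n : ℕ), ∃ c, IsLead J t (fun r => x * r ^ n) c := fun x n =>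
      lcm x (low (IsLead.pow J n) (by omega))
    have s1 := low (lsum a t hS (fun n hn => ha₀ n (by omega))) le_rfl
    have s2 := low (lsum b t hbS (fun n hn => hb₀ n (by omega))) le_rfl
    have s3 := low (lsum (fun n => n * a n) t (fun n hn => by simp [hS n hn])
      (fun n hn => by simp [ha₀ n (show n < e₀ by omega)])) le_rfl
    have s4 := low (lsum (fun n => n * b n) t (fun n hn => by simp [hbS n hn])
      (fun n hn => by simp [hb₀ n (show n < e₀ by omega)])) le_rfl
    obtain ⟨c, h⟩ := ladd (ladd (ladd (ladd (lcm ε (ladd (ladd (ladd (lcm α' s1) (lcm α s2))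
      (lrm α' β' s3)) (lrm α β s4))) (low (IsLead.const J c₀) (by omega))) (lcr c₂ 2)) (lcr c₃ 3))
      (lcr c₄ 4)
    exact ⟨c, h.congr hT⟩
  obtain ⟨cT, lT⟩ := lT
  -- Both terms on the right have order greater than d + e₀: the factor r³ outweighs the possible
  -- loss, since e₀ ≤ d and e₀ < 3 + t.
  have r1 := (((IsLead.const J (48 * α)).mul hJ (IsLead.pow J 3)).mul hJ (lB.mul hJ lB)).of_lt hJ
    (show d + e₀ < _ by push_cast; omega)
  have r2 := (((IsLead.pow J 3).mul hJ lB).mul hJ lT).of_lt hJ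
    (show d + e₀ < _ by push_cast; omega)
  have lR := r1.sub r2
  have key := lL.unique hJ hJ' (lR.congr fun r hr => (heq r hr).trans (by rw [pow_two]))
  simp only [sub_zero, add_zero, zero_sub] at key
  -- This is the coefficient of r^(d + e₀) on the left, divided by 16 k b_d. Neither K nor the
  -- source contributes.
  have key' : e₀ * (3 - e₀) * a e₀ - (1 + d) * ((3 - e₀) * a e₀ - if e₀ = 1 then 1 else 0) = 0 := by
    have h16 : 16 * k * b d ≠ 0 := by simp [hk, hd]
    refine (mul_eq_zero.1 ?_).resolve_left h16
    linear_combination key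
  rcases le_or_gt e 0 with h | h
  · exfalso
    have : e₀ = e := by omega
    rw [this, if_neg (by omega)] at key'
    -- Without the term −r the coefficient factorizes, and e ≤ d and e ≤ 0 keep both numerical
    -- factors away from zero.
    have h1 : (e - 1 - d : ℝ) * ((3 - e) * a e) = 0 := by linear_combination key'
    have h2 : (e - 1 - d : ℝ) ≠ 0 := by
      have : (e - 1 - d : ℤ) ≠ 0 := by omega
      exact_mod_cast this
    have h3 : (3 - e : ℝ) ≠ 0 := by
      have : (3 - e : ℤ) ≠ 0 := by omega
      exact_mod_cast this
    simp_all
  · have : e₀ = 1 := by omega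
    rw [this, if_pos rfl] at key'
    refine ⟨fun n hn => hemin n (by omega), d, hdS, by omega, ?_⟩
    push_cast at key'
    linear_combination -key'

/-- A bound on the order of a Laurent polynomial that satisfies a Riccati-like equation. -/
lemma order_bound_of_riccati {J : Set ℝ} (hJ : J ⊆ Ioi 0) (hJ' : J.Infinite)
    (S : Finset ℤ) (a b : ℤ → ℝ) (hS : ∀ n ∉ S, a n = 0) (hab : ∀ n, a n = 0 → b n = 0)
    (α β : ℝ) (hα : α ≠ 0) (p : ℤ)
    (heq : ∀ r ∈ J, ∑ n ∈ S, b n * r ^ n = r ^ p * (α + β * r) * (∑ n ∈ S, a n * r ^ n) ^ 2) :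
    ∀ n, a n ≠ 0 → -p ≤ n := by
  intro n hn
  obtain ⟨e, heS, he, hemin⟩ := exists_lowest hS ⟨n, hn⟩
  have hen : e ≤ n := by
    by_contra h
    exact hn (hemin n (by omega))
  by_contra hlt
  have lr : IsLead J 1 (fun r => r) 1 := (IsLead.pow J 1).congr (by simp)
  have lA := IsLead.sum hJ S a hS hemin
  have lB := IsLead.sum hJ S b (fun n hn => hab n (hS n hn)) (fun n hn => hab n (hemin n hn))
  have l1 : IsLead J 0 (fun r => α + β * r) (α + 0) := (IsLead.const J α).add
    (((IsLead.const J β).mul hJ lr).of_lt hJ (by norm_num))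
  have l2 := (((IsLead.zpow J p).mul hJ l1).mul hJ (lA.mul hJ lA))
  -- If p + e < 0, the right side has the exact order p + 2e < e, while the left side has order at
  -- least e.
  have l3 := lB.of_lt hJ (show p + 0 + (e + e) < e by omega)
  have := l3.unique hJ hJ' (l2.congr fun r hr => (heq r hr).trans (by rw [pow_two]))
  simp [hα, he] at this

/-- A Laurent polynomial that satisfies a Riccati-like equation is a monomial. -/
lemma support_of_riccati {J : Set ℝ} (hJ : J ⊆ Ioi 0) (hJ' : J.Infinite)
    (S : Finset ℤ) (a b : ℤ → ℝ) (hS : ∀ n ∉ S, a n = 0) (hab : ∀ n, a n = 0 → b n = 0)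
    (α β : ℝ) (hαβ : α ≠ 0 ∨ β ≠ 0)
    (heq : ∀ r ∈ J, r ^ 2 * ∑ n ∈ S, b n * r ^ n = (α + β * r) * (∑ n ∈ S, a n * r ^ n) ^ 2) :
    (∀ n, a n ≠ 0 → n = 2) ∨ ∀ n, a n ≠ 0 → n = 1 := by
  have hJi : J⁻¹ ⊆ Ioi 0 := fun r hr => by simpa using hJ hr
  have hJi' : J⁻¹.Infinite := by rwa [Set.infinite_inv]
  have hsum : ∀ (c : ℤ → ℝ) (t : ℝ),
      ∑ n ∈ S.map (Equiv.neg ℤ).toEmbedding, c (-n) * t ^ n = ∑ n ∈ S, c n * t⁻¹ ^ n := by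
    intro c t
    rw [Finset.sum_map]
    refine Finset.sum_congr rfl fun n _ => ?_
    simp [zpow_neg]
  have hSi : ∀ n ∉ S.map (Equiv.neg ℤ).toEmbedding, a (-n) = 0 := by
    intro n hn
    refine hS _ fun h => hn ?_
    exact Finset.mem_map.2 ⟨-n, h, by simp⟩
  -- The lower bound uses r itself, the upper bound the variable t = 1/r, which exchanges lowest and
  -- highest exponents. In both, x is the leading coefficient of the linear factor after its power
  -- of the variable has been split off.
  have low : ∀ (x y : ℝ) (p : ℤ), x ≠ 0 →
      (∀ r ∈ J, r ^ 2 * (r ^ p * (x + y * r)) = α + β * r) → ∀ n, a n ≠ 0 → -p ≤ n := by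
    intro x y p hx h
    refine order_bound_of_riccati hJ hJ' S a b hS hab x y hx p fun r hr => ?_
    have hr0 : r ^ 2 ≠ 0 := pow_ne_zero _ (hJ hr).ne'
    refine mul_left_cancel₀ hr0 ?_
    rw [heq r hr, ← h r hr]
    ring
  have high : ∀ (x y : ℝ) (p : ℤ), x ≠ 0 →
      (∀ t ∈ J⁻¹, t ^ p * (x + y * t) = t ^ 2 * (α + β * t⁻¹)) → ∀ n, a n ≠ 0 → n ≤ p := by
    intro x y p hx h n hn
    have := order_bound_of_riccati hJi hJi' _ (fun n => a (-n)) (fun n => b (-n)) hSi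
      (fun n => hab (-n)) x y hx p (fun t ht => ?_) (-n) (by simpa using hn)
    · omega
    · have ht0 : t ≠ 0 := (hJi ht).ne'
      rw [hsum, hsum, h t ht, mul_assoc, ← heq t⁻¹ ht]
      field_simp
  by_cases hα : α = 0
  · have hβ : β ≠ 0 := hαβ.resolve_left (not_not.2 hα)
    right
    intro n hn
    have h1 := low β 0 (-1) hβ (fun r hr => by
      have : r ≠ 0 := (hJ hr).ne'
      rw [zpow_neg_one, hα]; field_simp; ring) n hn
    have h2 := high β α 1 hβ (fun t ht => by
      have ht0 : t ≠ 0 := (hJi ht).ne'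
      rw [zpow_one]; field_simp; ring) n hn
    omega
  · have h1 := low α β (-2) hα (fun r hr => by
      have : r ≠ 0 := (hJ hr).ne'
      rw [show (-2 : ℤ) = -((2 : ℕ) : ℤ) by norm_num, zpow_neg, zpow_natCast]; field_simp)
    left
    intro n hn
    have h3 := h1 n hn
    by_cases hβ : β = 0
    · have h2 := high α 0 2 hα (fun t ht => by
        rw [hβ, show (2 : ℤ) = ((2 : ℕ) : ℤ) by norm_num, zpow_natCast]; ring) n hn
      omega
    -- If α and β are both nonzero, the bounds n ≥ 2 and n ≤ 1 contradict each other, so all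
    -- coefficients are zero.
    · have h2 := high β α 1 hβ (fun t ht => by
        have ht0 : t ≠ 0 := (hJi ht).ne'
        rw [zpow_one]; field_simp; ring) n hn
      omega

/-- Where a finite family of differentiable functions is considered on a nonempty open set, there
is a point at which the derivative of every member with value zero vanishes, too. -/
lemma exists_generic_point (S : Finset ℤ) (b b' : ℤ → ℝ → ℝ) {O : Set ℝ} (hO : IsOpen O)
    (hne : O.Nonempty) (hb : ∀ n ∈ S, ∀ t ∈ O, HasDerivAt (b n) (b' n t) t) :
    ∃ t ∈ O, ∀ n ∈ S, b n t = 0 → b' n t = 0 := by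
  classical
  induction S using Finset.induction_on generalizing O with
  | empty => exact ⟨hne.some, hne.some_mem, by simp⟩
  | insert n S _ ih =>
    -- Either the set can be shrunk to an open part without zeros of b n, or b n vanishes
    -- identically there and so does its derivative.
    by_cases h : ∃ t ∈ O, b n t ≠ 0
    · obtain ⟨t, htO, ht⟩ := h
      have hc : ContinuousOn (b n) O := fun x hx =>
        (hb n (Finset.mem_insert_self n S) x hx).continuousAt.continuousWithinAt
      obtain ⟨x, hx, hgood⟩ := ih (hc.isOpen_inter_preimage hO isOpen_compl_singleton)
        ⟨t, htO, ht⟩ (fun i hi x hx => hb i (Finset.mem_insert_of_mem hi) x hx.1)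
      refine ⟨x, hx.1, fun i hi h0 => ?_⟩
      rcases Finset.mem_insert.1 hi with rfl | hi
      · exact absurd h0 hx.2
      · exact hgood i hi h0
    · push Not at h
      obtain ⟨x, hx, hgood⟩ := ih hO hne fun i hi x hx => hb i (Finset.mem_insert_of_mem hi) x hx
      refine ⟨x, hx, fun i hi h0 => ?_⟩
      rcases Finset.mem_insert.1 hi with rfl | hi
      · have h1 := hb i (Finset.mem_insert_self i S) x hx
        have h2 : b i =ᶠ[𝓝 x] fun _ => 0 := by
          filter_upwards [hO.mem_nhds hx] with t ht using h t ht
        exact (h1.congr_of_eventuallyEq h2.symm).unique (hasDerivAt_const x 0)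
      · exact hgood i hi h0

end

end WarpedVaidya

namespace WarpedVaidya

noncomputable section

/-! ### Solutions of the component equations on a box -/

/-- Values are real numbers, so nilpotents vanish; this permits conclusions such as χ_v = 0 from
χ_v² = 0. -/
instance (U : TopologicalSpace.Opens (ℝ × ℝ × ℝ)) : IsReduced (SmoothAlg U) where
  eq_zero x h := by
    obtain ⟨n, hn⟩ := h
    refine SmoothAlg.ext_apply fun p => ?_
    have h1 : (x.1 p) ^ n = 0 := congrFun (congrArg Subtype.val hn) p
    exact eq_zero_of_pow_eq_zero h1

/-- Evaluation of a smooth function at a point. -/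
def SmoothAlg.eval {U : TopologicalSpace.Opens (ℝ × ℝ × ℝ)} (p : U) : SmoothAlg U →ₐ[ℝ] ℝ :=
  (Pi.evalAlgHom ℝ (fun _ : U => ℝ) p).comp (SmoothAlg U).val

variable {Jv Jr Jy : TopologicalSpace.Opens ℝ}

lemma SmoothOn.eval_toAlg {h : ℝ → ℝ → ℝ → ℝ} (hs : SmoothOn Jv Jr Jy h) {v r y : ℝ}
    (hv : v ∈ Jv) (hr : r ∈ Jr) (hy : y ∈ Jy) :
    SmoothAlg.eval (boxPoint hv hr hy) hs.toAlg = h v r y := rfl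

lemma SmoothAlg.ext_eval {a b : SmoothAlg (box Jv Jr Jy)}
    (h : ∀ v r y, ∀ (hv : v ∈ Jv) (hr : r ∈ Jr) (hy : y ∈ Jy),
      SmoothAlg.eval (boxPoint hv hr hy) a = SmoothAlg.eval (boxPoint hv hr hy) b) : a = b :=
  SmoothAlg.ext_apply fun p => h p.1.1 p.1.2.1 p.1.2.2 p.2.1 p.2.2.1 p.2.2.2

/-- A function whose radial derivative vanishes does not depend on `r`. -/
lemma SmoothAlg.eval_eq_of_Dr_eq_zero (hJr : (Jr : Set ℝ).OrdConnected)
    {x : SmoothAlg (box Jv Jr Jy)} (hx : Dr x = 0) {v r r' y : ℝ}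
    (hv : v ∈ Jv) (hr : r ∈ Jr) (hr' : r' ∈ Jr) (hy : y ∈ Jy) :
    eval (boxPoint hv hr hy) x = eval (boxPoint hv hr' hy) x := by
  have hs : SmoothOn Jv Jr Jy (fun v r y => rep x (v, r, y)) := contDiffOn_rep x
  have hx' : hs.toAlg = x := ext_apply fun p => rep_apply x p
  have h0 : ∀ t ∈ Jr, HasDerivAt (fun t => rep x (v, t, y)) 0 t := by
    intro t ht
    have h1 := hs.hasDerivAt_r hv ht hy
    have h2 : eval (boxPoint hv ht hy) (Dr hs.toAlg) = 0 := by rw [hx', hx, map_zero]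
    rw [hs.Dr_toAlg, hs.dr.eval_toAlg] at h2
    rwa [h2] at h1
  have key := Jr.isOpen.is_const_of_deriv_eq_zero hJr.isPreconnected
    (fun t ht => (h0 t ht).differentiableAt.differentiableWithinAt)
    (fun t ht => (h0 t ht).deriv) hr hr'
  rw [← hx', hs.eval_toAlg, hs.eval_toAlg]
  exact key

/-- A solution of the component equations on a box, in which `F` is a function of the fields. -/
structure Solution (Jv Jr Jy : TopologicalSpace.Opens ℝ) (A : ℝ → ℝ) (m φ χ F : ℝ → ℝ → ℝ → ℝ) :
    Prop where
  pos : (Jr : Set ℝ) ⊆ Ioi 0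
  warp : ContDiffOn ℝ ∞ A Jy
  warp_ne : ∀ y ∈ Jy, deriv A y ≠ 0
  mass : SmoothOn Jv Jr Jy m
  fst : SmoothOn Jv Jr Jy φ
  snd : SmoothOn Jv Jr Jy χ
  coupling : SmoothOn Jv Jr Jy F
  F_ne : ∀ v ∈ Jv, ∀ r ∈ Jr, ∀ y ∈ Jy, F v r y ≠ 0
  F_v : ∀ v ∈ Jv, ∀ r ∈ Jr, ∀ y ∈ Jy, dv φ v r y = 0 → dv χ v r y = 0 → dv F v r y = 0
  F_r : ∀ v ∈ Jv, ∀ r ∈ Jr, ∀ y ∈ Jy, dr φ v r y = 0 → dr χ v r y = 0 → dr F v r y = 0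
  eqs : ∀ v ∈ Jv, ∀ r ∈ Jr, ∀ y ∈ Jy, ComponentEquations A m φ χ F v r y

lemma SmoothOn.of_y {g : ℝ → ℝ} (hg : ContDiffOn ℝ ∞ g Jy) :
    SmoothOn Jv Jr Jy (fun _ _ y => g y) :=
  hg.comp (t := (Jy : Set ℝ)) (contDiff_snd.comp contDiff_snd).contDiffOn fun _ hp => hp.2.2

lemma SmoothOn.of_r {g : ℝ → ℝ} (hg : ContDiffOn ℝ ∞ g Jr) :
    SmoothOn Jv Jr Jy (fun _ r _ => g r) :=
  hg.comp (t := (Jr : Set ℝ)) (contDiff_fst.comp contDiff_snd).contDiffOn fun _ hp => hp.2.1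

namespace Solution

variable {A : ℝ → ℝ} {m φ χ F : ℝ → ℝ → ℝ → ℝ}

lemma mono (H : Solution Jv Jr Jy A m φ χ F) {Jv' Jr' Jy' : TopologicalSpace.Opens ℝ}
    (hv : Jv' ≤ Jv) (hr : Jr' ≤ Jr) (hy : Jy' ≤ Jy) : Solution Jv' Jr' Jy' A m φ χ F := by
  have hsub : (Jv' : Set ℝ) ×ˢ (Jr' : Set ℝ) ×ˢ (Jy' : Set ℝ) ⊆
      (Jv : Set ℝ) ×ˢ (Jr : Set ℝ) ×ˢ (Jy : Set ℝ) := prod_mono hv (prod_mono hr hy)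
  exact ⟨subset_trans hr H.pos, ContDiffOn.mono H.warp hy, fun y h => H.warp_ne y (hy h),
    ContDiffOn.mono H.mass hsub, ContDiffOn.mono H.fst hsub, ContDiffOn.mono H.snd hsub,
    ContDiffOn.mono H.coupling hsub, fun v h1 r h2 y h3 => H.F_ne v (hv h1) r (hr h2) y (hy h3),
    fun v h1 r h2 y h3 => H.F_v v (hv h1) r (hr h2) y (hy h3),
    fun v h1 r h2 y h3 => H.F_r v (hv h1) r (hr h2) y (hy h3),
    fun v h1 r h2 y h3 => H.eqs v (hv h1) r (hr h2) y (hy h3)⟩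

lemma symm (H : Solution Jv Jr Jy A m φ χ F) : Solution Jv Jr Jy A m χ φ F where
  pos := H.pos
  warp := H.warp
  warp_ne := H.warp_ne
  mass := H.mass
  fst := H.snd
  snd := H.fst
  coupling := H.coupling
  F_ne := H.F_ne
  F_v := fun v h1 r h2 y h3 h4 h5 => H.F_v v h1 r h2 y h3 h5 h4
  F_r := fun v h1 r h2 y h3 h4 h5 => H.F_r v h1 r h2 y h3 h5 h4
  eqs := fun v h1 r h2 y h3 => by
    have h := H.eqs v h1 r h2 y h3
    exact ⟨by linear_combination h.rr, by linear_combination h.ry, by linear_combination h.vy,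
      by linear_combination h.rθ, by linear_combination h.θy, by linear_combination h.vv⟩

lemma warp₁ (H : Solution Jv Jr Jy A m φ χ F) : ContDiffOn ℝ ∞ (deriv A) Jy := H.warp.deriv_of_isOpen Jy.isOpen (by simp)

lemma warp₂ (H : Solution Jv Jr Jy A m φ χ F) : ContDiffOn ℝ ∞ (deriv (deriv A)) Jy := H.warp₁.deriv_of_isOpen Jy.isOpen (by simp)

lemma warpE (H : Solution Jv Jr Jy A m φ χ F) : ContDiffOn ℝ ∞ (fun y => Real.exp (2 * A y)) Jy :=
  (contDiffOn_const.mul H.warp).exp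

lemma inv_r (H : Solution Jv Jr Jy A m φ χ F) : ContDiffOn ℝ ∞ (fun r : ℝ => r⁻¹) Jr :=
  contDiffOn_id.inv fun _ hr => (H.pos hr).ne'

open SmoothAlg

/-- The reduced system of a solution. -/
def system (H : Solution Jv Jr Jy A m φ χ F) : ReducedSystem (SmoothAlg (box Jv Jr Jy)) where
  Dv := Dv
  Dr := Dr
  Dy := Dy
  vr x := D_comm _ _ x
  vy x := D_comm _ _ x
  yr x := D_comm _ _ x
  r := (SmoothOn.of_r (g := fun r => r) contDiffOn_id : SmoothOn Jv Jr Jy _).toAlg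
  s := (SmoothOn.of_r H.inv_r : SmoothOn Jv Jr Jy _).toAlg
  E := (SmoothOn.of_y H.warpE : SmoothOn Jv Jr Jy _).toAlg
  A₁ := (SmoothOn.of_y H.warp₁ : SmoothOn Jv Jr Jy _).toAlg
  A₂ := (SmoothOn.of_y H.warp₂ : SmoothOn Jv Jr Jy _).toAlg
  m := H.mass.toAlg
  φ := H.fst.toAlg
  χ := H.snd.toAlg
  F := H.coupling.toAlg
  rs := ext_eval fun v r y hv hr hy => by
    simp only [map_mul, SmoothOn.eval_toAlg, map_one]
    exact mul_inv_cancel₀ (H.pos hr).ne'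
  v_r := ext_eval fun v r y hv hr hy => by
    rw [SmoothOn.Dv_toAlg, SmoothOn.eval_toAlg, map_zero]; simp [WarpedVaidya.dv]
  r_r := ext_eval fun v r y hv hr hy => by
    rw [SmoothOn.Dr_toAlg, SmoothOn.eval_toAlg, map_one]; simp [WarpedVaidya.dr]
  y_r := ext_eval fun v r y hv hr hy => by
    rw [SmoothOn.Dy_toAlg, SmoothOn.eval_toAlg, map_zero]; simp [WarpedVaidya.dy]
  v_E := ext_eval fun v r y hv hr hy => by
    rw [SmoothOn.Dv_toAlg, SmoothOn.eval_toAlg, map_zero]; simp [WarpedVaidya.dv]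
  r_E := ext_eval fun v r y hv hr hy => by
    rw [SmoothOn.Dr_toAlg, SmoothOn.eval_toAlg, map_zero]; simp [WarpedVaidya.dr]
  v_A₁ := ext_eval fun v r y hv hr hy => by
    rw [SmoothOn.Dv_toAlg, SmoothOn.eval_toAlg, map_zero]; simp [WarpedVaidya.dv]
  r_A₁ := ext_eval fun v r y hv hr hy => by
    rw [SmoothOn.Dr_toAlg, SmoothOn.eval_toAlg, map_zero]; simp [WarpedVaidya.dr]
  v_A₂ := ext_eval fun v r y hv hr hy => by
    rw [SmoothOn.Dv_toAlg, SmoothOn.eval_toAlg, map_zero]; simp [WarpedVaidya.dv]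
  r_A₂ := ext_eval fun v r y hv hr hy => by
    rw [SmoothOn.Dr_toAlg, SmoothOn.eval_toAlg, map_zero]; simp [WarpedVaidya.dr]
  eq_rr := ext_eval fun v r y hv hr hy => by
    simpa only [SmoothOn.Dv_toAlg, SmoothOn.Dr_toAlg, SmoothOn.Dy_toAlg, map_add, map_sub, map_mul,
      map_zero, SmoothOn.eval_toAlg] using (H.eqs v hv r hr y hy).rr
  eq_ry := ext_eval fun v r y hv hr hy => by
    simpa only [SmoothOn.Dv_toAlg, SmoothOn.Dr_toAlg, SmoothOn.Dy_toAlg, map_add, map_sub, map_mul,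
      map_zero, SmoothOn.eval_toAlg] using (H.eqs v hv r hr y hy).ry
  eq_vy := ext_eval fun v r y hv hr hy => by
    rw [show Dy (Dv H.coupling.toAlg) = Dv (Dy H.coupling.toAlg) from D_comm _ _ _]
    simpa only [SmoothOn.Dv_toAlg, SmoothOn.Dr_toAlg, SmoothOn.Dy_toAlg, map_add, map_sub, map_mul,
      map_pow, SmoothOn.eval_toAlg] using (H.eqs v hv r hr y hy).vy
  eq_rθ := ext_eval fun v r y hv hr hy => by
    rw [show Dr (Dv H.coupling.toAlg) = Dv (Dr H.coupling.toAlg) from D_comm _ _ _]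
    simpa only [SmoothOn.Dv_toAlg, SmoothOn.Dr_toAlg, SmoothOn.Dy_toAlg, map_add, map_sub, map_mul,
      map_pow, map_ofNat, SmoothOn.eval_toAlg] using (H.eqs v hv r hr y hy).rθ
  eq_θy := ext_eval fun v r y hv hr hy => by
    simpa only [SmoothOn.Dv_toAlg, SmoothOn.Dr_toAlg, SmoothOn.Dy_toAlg, map_add, map_sub, map_mul,
      map_pow, map_ofNat, SmoothOn.eval_toAlg] using (H.eqs v hv r hr y hy).θy
  eq_vv := ext_eval fun v r y hv hr hy => by
    rw [show Dr (Dv H.coupling.toAlg) = Dv (Dr H.coupling.toAlg) from D_comm _ _ _]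
    simpa only [SmoothOn.Dv_toAlg, SmoothOn.Dr_toAlg, SmoothOn.Dy_toAlg, map_add, map_sub, map_mul,
      map_pow, map_ofNat, SmoothOn.eval_toAlg] using (H.eqs v hv r hr y hy).vv

end Solution

end

end WarpedVaidya

/-! ### From ring identities to functions on the box; mass functions that are Laurent polynomials -/

namespace WarpedVaidya

noncomputable section

lemma ReducedSystem.radial_sq_eq_zero {R : Type*} [CommRing R] [Algebra ℝ R] (W : ReducedSystem R)
    (hφ : W.Dr W.φ = 0 ∨ W.Dy W.φ = 0) (hχ : W.Dr W.χ = 0 ∨ W.Dy W.χ = 0) :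
    W.A₁ * (W.Dr W.φ * W.Dr W.φ + W.Dr W.χ * W.Dr W.χ) = 0 := by
  rw [← W.radial_identity]
  rcases hφ with h | h <;> rcases hχ with h' | h' <;> simp [h, h']

variable {Jv Jr Jy : TopologicalSpace.Opens ℝ} {A : ℝ → ℝ} {m φ χ F : ℝ → ℝ → ℝ → ℝ}

/-- A function vanishes on the box. -/
def VanishesOn (Jv Jr Jy : Set ℝ) (g : ℝ → ℝ → ℝ → ℝ) : Prop :=
  ∀ v ∈ Jv, ∀ r ∈ Jr, ∀ y ∈ Jy, g v r y = 0

lemma SmoothOn.toAlg_eq_zero {h : ℝ → ℝ → ℝ → ℝ} (hs : SmoothOn Jv Jr Jy h) :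
    hs.toAlg = 0 ↔ VanishesOn Jv Jr Jy h := by
  constructor
  · intro h0 v hv r hr y hy
    rw [← hs.eval_toAlg hv hr hy, h0, map_zero]
  · intro h0
    exact SmoothAlg.ext_eval fun v r y hv hr hy => by rw [hs.eval_toAlg, h0 v hv r hr y hy, map_zero]

namespace SmoothAlg

/-- A smooth function on the box as a function of three variables. -/
def fn (x : SmoothAlg (box Jv Jr Jy)) (v r y : ℝ) : ℝ := rep x (v, r, y)

lemma smoothOn_fn (x : SmoothAlg (box Jv Jr Jy)) : SmoothOn Jv Jr Jy (fn x) := contDiffOn_rep x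

lemma eval_eq_fn (x : SmoothAlg (box Jv Jr Jy)) {v r y : ℝ} (hv : v ∈ Jv) (hr : r ∈ Jr)
    (hy : y ∈ Jy) : eval (boxPoint hv hr hy) x = fn x v r y :=
  (rep_apply x (boxPoint hv hr hy)).symm

lemma toAlg_fn (x : SmoothAlg (box Jv Jr Jy)) : (smoothOn_fn x).toAlg = x :=
  ext_eval fun _ _ _ hv hr hy => by rw [SmoothOn.eval_toAlg, eval_eq_fn]

end SmoothAlg

open SmoothAlg

namespace Solution

/-- By the radial identity A' (φ_r² + χ_r²) = 0, and a sum of real squares vanishes only termwise.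
-/
lemma vanishesOn_radial (H : Solution Jv Jr Jy A m φ χ F)
    (hφ : VanishesOn Jv Jr Jy (dr φ) ∨ VanishesOn Jv Jr Jy (dy φ))
    (hχ : VanishesOn Jv Jr Jy (dr χ) ∨ VanishesOn Jv Jr Jy (dy χ)) :
    VanishesOn Jv Jr Jy (dr φ) ∧ VanishesOn Jv Jr Jy (dr χ) := by
  rw [← H.fst.dr.toAlg_eq_zero, ← H.fst.dy.toAlg_eq_zero, ← H.fst.Dr_toAlg, ← H.fst.Dy_toAlg] at hφ
  rw [← H.snd.dr.toAlg_eq_zero, ← H.snd.dy.toAlg_eq_zero, ← H.snd.Dr_toAlg, ← H.snd.Dy_toAlg] at hχ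
  have h := H.system.radial_sq_eq_zero hφ hχ
  have key : ∀ v ∈ Jv, ∀ r ∈ Jr, ∀ y ∈ Jy, dr φ v r y = 0 ∧ dr χ v r y = 0 := by
    intro v hv r hr y hy
    have h1 := congrArg (eval (boxPoint hv hr hy)) h
    change eval _ (_ * (Dr H.fst.toAlg * Dr H.fst.toAlg + Dr H.snd.toAlg * Dr H.snd.toAlg)) = _ at h1
    rw [H.fst.Dr_toAlg, H.snd.Dr_toAlg] at h1
    simp only [map_mul, map_add, map_zero, H.fst.dr.eval_toAlg, H.snd.dr.eval_toAlg] at h1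
    have h2 := (mul_eq_zero.1 h1).resolve_left (H.warp_ne y hy)
    constructor <;> nlinarith [mul_self_nonneg (dr φ v r y), mul_self_nonneg (dr χ v r y)]
  exact ⟨fun v hv r hr y hy => (key v hv r hr y hy).1, fun v hv r hr y hy => (key v hv r hr y hy).2⟩

lemma of_no_radial (H : Solution Jv Jr Jy A m φ χ F) (hφ : VanishesOn Jv Jr Jy (dr φ))
    (hχ : VanishesOn Jv Jr Jy (dr χ)) :
    VanishesOn Jv Jr Jy (dv F) ∧ VanishesOn Jv Jr Jy (dy m) ∧
      ∃ Q : SmoothAlg (box Jv Jr Jy), 2 * Dr H.mass.toAlg = H.system.r ^ 2 * Q ∧ Dr Q = 0 ∧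
        Dy Q = 0 := by
  have hFr : VanishesOn Jv Jr Jy (dr F) := fun v hv r hr y hy =>
    H.F_r v hv r hr y hy (hφ v hv r hr y hy) (hχ v hv r hr y hy)
  rw [← H.fst.dr.toAlg_eq_zero, ← H.fst.Dr_toAlg] at hφ
  rw [← H.snd.dr.toAlg_eq_zero, ← H.snd.Dr_toAlg] at hχ
  rw [← H.coupling.dr.toAlg_eq_zero, ← H.coupling.Dr_toAlg] at hFr
  have hi : SmoothOn Jv Jr Jy (fun v r y => (F v r y)⁻¹) :=
    ContDiffOn.inv H.coupling fun p hp => H.F_ne _ hp.1 _ hp.2.1 _ hp.2.2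
  have hF : H.coupling.toAlg * hi.toAlg = 1 := ext_eval fun v r y hv hr hy => by
    rw [map_mul, H.coupling.eval_toAlg, hi.eval_toAlg, map_one]
    exact mul_inv_cancel₀ (H.F_ne v hv r hr y hy)
  obtain ⟨h1, h2, h3⟩ := H.system.of_no_radial hi.toAlg hF hφ hχ hFr
  refine ⟨?_, ?_, h3⟩
  · rwa [← H.coupling.dv.toAlg_eq_zero, ← H.coupling.Dv_toAlg]
  · rwa [← H.mass.dy.toAlg_eq_zero, ← H.mass.Dy_toAlg]

/-- If neither field is independent of v, each lacks r or y, and the radial identity applies.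
Otherwise the field independent of v can be taken first, possibly after exchanging the fields. -/
lemma massEquation_cases (H : Solution Jv Jr Jy A m φ χ F)
    (hφ : VanishesOn Jv Jr Jy (dv φ) ∨ VanishesOn Jv Jr Jy (dr φ) ∨ VanishesOn Jv Jr Jy (dy φ))
    (hχ : VanishesOn Jv Jr Jy (dv χ) ∨ VanishesOn Jv Jr Jy (dr χ) ∨ VanishesOn Jv Jr Jy (dy χ)) :
    (VanishesOn Jv Jr Jy (dr φ) ∧ VanishesOn Jv Jr Jy (dr χ)) ∨ H.system.MassEquation ∨
      H.symm.system.MassEquation := by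
  have aux : ∀ {φ χ : ℝ → ℝ → ℝ → ℝ} (H : Solution Jv Jr Jy A m φ χ F),
      VanishesOn Jv Jr Jy (dv φ) → VanishesOn Jv Jr Jy (dv χ) ∨ VanishesOn Jv Jr Jy (dr χ) ∨
        VanishesOn Jv Jr Jy (dy χ) → H.system.MassEquation := by
    intro φ χ H hφ hχ
    rw [← H.fst.dv.toAlg_eq_zero, ← H.fst.Dv_toAlg] at hφ
    rw [← H.snd.dv.toAlg_eq_zero, ← H.snd.dr.toAlg_eq_zero, ← H.snd.dy.toAlg_eq_zero,
      ← H.snd.Dv_toAlg, ← H.snd.Dr_toAlg, ← H.snd.Dy_toAlg] at hχ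
    rcases hχ with h | h | h
    · exact H.system.massEquation_of_static hφ h
    · exact H.system.massEquation_of_radial_eq_zero hφ h
    · have hi : SmoothOn Jv Jr Jy (fun _ _ y => (deriv A y)⁻¹) :=
        SmoothOn.of_y (H.warp₁.inv H.warp_ne)
      refine H.system.massEquation_of_transverse_eq_zero hi.toAlg ?_ hφ h
      exact ext_eval fun v r y hv hr hy => mul_inv_cancel₀ (H.warp_ne y hy)
  rcases hφ with h | h
  · exact Or.inr (Or.inl (aux H h hχ))
  · rcases hχ with h' | h'
    · exact Or.inr (Or.inr (aux H.symm h' (Or.inr h)))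
    · exact Or.inl (H.vanishesOn_radial h h')

end Solution

/-- The mass function is a finite power series in `r` with smooth coefficients. -/
structure PowerSeriesMass (Jv Jr Jy : Set ℝ) (m : ℝ → ℝ → ℝ → ℝ) (S : Finset ℤ)
    (a : ℤ → ℝ → ℝ → ℝ) : Prop where
  smooth : ∀ n, SmoothOn Jv Jr Jy (fun v _ y => a n v y)
  support : ∀ n ∉ S, ∀ v y, a n v y = 0
  eq : IsFinitePowerSeries Jv Jr Jy m S a

lemma hasDerivAt_laurent (S : Finset ℤ) (c : ℤ → ℝ) {r : ℝ} (hr : r ≠ 0) :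
    HasDerivAt (fun t : ℝ => ∑ n ∈ S, c n * t ^ n) (∑ n ∈ S, c n * (n * r ^ (n - 1))) r :=
  HasDerivAt.fun_sum fun n _ => (hasDerivAt_zpow n r (Or.inl hr)).const_mul (c n)

lemma deriv_laurent (hJr : (Jr : Set ℝ) ⊆ Ioi 0) (S : Finset ℤ) (c : ℤ → ℝ) {g : ℝ → ℝ}
    (hg : ∀ r ∈ Jr, g r = ∑ n ∈ S, c n * r ^ n) {r : ℝ} (hr : r ∈ Jr) :
    deriv g r = ∑ n ∈ S, c n * (n * r ^ (n - 1)) := by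
  refine ((hasDerivAt_laurent S c (hJr hr).ne').congr_of_eventuallyEq ?_).deriv
  filter_upwards [Jr.isOpen.mem_nhds hr] with t ht using hg t ht

lemma mul_deriv_laurent (hJr : (Jr : Set ℝ) ⊆ Ioi 0) (S : Finset ℤ) (c : ℤ → ℝ) {g : ℝ → ℝ}
    (hg : ∀ r ∈ Jr, g r = ∑ n ∈ S, c n * r ^ n) {r : ℝ} (hr : r ∈ Jr) :
    r * deriv g r = ∑ n ∈ S, (n * c n) * r ^ n := by
  rw [deriv_laurent hJr S c hg hr, Finset.mul_sum]
  refine Finset.sum_congr rfl fun n _ => ?_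
  have h0 : r ≠ 0 := (hJr hr).ne'
  rw [zpow_sub_one₀ h0]
  field_simp

lemma sq_mul_deriv_deriv_laurent (hJr : (Jr : Set ℝ) ⊆ Ioi 0) (S : Finset ℤ) (c : ℤ → ℝ)
    {g : ℝ → ℝ} (hg : ∀ r ∈ Jr, g r = ∑ n ∈ S, c n * r ^ n) {r : ℝ} (hr : r ∈ Jr) :
    r ^ 2 * deriv (deriv g) r = ∑ n ∈ S, (n * (n - 1) * c n) * r ^ n := by
  have h1 : deriv (deriv g) r = ∑ n ∈ S, c n * (n * (((n - 1 : ℤ) : ℝ) * r ^ (n - 1 - 1))) := by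
    refine (HasDerivAt.congr_of_eventuallyEq (HasDerivAt.fun_sum fun n _ =>
      (((hasDerivAt_zpow (n - 1) r (Or.inl (hJr hr).ne')).const_mul (n : ℝ)).const_mul (c n)))
      ?_).deriv
    filter_upwards [Jr.isOpen.mem_nhds hr] with t ht using deriv_laurent hJr S c hg ht
  rw [h1, Finset.mul_sum]
  refine Finset.sum_congr rfl fun n _ => ?_
  have h0 : r ≠ 0 := (hJr hr).ne'
  rw [zpow_sub_one₀ h0, zpow_sub_one₀ h0]
  push_cast
  field_simp

namespace PowerSeriesMass

variable {S : Finset ℤ} {a : ℤ → ℝ → ℝ → ℝ}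

lemma mono (L : PowerSeriesMass Jv Jr Jy m S a) {Jv' Jr' Jy' : TopologicalSpace.Opens ℝ}
    (hv : Jv' ≤ Jv) (hr : Jr' ≤ Jr) (hy : Jy' ≤ Jy) : PowerSeriesMass Jv' Jr' Jy' m S a :=
  ⟨fun n => ContDiffOn.mono (L.smooth n) (prod_mono hv (prod_mono hr hy)), L.support,
    fun v h1 r h2 y h3 => L.eq v (hv h1) r (hr h2) y (hy h3)⟩

lemma dy_eq (L : PowerSeriesMass Jv Jr Jy m S a) {v r y : ℝ} (hv : v ∈ Jv) (hr : r ∈ Jr)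
    (hy : y ∈ Jy) : dy m v r y = ∑ n ∈ S, deriv (a n v) y * r ^ n := by
  refine (HasDerivAt.congr_of_eventuallyEq (HasDerivAt.fun_sum fun n _ =>
    ((L.smooth n).hasDerivAt_y hv hr hy).mul_const (r ^ n)) ?_).deriv
  filter_upwards [Jy.isOpen.mem_nhds hy] with t ht using L.eq v hv r hr t ht

end PowerSeriesMass

end

end WarpedVaidya

/-! ### Equations for the Laurent coefficients of the mass, and the case k = 0 -/

namespace WarpedVaidya

noncomputable section

variable {Jv Jr Jy : TopologicalSpace.Opens ℝ} {A : ℝ → ℝ} {m φ χ F : ℝ → ℝ → ℝ → ℝ}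
  {S : Finset ℤ} {a : ℤ → ℝ → ℝ → ℝ}

open SmoothAlg

namespace Solution

lemma eval_r (H : Solution Jv Jr Jy A m φ χ F) {v r y : ℝ} (hv : v ∈ Jv) (hr : r ∈ Jr)
    (hy : y ∈ Jy) : eval (boxPoint hv hr hy) H.system.r = r := rfl

lemma eval_m (H : Solution Jv Jr Jy A m φ χ F) {v r y : ℝ} (hv : v ∈ Jv) (hr : r ∈ Jr)
    (hy : y ∈ Jy) : eval (boxPoint hv hr hy) H.system.m = m v r y := rfl

lemma eval_F (H : Solution Jv Jr Jy A m φ χ F) {v r y : ℝ} (hv : v ∈ Jv) (hr : r ∈ Jr)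
    (hy : y ∈ Jy) : eval (boxPoint hv hr hy) H.system.F = F v r y := rfl

lemma system_Dy_m (H : Solution Jv Jr Jy A m φ χ F) : H.system.Dy H.system.m = H.mass.dy.toAlg :=
  H.mass.Dy_toAlg

lemma system_Dr_m (H : Solution Jv Jr Jy A m φ χ F) : H.system.Dr H.system.m = H.mass.dr.toAlg :=
  H.mass.Dr_toAlg

lemma system_Dr_Dr_m (H : Solution Jv Jr Jy A m φ χ F) :
    H.system.Dr (H.mass.dr.toAlg) = H.mass.dr.dr.toAlg := H.mass.dr.Dr_toAlg

lemma system_Dr_Dy_m (H : Solution Jv Jr Jy A m φ χ F) :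
    H.system.Dr (H.mass.dy.toAlg) = H.mass.dy.dr.toAlg := H.mass.dy.Dr_toAlg

lemma system_Dy_Dr_m (H : Solution Jv Jr Jy A m φ χ F) :
    H.system.Dy (H.mass.dr.toAlg) = H.mass.dy.dr.toAlg := by
  rw [← system_Dr_m H, H.system.yr, system_Dy_m, system_Dr_Dy_m]

/-- The radial equation for the coefficients of the mass at fixed `(v, y)`. -/
lemma exists_radial_eq (H : Solution Jv Jr Jy A m φ χ F) (hJr : (Jr : Set ℝ).OrdConnected)
    (L : PowerSeriesMass Jv Jr Jy m S a) (hW : H.system.MassEquation) {v r₀ y : ℝ} (hv : v ∈ Jv)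
    (hr₀ : r₀ ∈ Jr) (hy : y ∈ Jy) (b : ℤ → ℝ) (hb : b = fun n => deriv (a n v) y) :
    ∃ (K α β α' β' ε c₀ c₂ c₃ c₄ : ℝ) (T : ℝ → ℝ),
    (∀ r ∈ Jr, T r = ε * (α' * ∑ n ∈ S, a n v y * r ^ n + α * ∑ n ∈ S, b n * r ^ n
        + (α' + r * β') * ∑ n ∈ S, (n * a n v y) * r ^ n
        + (α + r * β) * ∑ n ∈ S, (n * b n) * r ^ n)
      + c₀ + c₂ * r ^ 2 + c₃ * r ^ 3 + c₄ * r ^ 4) ∧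
    ∀ r ∈ Jr,
      16 * ((fn H.system.k v r₀ y + r ^ 3 * K) * (∑ n ∈ S, b n * r ^ n)
          * (∑ n ∈ S, (n * (3 - n) * a n v y) * r ^ n)
        + (3 * r ^ 3 * K * (∑ n ∈ S, b n * r ^ n)
            - (fn H.system.k v r₀ y + r ^ 3 * K)
              * ((∑ n ∈ S, b n * r ^ n) + ∑ n ∈ S, (n * b n) * r ^ n))
          * ((∑ n ∈ S, ((3 - n) * a n v y) * r ^ n) - r)) =
      48 * α * r ^ 3 * (∑ n ∈ S, b n * r ^ n) ^ 2 - r ^ 3 * (∑ n ∈ S, b n * r ^ n) * T r := by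
  obtain ⟨hA, -, ε, c₀, c₂, c₃, c₄, hε, h₀, h₂, h₃, h₄, hs⟩ := hW
  have hαy : H.system.Dr (H.system.Dy H.system.α) = 0 := by
    rw [← H.system.yr, hA.r_α, map_zero]
  have hβy : H.system.Dr (H.system.Dy H.system.β) = 0 := by
    rw [← H.system.yr, hA.r_β, map_zero]
  have indep : ∀ {x : SmoothAlg (box Jv Jr Jy)}, H.system.Dr x = 0 → ∀ {r : ℝ} (hr : r ∈ Jr),
      eval (boxPoint hv hr hy) x = fn x v r₀ y := fun {x} hx {r} hr => by
    rw [eval_eq_of_Dr_eq_zero hJr hx hv hr hr₀ hy, eval_eq_fn]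
  have em : ∀ r ∈ Jr, m v r y = ∑ n ∈ S, a n v y * r ^ n := fun r hr => L.eq v hv r hr y hy
  have emy : ∀ r ∈ Jr, dy m v r y = ∑ n ∈ S, b n * r ^ n := fun r hr => by
    rw [hb]; exact L.dy_eq hv hr hy
  have emr : ∀ r ∈ Jr, r * dr m v r y = ∑ n ∈ S, (n * a n v y) * r ^ n := fun r hr =>
    mul_deriv_laurent H.pos S (fun n => a n v y) em hr
  have emry : ∀ r ∈ Jr, r * dr (dy m) v r y = ∑ n ∈ S, (n * b n) * r ^ n := fun r hr =>
    mul_deriv_laurent H.pos S b emy hr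
  have emrr : ∀ r ∈ Jr, r ^ 2 * dr (dr m) v r y = ∑ n ∈ S, (n * (n - 1) * a n v y) * r ^ n :=
    fun r hr => sq_mul_deriv_deriv_laurent H.pos S (fun n => a n v y) em hr
  have eq₁ : ∀ r ∈ Jr, ∑ n ∈ S, ((3 - n) * a n v y) * r ^ n = 3 * m v r y - r * dr m v r y := by
    intro r hr
    rw [em r hr, emr r hr, Finset.mul_sum, ← Finset.sum_sub_distrib]
    exact Finset.sum_congr rfl fun n _ => by ring
  have eq₂ : ∀ r ∈ Jr, ∑ n ∈ S, (n * (3 - n) * a n v y) * r ^ n =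
      2 * (r * dr m v r y) - r ^ 2 * dr (dr m) v r y := by
    intro r hr
    rw [emrr r hr, emr r hr, Finset.mul_sum, ← Finset.sum_sub_distrib]
    exact Finset.sum_congr rfl fun n _ => by ring
  have hR := H.system.radial_eq _ _ _ rfl rfl rfl
  simp only [Derivation.leibniz, smul_eq_mul, H.system.r_r, system_Dy_m, system_Dr_m,
    system_Dr_Dr_m, system_Dr_Dy_m] at hR
  simp only [map_add, Derivation.leibniz, smul_eq_mul, H.system.y_r, system_Dy_m,
    system_Dr_m, system_Dy_Dr_m] at hs
  refine ⟨fn H.system.K v r₀ y, fn H.system.α v r₀ y, fn H.system.β v r₀ y,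
    fn (H.system.Dy H.system.α) v r₀ y, fn (H.system.Dy H.system.β) v r₀ y, fn ε v r₀ y,
    fn c₀ v r₀ y, fn c₂ v r₀ y, fn c₃ v r₀ y, fn c₄ v r₀ y, _, fun r _ => rfl, fun r hr => ?_⟩
  have hR' := congrArg (eval (boxPoint hv hr hy)) hR
  have hs' := congrArg (eval (boxPoint hv hr hy)) hs
  simp only [map_add, map_sub, map_mul, map_pow, map_ofNat, map_zero, map_one, H.eval_r hv hr hy,
    H.eval_m hv hr hy, H.mass.dy.eval_toAlg hv hr hy, H.mass.dr.eval_toAlg hv hr hy,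
    H.mass.dr.dr.eval_toAlg hv hr hy, H.mass.dy.dr.eval_toAlg hv hr hy, indep hA.r_k hr,
    indep hA.r_K hr, indep hA.r_α hr, indep hA.r_β hr, indep hαy hr, indep hβy hr, indep hε hr,
    indep h₀ hr, indep h₂ hr, indep h₃ hr, indep h₄ hr] at hR' hs'
  rw [eq₁ r hr, eq₂ r hr, ← em r hr, ← emr r hr, ← emy r hr, ← emry r hr]
  -- The factor 16 produces 48 s r m_y on the right of the radial equation, which the source
  -- equation replaces by T.
  linear_combination 16 * hR' - r ^ 3 * dy m v r y * hs'

/-- Where k ≠ 0, which is an open condition, one can choose y such that every vanishing coefficient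
also has vanishing y-derivative. Then the lowest-order comparison applies and yields rigid
coefficients, which are excluded. -/
lemma k_eq_zero (H : Solution Jv Jr Jy A m φ χ F) (hJr : (Jr : Set ℝ).OrdConnected)
    (L : PowerSeriesMass Jv Jr Jy m S a) (hW : H.system.MassEquation)
    (hne : ∀ v ∈ Jv, ∀ y ∈ Jy, ∃ r ∈ Jr, dy m v r y ≠ 0)
    (hC : ∀ v ∈ Jv, ∀ y ∈ Jy, ¬ RigidCoefficients S fun n => a n v y) : H.system.k = 0 := by
  refine ext_eval fun v r₀ y hv hr₀ hy => ?_
  rw [eval_eq_fn, map_zero]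
  by_contra hk
  have hinf : (Jr : Set ℝ).Infinite := infinite_of_mem_nhds r₀ (Jr.isOpen.mem_nhds hr₀)
  have hc : ContinuousOn (fun t => fn H.system.k v r₀ t) Jy := fun t ht =>
    ((smoothOn_fn H.system.k).hasDerivAt_y hv hr₀ ht).continuousAt.continuousWithinAt
  obtain ⟨y', hy', hgood⟩ := exists_generic_point S (fun n => a n v) (fun n => deriv (a n v))
    (hc.isOpen_inter_preimage Jy.isOpen isOpen_compl_singleton) ⟨y, hy, hk⟩
    (fun n _ t ht => (L.smooth n).hasDerivAt_y hv hr₀ ht.1)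
  obtain ⟨K, α, β, α', β', ε, c₀, c₂, c₃, c₄, T, hT, heq⟩ :=
    H.exists_radial_eq hJr L hW hv hr₀ hy'.1 _ rfl
  have hb0 : ∀ n, a n v y' = 0 → deriv (a n v) y' = 0 := by
    intro n hn
    by_cases h : n ∈ S
    · exact hgood n h hn
    · have : a n v = fun _ => 0 := funext fun t => L.support n h v t
      rw [this, deriv_const]
  refine hC v hv y' hy'.1 (rigidCoefficients_of_radial_eq H.pos hinf S (fun n => a n v y') _
    (fun n hn => L.support n hn v y') hb0 ?_ _ K α β α' β' ε c₀ c₂ c₃ c₄ hy'.2 T hT heq)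
  obtain ⟨r, hr, h⟩ := hne v hv y' hy'.1
  by_contra h0
  push Not at h0
  refine h ?_
  rw [L.dy_eq hv hr hy'.1]
  exact Finset.sum_eq_zero fun n _ => by rw [h0 n, zero_mul]

lemma coupling_eq (H : Solution Jv Jr Jy A m φ χ F) (hk : H.system.k = 0) :
    3 * (H.system.Dy H.system.m * H.system.F) = H.system.r ^ 2 * H.system.K := by
  have h := hk
  rw [ReducedSystem.k] at h
  refine sub_eq_zero.1 (H.system.eq_zero_of_r_mul ?_)
  linear_combination h

/-- K is independent of r, so a zero of K would give m_y F = 0 on a whole radial line, although F ≠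
0 and m_y ≠ 0 somewhere on it. -/
lemma K_ne_zero (H : Solution Jv Jr Jy A m φ χ F) (hJr : (Jr : Set ℝ).OrdConnected)
    (hW : H.system.MassEquation) (hk : H.system.k = 0)
    (hne : ∀ v ∈ Jv, ∀ y ∈ Jy, ∃ r ∈ Jr, dy m v r y ≠ 0) {v r y : ℝ} (hv : v ∈ Jv) (hr : r ∈ Jr)
    (hy : y ∈ Jy) : eval (boxPoint hv hr hy) H.system.K ≠ 0 := by
  intro h
  obtain ⟨r', hr', h'⟩ := hne v hv y hy
  rw [eval_eq_of_Dr_eq_zero hJr hW.adapted.r_K hv hr hr' hy] at h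
  have h1 := congrArg (eval (boxPoint hv hr' hy)) (H.coupling_eq hk)
  rw [map_mul _ (_ ^ 2), h, mul_zero, system_Dy_m, map_mul, map_mul, map_ofNat,
    H.mass.dy.eval_toAlg, eval_F] at h1
  simp [h', H.F_ne v hv r' hr' y hy] at h1

/-- If the coupling depends on `v` somewhere on a line in the direction of `v`, then `F` is a
monomial of degree at most one in `r` somewhere on an arbitrary open part of this line. -/
lemma exists_dr_dr_eq_zero (H : Solution Jv Jr Jy A m φ χ F) (hJr : (Jr : Set ℝ).OrdConnected)
    (L : PowerSeriesMass Jv Jr Jy m S a) (hW : H.system.MassEquation) (hk : H.system.k = 0)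
    (hne : ∀ v ∈ Jv, ∀ y ∈ Jy, ∃ r ∈ Jr, dy m v r y ≠ 0)
    {O : Set ℝ} (hO : IsOpen O) (hOv : O ⊆ Jv) (hOne : O.Nonempty) {r₀ y : ℝ} (hr₀ : r₀ ∈ Jr)
    (hy : y ∈ Jy) (hαβ : ∀ v ∈ O, fn H.system.α v r₀ y ≠ 0 ∨ fn H.system.β v r₀ y ≠ 0) : ∃ v ∈ O, ∀ r ∈ Jr, dr (dr F) v r y = 0 := by
  have hinf : (Jr : Set ℝ).Infinite := infinite_of_mem_nhds r₀ (Jr.isOpen.mem_nhds hr₀)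
  obtain ⟨v, hvO, hgood⟩ := exists_generic_point S (fun n v => deriv (a n v) y)
    (fun n v => dv (dy (fun v _ y => a n v y)) v r₀ y) hO hOne
    (fun n _ t ht => (L.smooth n).dy.hasDerivAt_v (hOv ht) hr₀ hy)
  have hv := hOv hvO
  set b : ℤ → ℝ := fun n => deriv (a n v) y with hb
  set b' : ℤ → ℝ := fun n => dv (dy (fun v _ y => a n v y)) v r₀ y with hb'
  have hbS : ∀ n ∉ S, b n = 0 := fun n hn => by
    have : a n v = fun _ => 0 := funext fun t => L.support n hn v t
    rw [hb]
    simp only [this, deriv_const]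
  have hb0 : ∀ n, b n = 0 → b' n = 0 := by
    intro n hn
    by_cases h : n ∈ S
    · exact hgood n h hn
    · have : ∀ v, a n v = fun _ => 0 := fun v => funext fun t => L.support n h v t
      simp [hb', WarpedVaidya.dv, WarpedVaidya.dy, this]
  have emy : ∀ r ∈ Jr, dy m v r y = ∑ n ∈ S, b n * r ^ n := fun r hr => L.dy_eq hv hr hy
  have emvy : ∀ r ∈ Jr, WarpedVaidya.dv (WarpedVaidya.dy m) v r y = ∑ n ∈ S, b' n * r ^ n := by
    intro r hr
    refine (HasDerivAt.congr_of_eventuallyEq (HasDerivAt.fun_sum fun n _ =>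
      ((L.smooth n).dy.hasDerivAt_v hv hr₀ hy).mul_const (r ^ n)) ?_).deriv
    filter_upwards [Jv.isOpen.mem_nhds hv] with t ht using L.dy_eq ht hr hy
  have hc := H.coupling_eq hk
  have hcv := congrArg H.system.Dv hc
  have hα : H.system.Dv H.system.F = H.system.α + H.system.r * H.system.β := by
    rw [ReducedSystem.α]; ring
  simp only [Derivation.leibniz, Derivation.leibniz_pow, ReducedSystem.map_three, H.system.v_r, hα,
    smul_eq_mul, smul_zero, mul_zero, add_zero, system_Dy_m,
    show H.system.Dv H.mass.dy.toAlg = H.mass.dy.dv.toAlg from H.mass.dy.Dv_toAlg] at hcv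
  rw [system_Dy_m] at hc
  have hKv : H.system.Dr (H.system.Dv H.system.K) = 0 := by
    rw [← H.system.vr, hW.adapted.r_K, map_zero]
  have indep : ∀ {x : SmoothAlg (box Jv Jr Jy)}, H.system.Dr x = 0 → ∀ {r : ℝ} (hr : r ∈ Jr),
      eval (boxPoint hv hr hy) x = fn x v r₀ y := fun {x} hx {r} hr => by
    rw [eval_eq_of_Dr_eq_zero hJr hx hv hr hr₀ hy, eval_eq_fn]
  have hK0 : fn H.system.K v r₀ y ≠ 0 := by
    rw [← eval_eq_fn _ hv hr₀ hy]
    exact H.K_ne_zero hJr hW hk hne hv hr₀ hy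
  have hc' : ∀ r ∈ Jr, 3 * (dy m v r y * F v r y) = r ^ 2 * fn H.system.K v r₀ y := by
    intro r hr
    have h1 := congrArg (eval (boxPoint hv hr hy)) hc
    simpa only [map_mul, map_pow, map_ofNat, H.eval_r hv hr hy, H.eval_F hv hr hy,
      H.mass.dy.eval_toAlg hv hr hy, indep hW.adapted.r_K hr] using h1
  -- F is eliminated between 3 m_y F = r² K and its v-derivative 3 m_vy F + 3 m_y (α + rβ) = r² K_v,
  -- which yields r² (K_v m_y − K m_vy) = 3 (α + rβ) m_y².
  have heq : ∀ r ∈ Jr, r ^ 2 * ∑ n ∈ S, (-(fn H.system.K v r₀ y * b' n)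
      + fn (H.system.Dv H.system.K) v r₀ y * b n) * r ^ n =
      (3 * fn H.system.α v r₀ y + 3 * fn H.system.β v r₀ y * r) * (∑ n ∈ S, b n * r ^ n) ^ 2 := by
    intro r hr
    have h2 := congrArg (eval (boxPoint hv hr hy)) hcv
    simp only [map_add, map_mul, map_pow, map_ofNat, H.eval_r hv hr hy, H.eval_F hv hr hy,
      H.mass.dy.eval_toAlg hv hr hy, H.mass.dy.dv.eval_toAlg hv hr hy, indep hKv hr,
      indep hW.adapted.r_α hr, indep hW.adapted.r_β hr] at h2
    have h3 : ∑ n ∈ S, (-(fn H.system.K v r₀ y * b' n) + fn (H.system.Dv H.system.K) v r₀ y * b n) * r ^ n =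
        -(fn H.system.K v r₀ y * dv (dy m) v r y) + fn (H.system.Dv H.system.K) v r₀ y * dy m v r y := by
      rw [emvy r hr, emy r hr, Finset.mul_sum, Finset.mul_sum, ← Finset.sum_neg_distrib,
        ← Finset.sum_add_distrib]
      exact Finset.sum_congr rfl fun n _ => by ring
    rw [h3, ← emy r hr]
    linear_combination -dy m v r y * h2 + dv (dy m) v r y * hc' r hr
  have hF : ∃ c₀ c₁ : ℝ, ∀ r ∈ Jr, F v r y = c₀ + c₁ * r := by
    have mono : ∀ i, (∀ n, b n ≠ 0 → n = i) → ∀ r ∈ Jr, dy m v r y = b i * r ^ i := by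
      intro i hi r hr
      rw [emy r hr]
      refine Finset.sum_eq_single i (fun n _ hn => ?_) (fun h => ?_)
      · rw [by_contra fun h => hn (hi n h), zero_mul]
      · rw [hbS i h, zero_mul]
    obtain ⟨r', hr', h'⟩ := hne v hv y hy
    rcases support_of_riccati H.pos hinf S b _ hbS (fun n hn => by simp [hn, hb0 n hn]) _ _ (by
      have := hαβ v hvO
      rcases this with h | h
      · exact Or.inl (mul_ne_zero three_ne_zero h)
      · exact Or.inr (mul_ne_zero three_ne_zero h)) heq with h | h
    -- With m_y = b r² the coupling is K / (3b); with m_y = b r it is K r / (3b). In both cases it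
    -- is affine in r.
    · have hm := mono 2 h
      have hb2 : b 2 ≠ 0 := fun h0 => h' (by rw [hm r' hr', h0, zero_mul])
      refine ⟨fn H.system.K v r₀ y / (3 * b 2), 0, fun r hr => ?_⟩
      have h1 := hc' r hr
      have hr0 : r ≠ 0 := (H.pos hr).ne'
      rw [hm r hr, show (2 : ℤ) = ((2 : ℕ) : ℤ) by norm_num, zpow_natCast] at h1
      push_cast at h1
      field_simp
      refine mul_left_cancel₀ (pow_ne_zero 2 hr0) ?_
      linear_combination h1
    · have hm := mono 1 h
      have hb1 : b 1 ≠ 0 := fun h0 => h' (by rw [hm r' hr', h0, zero_mul])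
      refine ⟨0, fn H.system.K v r₀ y / (3 * b 1), fun r hr => ?_⟩
      have h1 := hc' r hr
      have hr0 : r ≠ 0 := (H.pos hr).ne'
      rw [hm r hr, zpow_one] at h1
      field_simp
      refine mul_left_cancel₀ hr0 ?_
      linear_combination h1
  obtain ⟨c₀, c₁, hF⟩ := hF
  have hF1 : ∀ r ∈ Jr, dr F v r y = c₁ := fun r hr => by
    have h1 : HasDerivAt (fun t : ℝ => c₀ + c₁ * t) c₁ r := by
      simpa using ((hasDerivAt_id r).const_mul c₁).const_add c₀
    refine (h1.congr_of_eventuallyEq ?_).deriv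
    filter_upwards [Jr.isOpen.mem_nhds hr] with t ht using hF t ht
  refine ⟨v, hvO, fun r hr => ?_⟩
  refine ((hasDerivAt_const r c₁).congr_of_eventuallyEq ?_).deriv
  filter_upwards [Jr.isOpen.mem_nhds hr] with t ht using hF1 t ht

end Solution

end

end WarpedVaidya

/-! ### Rigidity of the coefficients wherever the mass depends on y -/

namespace WarpedVaidya

noncomputable section

variable {Jv Jr Jy : TopologicalSpace.Opens ℝ} {A : ℝ → ℝ} {m φ χ F : ℝ → ℝ → ℝ → ℝ}
  {S : Finset ℤ} {a : ℤ → ℝ → ℝ → ℝ}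

open SmoothAlg

lemma SmoothOn.exists_opens_ne_zero {g : ℝ → ℝ → ℝ → ℝ} (hg : SmoothOn Jv Jr Jy g) {v r y : ℝ}
    (hv : v ∈ Jv) (hr : r ∈ Jr) (hy : y ∈ Jy) (h : g v r y ≠ 0) :
    ∃ Jv' ≤ Jv, ∃ Jy' ≤ Jy, v ∈ Jv' ∧ y ∈ Jy' ∧ ∀ v' ∈ Jv', ∀ y' ∈ Jy', g v' r y' ≠ 0 := by
  have hc : ContinuousAt (fun p : ℝ × ℝ => g p.1 r p.2) (v, y) :=
    ContinuousAt.comp (x := (v, y)) (f := fun p : ℝ × ℝ => (p.1, r, p.2))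
      (g := fun p : ℝ × ℝ × ℝ => g p.1 p.2.1 p.2.2) (hg.differentiableAt hv hr hy).continuousAt
      (by fun_prop)
  have h1 := hc.eventually_ne h
  obtain ⟨u, w, hu, hvu, hw, hyw, hsub⟩ := mem_nhds_prod_iff'.1 h1
  refine ⟨Jv ⊓ ⟨u, hu⟩, inf_le_left, Jy ⊓ ⟨w, hw⟩, inf_le_left, ⟨hv, hvu⟩, ⟨hy, hyw⟩,
    fun v' hv' y' hy' => ?_⟩
  exact hsub (mk_mem_prod hv'.2 hy'.2)

namespace Solution

/-- Without radial dependence of the fields, `of_no_radial` would give m_y = 0. Applied to smaller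
boxes, this makes the points with radial dependence dense where m_y ≠ 0. -/
lemma exists_radial_ne_zero (H : Solution Jv Jr Jy A m φ χ F)
    (hne : ∀ v ∈ Jv, ∀ y ∈ Jy, ∃ r ∈ Jr, dy m v r y ≠ 0) {v y : ℝ} (hv : v ∈ Jv) (hy : y ∈ Jy) :
    ∃ v ∈ Jv, ∃ r ∈ Jr, ∃ y ∈ Jy, dr φ v r y * dr φ v r y + dr χ v r y * dr χ v r y ≠ 0 := by
  by_contra h
  push Not at h
  obtain ⟨r, hr, h'⟩ := hne v hv y hy
  refine h' ((H.of_no_radial ?_ ?_).2.1 v hv r hr y hy) <;>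
  · intro v hv r hr y hy
    nlinarith [h v hv r hr y hy, mul_self_nonneg (dr φ v r y), mul_self_nonneg (dr χ v r y)]

/-- If no coefficients are rigid, then k = 0. Where (α, β) ≠ 0, the Riccati argument produces a
point with F_rr = 0 among points with φ_r² + χ_r² ≠ 0, against the rr equation. So F_v = 0 and K =
0, which contradicts m_y ≠ 0. -/
lemma exists_rigidCoefficients_of_massEquation (H : Solution Jv Jr Jy A m φ χ F)
    (hJr : (Jr : Set ℝ).OrdConnected) (L : PowerSeriesMass Jv Jr Jy m S a)
    (hW : H.system.MassEquation) (hne : ∀ v ∈ Jv, ∀ y ∈ Jy, ∃ r ∈ Jr, dy m v r y ≠ 0) {v y : ℝ}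
    (hv : v ∈ Jv) (hy : y ∈ Jy) :
    ∃ v ∈ Jv, ∃ y ∈ Jy, RigidCoefficients S fun n => a n v y := by
  by_contra hC
  push Not at hC
  have hk := H.k_eq_zero hJr L hW hne hC
  have key : ∀ x : SmoothAlg (box Jv Jr Jy), x = H.system.α ∨ x = H.system.β →
      VanishesOn Jv Jr Jy (fn x) := by
    intro x hx v hv r hr y hy
    -- The nonvanishing of x is spread to an open set of (v, y), inside which a line in the
    -- direction of v with φ_r² + χ_r² ≠ 0 on an open part is selected.
    by_contra h0
    obtain ⟨Jv', hJv', Jy', hJy', hv', hy', h'⟩ :=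
      (smoothOn_fn x).exists_opens_ne_zero hv hr hy h0
    obtain ⟨v₁, hv₁, r₁, hr₁, y₁, hy₁, h₁⟩ := (H.mono hJv' le_rfl hJy').exists_radial_ne_zero
      (fun v hv y hy => hne v (hJv' hv) y (hJy' hy)) hv' hy'
    have hc : ContinuousOn (fun t => dr φ t r₁ y₁ * dr φ t r₁ y₁ + dr χ t r₁ y₁ * dr χ t r₁ y₁)
        Jv' := fun t ht => by
      have c1 := (H.fst.dr.hasDerivAt_v (hJv' ht) hr₁ (hJy' hy₁)).continuousAt
      have c2 := (H.snd.dr.hasDerivAt_v (hJv' ht) hr₁ (hJy' hy₁)).continuousAt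
      exact ((c1.mul c1).add (c2.mul c2)).continuousWithinAt
    have hx0 : H.system.Dr x = 0 := by
      rcases hx with rfl | rfl
      exacts [hW.adapted.r_α, hW.adapted.r_β]
    obtain ⟨v₂, hv₂, h₂⟩ := H.exists_dr_dr_eq_zero hJr L hW hk hne
      (hc.isOpen_inter_preimage Jv'.isOpen isOpen_compl_singleton)
      (inter_subset_left.trans hJv') ⟨v₁, hv₁, h₁⟩ hr₁ (hJy' hy₁) (fun t ht => by
        have h2 := h' t ht.1 y₁ hy₁
        rw [← eval_eq_fn x (hJv' ht.1) hr (hJy' hy₁),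
          eval_eq_of_Dr_eq_zero hJr hx0 (hJv' ht.1) hr hr₁ (hJy' hy₁), eval_eq_fn] at h2
        rcases hx with rfl | rfl
        exacts [Or.inl h2, Or.inr h2])
    have h3 := (H.eqs v₂ (hJv' hv₂.1) r₁ hr₁ y₁ (hJy' hy₁)).rr
    rw [h₂ r₁ hr₁, add_zero] at h3
    exact hv₂.2 h3
  have zero : ∀ x : SmoothAlg (box Jv Jr Jy), VanishesOn Jv Jr Jy (fn x) → x = 0 := by
    intro x hx
    rw [← toAlg_fn x, SmoothOn.toAlg_eq_zero]
    exact hx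
  have hα := zero _ (key _ (Or.inl rfl))
  have hβ := zero _ (key _ (Or.inr rfl))
  have hF : H.system.Dv H.system.F = 0 := by
    have := hα
    rw [ReducedSystem.α, hβ, mul_zero, sub_zero] at this
    exact this
  obtain ⟨r, hr, -⟩ := hne v hv y hy
  exact H.K_ne_zero hJr hW hk hne hv hr hy (by rw [hW.K_eq_zero hF, map_zero])

lemma exists_rigidCoefficients (H : Solution Jv Jr Jy A m φ χ F)
    (hJr : (Jr : Set ℝ).OrdConnected) (L : PowerSeriesMass Jv Jr Jy m S a)
    (hφ : VanishesOn Jv Jr Jy (dv φ) ∨ VanishesOn Jv Jr Jy (dr φ) ∨ VanishesOn Jv Jr Jy (dy φ))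
    (hχ : VanishesOn Jv Jr Jy (dv χ) ∨ VanishesOn Jv Jr Jy (dr χ) ∨ VanishesOn Jv Jr Jy (dy χ))
    (hne : ∀ v ∈ Jv, ∀ y ∈ Jy, ∃ r ∈ Jr, dy m v r y ≠ 0) {v y : ℝ} (hv : v ∈ Jv) (hy : y ∈ Jy) :
    ∃ v ∈ Jv, ∃ y ∈ Jy, RigidCoefficients S fun n => a n v y := by
  rcases H.massEquation_cases hφ hχ with h | h | h
  · obtain ⟨r, hr, h'⟩ := hne v hv y hy
    exact absurd ((H.of_no_radial h.1 h.2).2.1 v hv r hr y hy) h'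
  · exact H.exists_rigidCoefficients_of_massEquation hJr L h hne hv hy
  · exact H.symm.exists_rigidCoefficients_of_massEquation hJr L h hne hv hy

/-- Wherever the mass depends on `y`, its coefficients are rigid. -/
lemma rigidCoefficients (H : Solution Jv Jr Jy A m φ χ F)
    (hJr : (Jr : Set ℝ).OrdConnected) (L : PowerSeriesMass Jv Jr Jy m S a)
    (hφ : VanishesOn Jv Jr Jy (dv φ) ∨ VanishesOn Jv Jr Jy (dr φ) ∨ VanishesOn Jv Jr Jy (dy φ))
    (hχ : VanishesOn Jv Jr Jy (dv χ) ∨ VanishesOn Jv Jr Jy (dr χ) ∨ VanishesOn Jv Jr Jy (dy χ))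
    {v r y : ℝ} (hv : v ∈ Jv) (hr : r ∈ Jr) (hy : y ∈ Jy) (hne : dy m v r y ≠ 0) :
    RigidCoefficients S fun n => a n v y := by
  -- Rigid coefficients occur in every neighbourhood of (v, y). Both conditions are closed, so they
  -- hold at the point itself.
  have sub : ∀ {Jv' Jy' : TopologicalSpace.Opens ℝ}, Jv' ≤ Jv → Jy' ≤ Jy → v ∈ Jv' → y ∈ Jy' →
      ∃ v ∈ Jv', ∃ y ∈ Jy', RigidCoefficients S fun n => a n v y := by
    intro Jv' Jy' hJv' hJy' hv' hy'
    obtain ⟨Jv₁, h1, Jy₁, h2, hv₁, hy₁, h3⟩ := (H.mass.dy).exists_opens_ne_zero hv hr hy hne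
    have i1 : Jv' ⊓ Jv₁ ≤ Jv := inf_le_left.trans hJv'
    have i2 : Jy' ⊓ Jy₁ ≤ Jy := inf_le_left.trans hJy'
    have van : ∀ {g}, VanishesOn Jv Jr Jy g →
        VanishesOn (Jv' ⊓ Jv₁ : TopologicalSpace.Opens ℝ) Jr (Jy' ⊓ Jy₁ : TopologicalSpace.Opens ℝ) g :=
      fun h v hv r hr y hy => h v (i1 hv) r hr y (i2 hy)
    obtain ⟨v₂, hv₂, y₂, hy₂, h⟩ := (H.mono i1 le_rfl i2).exists_rigidCoefficients hJr
      (L.mono i1 le_rfl i2) (hφ.imp van (Or.imp van van)) (hχ.imp van (Or.imp van van))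
      (fun v hv y hy => ⟨r, hr, h3 v hv.2 y hy.2⟩) ⟨hv', hv₁⟩ ⟨hy', hy₁⟩
    exact ⟨v₂, hv₂.1, y₂, hy₂.1, h⟩
  constructor
  · intro n hn
    by_contra h0
    obtain ⟨Jv', hJv', Jy', hJy', hv', hy', h'⟩ := (L.smooth n).exists_opens_ne_zero hv hr hy h0
    obtain ⟨v₂, hv₂, y₂, hy₂, h⟩ := sub hJv' hJy' hv' hy'
    exact h' v₂ hv₂ y₂ hy₂ (h.1 n hn)
  · by_contra h0
    push Not at h0
    -- The existence of j is expressed by the vanishing of one finite product, which is a closed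
    -- condition.
    have hs : SmoothOn Jv Jr Jy (fun v _ y => ∏ j ∈ S.filter fun j => 1 ≤ j,
        (2 * a 1 v y * j - (j + 1))) := by
      refine contDiffOn_prod fun j _ => ?_
      exact ((contDiffOn_const.mul (L.smooth 1)).mul contDiffOn_const).sub contDiffOn_const
    obtain ⟨Jv', hJv', Jy', hJy', hv', hy', h'⟩ := hs.exists_opens_ne_zero hv hr hy (by
      refine Finset.prod_ne_zero_iff.2 fun j hj => ?_
      rw [Finset.mem_filter] at hj
      exact sub_ne_zero.2 (h0 j hj.1 hj.2))
    obtain ⟨v₂, hv₂, y₂, hy₂, -, j, hj, hj1, h⟩ := sub hJv' hJy' hv' hy'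
    refine h' v₂ hv₂ y₂ hy₂ (Finset.prod_eq_zero (Finset.mem_filter.2 ⟨hj, hj1⟩) ?_)
    exact sub_eq_zero.2 h

end Solution

end

end WarpedVaidya

/-! ### Recovering Laurent coefficients from values; from the field equations to a solution -/

namespace WarpedVaidya

noncomputable section

/-- The coefficients of a Laurent polynomial are linear combinations of its values. -/
lemma exists_coefficient_weights {J : Set ℝ} (hJ : J ⊆ Ioi 0) (hJ' : J.Infinite) (S : Finset ℤ)
    {n : ℤ} (hn : n ∈ S) : ∃ (T : Finset ℝ) (w : ℝ → ℝ), (T : Set ℝ) ⊆ J ∧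
      ∀ c : ℤ → ℝ, c n = ∑ r ∈ T, w r * ∑ k ∈ S, c k * r ^ k := by
  classical
  -- Multiplication by r^M turns every sum into a polynomial of degree at most 2M, which Lagrange
  -- interpolation recovers from 2M + 1 nodes. The weights do not depend on the coefficients.
  obtain ⟨M, hM⟩ : ∃ M : ℕ, ∀ k ∈ S, |k| ≤ M := by
    refine ⟨∑ k ∈ S, k.natAbs, fun k hk => ?_⟩
    rw [Int.abs_eq_natAbs]
    exact_mod_cast Finset.single_le_sum (f := Int.natAbs) (fun _ _ => Nat.zero_le _) hk
  obtain ⟨T, hTJ, hT⟩ := hJ'.exists_subset_card_eq (2 * M + 1)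
  refine ⟨T, fun r => r ^ M * (Lagrange.basis T id r).coeff (n + M).toNat, hTJ, fun c => ?_⟩
  set p : Polynomial ℝ := ∑ k ∈ S, Polynomial.C (c k) * Polynomial.X ^ (k + M).toNat with hp
  have hdeg : p.degree < T.card := by
    rw [hp, hT]
    refine (Polynomial.degree_sum_le _ _).trans_lt ?_
    rw [Finset.sup_lt_iff (by exact WithBot.bot_lt_coe _)]
    intro k hk
    refine (Polynomial.degree_C_mul_X_pow_le _ _).trans_lt ?_
    have := abs_le.1 (hM k hk)
    exact_mod_cast (by omega : (k + M).toNat < 2 * M + 1)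
  have heval : ∀ r ∈ T, p.eval r = r ^ M * ∑ k ∈ S, c k * r ^ k := by
    intro r hr
    have h0 : r ≠ 0 := (hJ (hTJ hr)).ne'
    rw [hp, Polynomial.eval_finsetSum, Finset.mul_sum]
    refine Finset.sum_congr rfl fun k hk => ?_
    have := abs_le.1 (hM k hk)
    rw [Polynomial.eval_mul, Polynomial.eval_C, Polynomial.eval_pow, Polynomial.eval_X,
      ← zpow_natCast, Int.toNat_of_nonneg (by omega), zpow_add₀ h0, zpow_natCast]
    ring
  have hcoeff : p.coeff (n + M).toNat = c n := by
    rw [hp, Polynomial.finsetSum_coeff, Finset.sum_eq_single n]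
    · simp
    · intro k hk hkn
      have h1 := abs_le.1 (hM k hk)
      have h2 := abs_le.1 (hM n hn)
      rw [Polynomial.coeff_C_mul_X_pow, if_neg (by omega)]
    · exact fun h => absurd hn h
  have hL := Lagrange.eq_interpolate (v := id) (Function.injective_id.injOn (s := (T : Set ℝ))) hdeg
  rw [← hcoeff]
  conv_lhs => rw [hL]
  rw [Lagrange.interpolate_apply, Polynomial.finsetSum_coeff]
  refine Finset.sum_congr rfl fun r hr => ?_
  rw [Polynomial.coeff_C_mul, id, heval r hr]
  ring

variable {Jv Jr Jy : TopologicalSpace.Opens ℝ} {A : ℝ → ℝ} {m φ χ : ℝ → ℝ → ℝ → ℝ}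
  {S : Finset ℤ} {a : ℤ → ℝ → ℝ → ℝ}

lemma SmoothOn.fix_r (hm : SmoothOn Jv Jr Jy m) {r : ℝ} (hr : r ∈ Jr) :
    SmoothOn Jv Jr Jy (fun v _ y => m v r y) :=
  ContDiffOn.comp (f := fun p : ℝ × ℝ × ℝ => (p.1, r, p.2.2)) hm (by fun_prop)
    fun _ hp => ⟨hp.1, hr, hp.2.2⟩

/-- The coefficients of a smooth mass function are smooth. -/
lemma IsFinitePowerSeries.exists_powerSeriesMass (hJr : (Jr : Set ℝ) ⊆ Ioi 0)
    (hJr' : (Jr : Set ℝ).Infinite) (hm : SmoothOn Jv Jr Jy m)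
    (h : IsFinitePowerSeries Jv Jr Jy m S a) :
    ∃ a' : ℤ → ℝ → ℝ → ℝ, PowerSeriesMass Jv Jr Jy m S a' ∧
      ∀ n ∈ S, ∀ v ∈ Jv, ∀ y ∈ Jy, a' n v y = a n v y := by
  classical
  have hw := fun n (hn : n ∈ S) => exists_coefficient_weights hJr hJr' S hn
  choose! T w hT hw using hw
  have haa : ∀ n ∈ S, ∀ v ∈ Jv, ∀ y ∈ Jy, ∑ r ∈ T n, w n r * m v r y = a n v y := by
    intro n hn v hv y hy
    rw [hw n hn fun n => a n v y]
    exact Finset.sum_congr rfl fun r hr => by rw [h v hv r (hT n hn hr) y hy]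
  -- The given coefficients are not assumed smooth. As fixed combinations of values of m they become
  -- smooth, and they are set to zero outside S.
  refine ⟨fun n v y => if n ∈ S then ∑ r ∈ T n, w n r * m v r y else 0, ⟨fun n => ?_, ?_, ?_⟩, ?_⟩
  · by_cases hn : n ∈ S
    · simp only [hn, if_true]
      exact ContDiffOn.sum fun r hr => contDiffOn_const.mul (hm.fix_r (hT n hn hr))
    · simp only [hn, if_false]
      exact contDiffOn_const
  · intro n hn v y
    rw [if_neg hn]
  · intro v hv r hr y hy
    rw [h v hv r hr y hy]
    exact Finset.sum_congr rfl fun n hn => by simp only [if_pos hn, haa n hn v hv y hy]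
  · intro n hn v hv y hy
    simp only [if_pos hn, haa n hn v hv y hy]

lemma hasDerivAt_comp_eq_zero {U : Set (ℝ × ℝ)} (hU : IsOpen U) {f : ℝ → ℝ → ℝ}
    (hf : ContDiffOn ℝ ∞ (fun p : ℝ × ℝ => f p.1 p.2) U) {g h : ℝ → ℝ} {t : ℝ}
    (ht : (g t, h t) ∈ U) (hg : HasDerivAt g 0 t) (hh : HasDerivAt h 0 t) :
    deriv (fun t => f (g t) (h t)) t = 0 := by
  have h1 := ((hf.contDiffAt (hU.mem_nhds ht)).differentiableAt (by simp)).hasFDerivAt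
  have h2 := h1.comp_hasDerivAt (f := fun t => (g t, h t)) t (hg.prodMk hh)
  exact h2.deriv.trans (map_zero _)

/-- A solution of the field equations is a solution of the component equations. -/
lemma solution_of_fieldEquations (hr : (Jr : Set ℝ) ⊆ Ioi 0) (hA : ContDiffOn ℝ ∞ A Jy)
    (hA' : ∀ y ∈ Jy, deriv A y ≠ 0) (hm : SmoothOn Jv Jr Jy m) (hφ : SmoothOn Jv Jr Jy φ)
    (hχ : SmoothOn Jv Jr Jy χ) {U : Set (ℝ × ℝ)} (hU : IsOpen U) {f : ℝ → ℝ → ℝ}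
    (hf : ContDiffOn ℝ ∞ (fun p : ℝ × ℝ => f p.1 p.2) U)
    (hfU : ∀ v ∈ Jv, ∀ r ∈ Jr, ∀ y ∈ Jy, (φ v r y, χ v r y) ∈ U)
    (hf0 : ∀ v ∈ Jv, ∀ r ∈ Jr, ∀ y ∈ Jy, f (φ v r y) (χ v r y) ≠ 0)
    {V : ℝ → ℝ → ℝ} {Λ : ℝ} (hfield : FieldEquations Jv Jr Jy A m φ χ f V Λ) :
    Solution Jv Jr Jy A m φ χ (fun v r y => f (φ v r y) (χ v r y)) where
  pos := hr
  warp := hA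
  warp_ne := hA'
  mass := hm
  fst := hφ
  snd := hχ
  coupling := hf.comp (ContDiffOn.prodMk hφ hχ) fun _ hp => hfU _ hp.1 _ hp.2.1 _ hp.2.2
  F_ne := hf0
  F_v v hv r hr y hy h1 h2 := hasDerivAt_comp_eq_zero hU hf (hfU v hv r hr y hy)
    (h1 ▸ hφ.hasDerivAt_v hv hr hy) (h2 ▸ hχ.hasDerivAt_v hv hr hy)
  F_r v hv r hr y hy h1 h2 := hasDerivAt_comp_eq_zero hU hf (hfU v hv r hr y hy)
    (h1 ▸ hφ.hasDerivAt_r hv hr hy) (h2 ▸ hχ.hasDerivAt_r hv hr hy)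
  eqs _ hv _ hr' _ hy := componentEquations hA hm (fun h => lt_irrefl (0 : ℝ) (hr h)) hfield
    hv hr' hy

end

end WarpedVaidya

/-! ### The shape of the mass function and the consequences of localization -/

namespace WarpedVaidya

noncomputable section

variable {Jv Jr Jy : TopologicalSpace.Opens ℝ} {A : ℝ → ℝ} {m φ χ F : ℝ → ℝ → ℝ → ℝ}
  {S : Finset ℤ} {a : ℤ → ℝ → ℝ → ℝ}

lemma not_nonzeroOn {Jv Jr Jy : Set ℝ} {d : ℝ → ℝ → ℝ → ℝ} :
    ¬ NonzeroOn Jv Jr Jy d ↔ VanishesOn Jv Jr Jy d := by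
  simp only [NonzeroOn, VanishesOn]
  push Not
  rfl

lemma DependsOnAtMostTwo.vanishesOn {Jv Jr Jy : Set ℝ} {h : ℝ → ℝ → ℝ → ℝ}
    (h2 : DependsOnAtMostTwo Jv Jr Jy h) :
    VanishesOn Jv Jr Jy (dv h) ∨ VanishesOn Jv Jr Jy (dr h) ∨ VanishesOn Jv Jr Jy (dy h) := by
  rw [DependsOnAtMostTwo, DependsOnV, DependsOnR, DependsOnY] at h2
  rw [← not_nonzeroOn, ← not_nonzeroOn, ← not_nonzeroOn]
  tauto

lemma vanishesOn_of_not_dependsOnRY {Jv Jr Jy : Set ℝ} {h : ℝ → ℝ → ℝ → ℝ}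
    (h2 : ¬ DependsOnRY Jv Jr Jy h) :
    VanishesOn Jv Jr Jy (dr h) ∨ VanishesOn Jv Jr Jy (dy h) := by
  rw [DependsOnRY, DependsOnR, DependsOnY] at h2
  rw [← not_nonzeroOn, ← not_nonzeroOn]
  tauto

/-- A function of a real variable that takes only finitely many values near a point and is
continuous there has derivative zero. -/
lemma deriv_eq_zero_of_finite_range {g : ℝ → ℝ} {t : ℝ} (hg : ContinuousAt g t) {G : Set ℝ}
    (hG : G.Finite) (h : ∀ᶠ x in 𝓝 t, g x ∈ G) : deriv g t = 0 := by
  have h1 : ∀ᶠ x in 𝓝 t, g x ∈ (G \ {g t})ᶜ :=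
    hg.eventually ((hG.subset sdiff_subset).isClosed.isOpen_compl.mem_nhds (by simp))
  have h2 : g =ᶠ[𝓝 t] fun _ => g t := by
    filter_upwards [h, h1] with x hx hx'
    by_contra hne
    exact hx' ⟨hx, hne⟩
  rw [h2.deriv_eq, deriv_const]

namespace Solution

/-- The shape of the mass function if no field depends on `r`. -/
lemma exists_mass_eq (H : Solution Jv Jr Jy A m φ χ F) (hJr : (Jr : Set ℝ).OrdConnected)
    (hJy : (Jy : Set ℝ).OrdConnected) (hφ : VanishesOn Jv Jr Jy (dr φ))
    (hχ : VanishesOn Jv Jr Jy (dr χ)) :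
    ∃ m₀ m₁ : ℝ → ℝ, ∀ v ∈ Jv, ∀ r ∈ Jr, ∀ y ∈ Jy, m v r y = m₀ v * r ^ 3 / 3 + m₁ v := by
  by_cases hne : ∃ r₀ ∈ Jr, ∃ y₀ ∈ Jy, True
  swap
  · push Not at hne
    exact ⟨0, 0, fun v _ r hr y hy => (hne r hr y hy).elim⟩
  obtain ⟨r₀, hr₀, y₀, hy₀, -⟩ := hne
  obtain ⟨-, hmy, Q, hQ, hQr, -⟩ := H.of_no_radial hφ hχ
  -- From 2 m_r = r² Q, integration gives m = Q r³ / 6 plus a function of v, so m₀ = Q / 2; the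
  -- second function is fixed by the value at (r₀, y₀).
  refine ⟨fun v => SmoothAlg.fn Q v r₀ y₀ / 2,
    fun v => m v r₀ y₀ - SmoothAlg.fn Q v r₀ y₀ / 2 * r₀ ^ 3 / 3, fun v hv r hr y hy => ?_⟩
  have hmy' : m v r y = m v r y₀ :=
    Jy.isOpen.is_const_of_deriv_eq_zero hJy.isPreconnected
      (fun t ht => (H.mass.hasDerivAt_y hv hr ht).differentiableAt.differentiableWithinAt)
      (fun t ht => hmy v hv r hr t ht) hy hy₀
  have hd : ∀ t ∈ Jr, HasDerivAt (fun t => m v t y₀ - SmoothAlg.fn Q v r₀ y₀ / 2 * t ^ 3 / 3) 0 t := by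
    intro t ht
    have h1 := congrArg (SmoothAlg.eval (boxPoint hv ht hy₀)) hQ
    rw [H.mass.Dr_toAlg, map_mul, map_mul, map_pow, H.mass.dr.eval_toAlg, map_ofNat,
      H.eval_r, SmoothAlg.eval_eq_of_Dr_eq_zero hJr hQr hv ht hr₀ hy₀, SmoothAlg.eval_eq_fn] at h1
    refine ((H.mass.hasDerivAt_r hv ht hy₀).sub
      (((hasDerivAt_pow 3 t).const_mul _).div_const 3)).congr_deriv ?_
    push_cast
    linear_combination h1 / 2
  have := Jr.isOpen.is_const_of_deriv_eq_zero hJr.isPreconnected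
    (fun t ht => (hd t ht).differentiableAt.differentiableWithinAt)
    (fun t ht => (hd t ht).deriv) hr hr₀
  rw [hmy']
  linear_combination this

/-- A mass function that is a finite power series does not depend on `y` or is not the mass function
of a black hole. -/
lemma nonBlackHoleProfile (H : Solution Jv Jr Jy A m φ χ F)
    (hJr : (Jr : Set ℝ).OrdConnected) (hJy : (Jy : Set ℝ).OrdConnected)
    (hφ : VanishesOn Jv Jr Jy (dv φ) ∨ VanishesOn Jv Jr Jy (dr φ) ∨ VanishesOn Jv Jr Jy (dy φ))
    (hχ : VanishesOn Jv Jr Jy (dv χ) ∨ VanishesOn Jv Jr Jy (dr χ) ∨ VanishesOn Jv Jr Jy (dy χ))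
    (ha : IsFinitePowerSeries Jv Jr Jy m S a) {v : ℝ} (hv : v ∈ Jv) :
    (∀ r ∈ Jr, ∀ y ∈ Jy, dy m v r y = 0) ∨ NonBlackHoleProfile Jy S a v := by
  refine or_iff_not_imp_left.2 fun hmy => ?_
  push Not at hmy
  obtain ⟨r₀, hr₀, y₀, hy₀, h₀⟩ := hmy
  have hinf : (Jr : Set ℝ).Infinite := infinite_of_mem_nhds r₀ (Jr.isOpen.mem_nhds hr₀)
  obtain ⟨a', L, haa⟩ := ha.exists_powerSeriesMass H.pos hinf H.mass
  have hrigid := fun (r y : ℝ) (hr : r ∈ Jr) (hy : y ∈ Jy) (h : dy m v r y ≠ 0) =>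
    H.rigidCoefficients hJr L hφ hχ hv hr hy h
  have hda : ∀ n, ∀ y ∈ Jy, HasDerivAt (a' n v) (deriv (a' n v) y) y := fun n y hy =>
    (L.smooth n).hasDerivAt_y hv hr₀ hy
  -- At a y where m_y vanishes for all r, every coefficient of m_y vanishes. At any other y the
  -- coefficients are rigid nearby, so a_n takes values in the finite set of 0 and the numbers (j +
  -- 1) / (2j), and continuity makes it locally constant.
  have hd : ∀ n, ∀ y ∈ Jy, (n ≤ 0 ∨ n = 1) → deriv (a' n v) y = 0 := by
    intro n y hy hn
    by_cases hmy : ∀ r ∈ Jr, dy m v r y = 0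
    · by_cases hnS : n ∈ S
      · obtain ⟨T, w, hT, hw⟩ := exists_coefficient_weights H.pos hinf S hnS
        rw [hw fun n => deriv (a' n v) y]
        refine Finset.sum_eq_zero fun r hr => ?_
        rw [← L.dy_eq hv (hT hr) hy, hmy r (hT hr), mul_zero]
      · have : a' n v = fun _ => 0 := funext fun t => L.support n hnS v t
        rw [this, deriv_const]
    · push Not at hmy
      obtain ⟨r, hr, h⟩ := hmy
      have hev : ∀ᶠ t in 𝓝 y, RigidCoefficients S fun n => a' n v t := by
        filter_upwards [(H.mass.dy.hasDerivAt_y hv hr hy).continuousAt.eventually_ne h,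
          Jy.isOpen.mem_nhds hy] with t ht ht'
        exact hrigid r t hr ht' ht
      refine deriv_eq_zero_of_finite_range (hda n y hy).continuousAt
        (((S.image fun j : ℤ => ((j : ℝ) + 1) / (2 * j)).finite_toSet).insert 0) ?_
      filter_upwards [hev] with t ht
      rcases hn with hn | rfl
      · exact Or.inl (ht.1 n hn)
      · obtain ⟨j, hj, hj1, hjeq⟩ := ht.2
        refine Or.inr (Finset.mem_coe.2 (Finset.mem_image.2 ⟨j, hj, ?_⟩))
        have : (j : ℝ) ≠ 0 := by exact_mod_cast (by omega : j ≠ 0)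
        field_simp
        linear_combination -hjeq
  have hconst : ∀ n, (n ≤ 0 ∨ n = 1) → ∀ y ∈ Jy, a' n v y = a' n v y₀ := fun n hn y hy =>
    Jy.isOpen.is_const_of_deriv_eq_zero hJy.isPreconnected
      (fun t ht => (hda n t ht).differentiableAt.differentiableWithinAt)
      (fun t ht => hd n t ht hn) hy hy₀
  obtain ⟨hz, j, hj, hj1, hjeq⟩ := hrigid r₀ y₀ hr₀ hy₀ h₀
  have hjpos : (0 : ℝ) < j := by exact_mod_cast (by omega : (0 : ℤ) < j)
  have hc : 1 / 2 < a' 1 v y₀ := by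
    have h1 : (1 : ℝ) ≤ j := by exact_mod_cast hj1
    by_contra hle
    nlinarith
  have h1S : (1 : ℤ) ∈ S := by
    by_contra h
    rw [L.support 1 h] at hc
    norm_num at hc
  refine ⟨fun n hn hn0 y hy => ?_, h1S, a' 1 v y₀, hc, fun y hy => ?_⟩
  · rw [← haa n hn v hv y hy, hconst n (Or.inl hn0) y hy]
    exact hz n hn0
  · rw [← haa 1 h1S v hv y hy, hconst 1 (Or.inr rfl) y hy]

end Solution

lemma eventually_mem_of_not_bddAbove {J : Set ℝ} (hJ : J.OrdConnected) (hb : ¬ BddAbove J) :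
    ∀ᶠ y in atTop, y ∈ J := by
  have hne : J.Nonempty := by
    by_contra h
    rw [not_nonempty_iff_eq_empty] at h
    exact hb (h ▸ bddAbove_empty)
  obtain ⟨y₀, hy₀⟩ := hne
  filter_upwards [eventually_ge_atTop y₀] with y hy
  obtain ⟨z, hz, hyz⟩ := not_bddAbove_iff.1 hb y
  exact hJ.out hy₀ hz ⟨hy, hyz.le⟩

/-- A localized mass that does not depend on `y` vanishes. -/
lemma BraneLocalized.eq_zero (hJy : (Jy : Set ℝ).OrdConnected) (hm : SmoothOn Jv Jr Jy m)
    (hloc : BraneLocalized Jv Jr Jy m) {v r : ℝ} (hv : v ∈ Jv) (hr : r ∈ Jr)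
    (h : ∀ y ∈ Jy, dy m v r y = 0) {y : ℝ} (hy : y ∈ Jy) : m v r y = 0 := by
  refine tendsto_nhds_unique ?_ (hloc.2 v hv r hr)
  refine tendsto_const_nhds.congr' ?_
  filter_upwards [eventually_mem_of_not_bddAbove hJy hloc.1] with t ht
  exact Jy.isOpen.is_const_of_deriv_eq_zero hJy.isPreconnected
    (fun t ht => (hm.hasDerivAt_y hv hr ht).differentiableAt.differentiableWithinAt)
    (fun t ht => h t ht) hy ht

/-- The mass of a localized finite power series has no fixed linear term. -/
lemma BraneLocalized.not_nonBlackHoleProfile (hJr : (Jr : Set ℝ) ⊆ Ioi 0)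
    (hJr' : (Jr : Set ℝ).Infinite) (hJy : (Jy : Set ℝ).OrdConnected)
    (hloc : BraneLocalized Jv Jr Jy m) (ha : IsFinitePowerSeries Jv Jr Jy m S a) {v : ℝ}
    (hv : v ∈ Jv) : ¬ NonBlackHoleProfile Jy S a v := by
  rintro ⟨-, h1S, c, hc, hac⟩
  obtain ⟨T, w, hT, hw⟩ := exists_coefficient_weights hJr hJr' S h1S
  have h1 : Tendsto (fun y => ∑ r ∈ T, w r * m v r y) atTop (𝓝 (∑ r ∈ T, w r * 0)) :=
    tendsto_finsetSum _ fun r hr => (hloc.2 v hv r (hT hr)).const_mul (w r)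
  simp only [mul_zero, Finset.sum_const_zero] at h1
  -- The same combination of values of m is the coefficient a₁ = c for large y, so c would be zero.
  have h2 : Tendsto (fun y => ∑ r ∈ T, w r * m v r y) atTop (𝓝 c) := by
    refine tendsto_const_nhds.congr' ?_
    filter_upwards [eventually_mem_of_not_bddAbove hJy hloc.1] with y hy
    rw [← hac y hy, hw fun n => a n v y]
    exact Finset.sum_congr rfl fun r hr => by rw [ha v hv r (hT hr) y hy]
  have := tendsto_nhds_unique h1 h2
  linarith

end

end WarpedVaidya
theorem mainTheorem1
    -- the coordinate box: open intervals of `v`, `r > 0` and `y`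
    (Jv Jr Jy : Set ℝ)
    (hJv : IsOpen Jv) (hJv' : Jv.OrdConnected)
    (hJr : IsOpen Jr) (hJr' : Jr.OrdConnected) (hr : Jr ⊆ Ioi 0)
    (hJy : IsOpen Jy) (hJy' : Jy.OrdConnected)
    -- the warp factor, the mass function and the two scalar fields
    (A : ℝ → ℝ) (m φ χ : ℝ → ℝ → ℝ → ℝ)
    (hA : ContDiffOn ℝ ∞ A Jy) (hA' : ∀ y ∈ Jy, deriv A y ≠ 0)
    (hm : SmoothOn Jv Jr Jy m) (hφ : SmoothOn Jv Jr Jy φ) (hχ : SmoothOn Jv Jr Jy χ)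
    -- the coupling function, smooth on an open set that contains the values of the fields
    (U : Set (ℝ × ℝ)) (hU : IsOpen U) (f : ℝ → ℝ → ℝ)
    (hf : ContDiffOn ℝ ∞ (fun p : ℝ × ℝ => f p.1 p.2) U)
    (hfU : ∀ v ∈ Jv, ∀ r ∈ Jr, ∀ y ∈ Jy, (φ v r y, χ v r y) ∈ U)
    (hf0 : ∀ v ∈ Jv, ∀ r ∈ Jr, ∀ y ∈ Jy, f (φ v r y) (χ v r y) ≠ 0)
    -- the potential and the cosmological constant of the bulk
    (V : ℝ → ℝ → ℝ) (Λ : ℝ)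
    (hfield : FieldEquations Jv Jr Jy A m φ χ f V Λ)
    -- each field depends on at most two of the coordinates `v`, `r`, `y`
    (hφ2 : DependsOnAtMostTwo Jv Jr Jy φ) (hχ2 : DependsOnAtMostTwo Jv Jr Jy χ) :
    -- the field equations are inconsistent if some field depends on `r`, but none on both `r`, `y`
    ((DependsOnR Jv Jr Jy φ ∨ DependsOnR Jv Jr Jy χ) →
      ¬ DependsOnRY Jv Jr Jy φ → ¬ DependsOnRY Jv Jr Jy χ → False) ∧
    -- if no field depends on `r`, then the coupling does not depend on `v`
    -- (so that the equations are inconsistent if it does), and the mass does not depend on `y`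
    (¬ DependsOnR Jv Jr Jy φ → ¬ DependsOnR Jv Jr Jy χ →
      (∀ v ∈ Jv, ∀ r ∈ Jr, ∀ y ∈ Jy, dv (fun v r y => f (φ v r y) (χ v r y)) v r y = 0) ∧
      (∀ v ∈ Jv, ∀ r ∈ Jr, ∀ y ∈ Jy, dy m v r y = 0) ∧
      ∃ m₀ m₁ : ℝ → ℝ, ∀ v ∈ Jv, ∀ r ∈ Jr, ∀ y ∈ Jy, m v r y = m₀ v * r ^ 3 / 3 + m₁ v) ∧
    -- in all cases, if the mass function is a finite power series in `r`, then it does not depend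
    -- on `y` or does not have the profile of a black hole
    (∀ (S : Finset ℤ) (a : ℤ → ℝ → ℝ → ℝ), IsFinitePowerSeries Jv Jr Jy m S a → ∀ v ∈ Jv,
      (∀ r ∈ Jr, ∀ y ∈ Jy, dy m v r y = 0) ∨ NonBlackHoleProfile Jy S a v) ∧
    -- there is no localized black hole: a mass function localized near the brane vanishes
    ((DependsOnRY Jv Jr Jy φ ∨ DependsOnRY Jv Jr Jy χ →
        ∃ (S : Finset ℤ) (a : ℤ → ℝ → ℝ → ℝ), IsFinitePowerSeries Jv Jr Jy m S a) →
      BraneLocalized Jv Jr Jy m →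
      ∀ v ∈ Jv, ∀ r ∈ Jr, ∀ y ∈ Jy, m v r y = 0) := by 
  obtain ⟨Jv, rfl⟩ : ∃ K : TopologicalSpace.Opens ℝ, (K : Set ℝ) = Jv := ⟨⟨Jv, hJv⟩, rfl⟩
  obtain ⟨Jr, rfl⟩ : ∃ K : TopologicalSpace.Opens ℝ, (K : Set ℝ) = Jr := ⟨⟨Jr, hJr⟩, rfl⟩
  obtain ⟨Jy, rfl⟩ : ∃ K : TopologicalSpace.Opens ℝ, (K : Set ℝ) = Jy := ⟨⟨Jy, hJy⟩, rfl⟩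
  have H := solution_of_fieldEquations hr hA hA' hm hφ hχ hU hf hfU hf0 hfield
  have part1 : (DependsOnR Jv Jr Jy φ ∨ DependsOnR Jv Jr Jy χ) →
      ¬ DependsOnRY Jv Jr Jy φ → ¬ DependsOnRY Jv Jr Jy χ → False := by
    intro hR h1 h2
    have h := H.vanishesOn_radial (vanishesOn_of_not_dependsOnRY h1)
      (vanishesOn_of_not_dependsOnRY h2)
    exact hR.elim (not_nonzeroOn.2 h.1) (not_nonzeroOn.2 h.2)
  have part3 := fun (S : Finset ℤ) (a : ℤ → ℝ → ℝ → ℝ)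
    (ha : IsFinitePowerSeries Jv Jr Jy m S a) (v : ℝ) (hv : v ∈ Jv) =>
    H.nonBlackHoleProfile hJr' hJy' hφ2.vanishesOn hχ2.vanishesOn ha hv
  refine ⟨part1, fun h1 h2 => ?_, part3, fun hS hloc v hv r hr₁ y hy => ?_⟩
  · have h := H.of_no_radial (not_nonzeroOn.1 h1) (not_nonzeroOn.1 h2)
    exact ⟨h.1, h.2.1, H.exists_mass_eq hJr' hJy' (not_nonzeroOn.1 h1) (not_nonzeroOn.1 h2)⟩
  · refine hloc.eq_zero hJy' hm hv hr₁ (fun t ht => ?_) hy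
    -- If no field depends on both r and y, the first claim excludes any radial dependence and the
    -- second one applies, so no power series is needed.
    by_cases hRY : DependsOnRY Jv Jr Jy φ ∨ DependsOnRY Jv Jr Jy χ
    · obtain ⟨S, a, ha⟩ := hS hRY
      exact (part3 S a ha v hv).resolve_right (hloc.not_nonBlackHoleProfile hr
        (infinite_of_mem_nhds r (Jr.isOpen.mem_nhds hr₁)) hJy' ha hv) r hr₁ t ht
    · rw [not_or] at hRY
      have hR : ¬ (DependsOnR Jv Jr Jy φ ∨ DependsOnR Jv Jr Jy χ) := fun h =>
        part1 h hRY.1 hRY.2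
      rw [not_or] at hR
      exact (H.of_no_radial (not_nonzeroOn.1 hR.1) (not_nonzeroOn.1 hR.2)).2.1 v hv r hr₁ t ht
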